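/- **Setting.** Let $F=\Lambda^{\infty}$ be the infinite wedge space: the complex vector space with basis the symbols $v_S$, where $S\subset\mathbb Z$ contains only finitely many positive integers and misses only finitely many integers $\le 0$ (so $v_S=v_{i_m}\wedge v_{i_{m-1}}\wedge\cdots$ for $S=\{i_m>i_{m-1}>\cdots\}$). The lift $\widetilde D_r$ to $F$ of the operator $(t\frac{d}{dt})^r$ on $\mathbb C[t,t^{-1}]t^{-1/2}$, $r\ge 0$, acts diagonally, $\widetilde D_r v_S=d_r(S)v_S$, with $$d_r(S)=\sum_{m\in S,\;m>0}\left(m-\tfrac12\right)^r-\sum_{m\notin S,\;m\le 0}\left(m-\tfrac12\right)^r+(-1)^r\xi(-r),\qquad \xi(s)=(2^s-1)\zeta(s).$$ The character of the infinite wedge representation is $\Omega(\tau_0,\tau_1,\dots)=\operatorname{Trace}_F\exp\big(2\pi i\sum_{r\ge0}\tau_r\widetilde D_r\big)$, understood as a formal Taylor series in $\tau_0,\tau_2,\tau_3,\dots$ whose coefficients are functions of $\tau_1$ in the upper half-plane $\mathcal H$. Its charge-$0$ part $V(\tau_1,\tau_2,\dots)$ is the trace of $\exp\big(2\pi i\sum_{r\ge1}\tau_r\widetilde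 D_r\big)$ on $\ker\widetilde D_0$, a formal Taylor series in $\tau_2,\tau_3,\dots$. Thus $\Omega=\sum_A\omega_A(\tau_1)\tau^A/A!$ over finitely supported multi-indices $A=(a_0,a_2,a_3,\dots)$ and $V=\sum_B v_B(\tau_1)\tau^B/B!$ over finitely supported $B=(b_2,b_3,\dots)$, where $$\omega_A(\tau_1)=\sum_S e^{2\pi i\tau_1d_1(S)}\prod_{r\ne1}(2\pi i\,d_r(S))^{a_r},\qquad v_B(\tau_1)=\sum_{S:\,d_0(S)=0}e^{2\pi i\tau_1d_1(S)}\prod_{r\ge2}(2\pi i\,d_r(S))^{b_r}.$$ **Quasimodularity.** Let $\Gamma\subset\Gamma_0(4)$ be a subgroup of finite index in $SL_2(\mathbb Z)$ and $k\in\frac12\mathbb Z$. Put $j_k(\gamma,\tau)=(c\tau+d)^k$ if $k\in\mathbb Z$, and $j_k(\gamma,\tau)=(\theta(\gamma\tau)/\theta(\tau))^{2k}$ with $\theta(\tau)=\sum_{n\in\mathbb Z}e^{2\pi in^2\tau}$ if $k\notin\mathbb Z$. An almost holomorphic function is a finite sum $\sum_{m=0}^N f_m(\tau)y^{-m}$,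 $y=\operatorname{Im}\tau$, where each $f_m$ has an expansion $f_m(\tau)=\sum_{n\ge -n_0}a_ne^{2\pi in\tau/\ell}$ converging on $\mathcal H$ for some $\ell\ge1$ and $n_0\ge 0$. An almost holomorphic modular form of weight $k$ for $\Gamma$ is an almost holomorphic function $F$ with $F(\gamma\tau)=j_k(\gamma,\tau)F(\tau)$ for all $\gamma\in\Gamma$, such that $(c\tau+d)^{-k}F(\gamma\tau)$ is almost holomorphic for every $\gamma\in SL_2(\mathbb Z)$ (so poles at the cusps are allowed). A quasimodular form of weight $k$ for $\Gamma$ is the term $f_0$ of such a form. With $\operatorname{wt}(A)=\sum_r(r+1)a_r$, a series $\sum_A f_A(\tau_1)\tau^A/A!$ is quasimodular of weight $w$ if, for some such $\Gamma$, every $f_A$ is a quasimodular form of weight $w+\operatorname{wt}(A)$ for $\Gamma$. **Theorem.** All the series defining $\omega_A$ and $v_B$ converge absolutely on $\mathcal H$. The series $\Omega(\tau_0,\tau_1,\dots)$ is quasimodular of weight $0$, and $V(\tau_1,\tau_2,\dots)$ is quasimodular of weight $-\frac12$. -/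

import Mathlib

open scoped MatrixGroups

noncomputable section

namespace InfiniteWedge

/-! ### The infinite wedge space -/

/-- The index sets of the basis vectors `v_I = v_{i_m} ∧ v_{i_{m-1}} ∧ ⋯`, where
`i_{k-1} < i_k` and `i_k = k` for `k ≪ 0`.  Such a sequence is recorded by the set
`I = {i_m, i_{m-1}, …} ⊆ ℤ`; the sets that occur are exactly those which contain only finitely
many positive integers and miss only finitely many nonpositive ones. -/
abbrev Maya : Type :=
  {S : Set ℤ // (S ∩ Set.Ioi 0).Finite ∧ (Set.Iic 0 \ S).Finite}

/-- The infinite wedge space `F = Λ^∞ V`, with basis the vectors `v_I`. -/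
abbrev Wedge : Type := Maya →₀ ℂ

/-- The basis vector `v_S`. -/
def basisVec (S : Maya) : Wedge := Finsupp.single S 1

/-- The index set obtained from `S` by replacing `i` by `j`. -/
def Maya.move (S : Maya) (i j : ℤ) : Maya :=
  ⟨insert j (S.1 \ {i}), by
    constructor
    · refine ((S.2.1).insert j).subset ?_
      rintro x ⟨hx, hx0⟩
      rcases hx with rfl | hx
      · exact Set.mem_insert _ _
      · exact Set.mem_insert_of_mem _ ⟨hx.1, hx0⟩
    · refine ((S.2.2).insert i).subset ?_
      rintro x ⟨hx0, hx⟩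
      by_cases hxi : x = i
      · exact hxi ▸ Set.mem_insert _ _
      · refine Set.mem_insert_of_mem _ ⟨hx0, fun hxS => hx ?_⟩
        exact Set.mem_insert_of_mem _ ⟨hxS, hxi⟩⟩

open Classical in
/-- The action `α₀` on `F` of the elementary matrix `E_{ij}` (with `E_{ij} v_i = v_j` and
`E_{ij} v_k = 0` for `k ≠ i`), as a derivation of the wedge product: `v_i` is replaced by `v_j`,
which is then moved past the factors with index strictly between `i` and `j`. -/
def elemAct (i j : ℤ) : Module.End ℂ Wedge :=
  Finsupp.linearCombination ℂ fun S : Maya =>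
    if i ∈ S.1 ∧ (j = i ∨ j ∉ S.1) then
      (-1 : ℂ) ^ (S.1 ∩ Set.Ioo (min i j) (max i j)).ncard • basisVec (S.move i j)
    else 0

/-- The normalization `σ(E_{ij})`: equal to `α₀(E_{ij})`, except that the identity is subtracted
when `i = j ≤ 0`. -/
def sigmaElem (i j : ℤ) : Module.End ℂ Wedge :=
  elemAct i j - (if i = j ∧ i ≤ 0 then (1 : ℂ) else 0) • (1 : Module.End ℂ Wedge)

/-- The extension of `σ` to infinite matrices `x = ∑ x_{ij} E_{ij}` supported in a bounded strip
around the diagonal; on each `v_S` only finitely many terms are nonzero. -/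
def sigma (x : ℤ → ℤ → ℂ) : Module.End ℂ Wedge :=
  Finsupp.linearCombination ℂ fun S : Maya =>
    ∑ᶠ p : ℤ × ℤ, x p.1 p.2 • sigmaElem p.1 p.2 (basisVec S)

/-- The matrix `∑_n (n - 1/2)^r E_{n,n+p}` of the differential operator `t^p (t d/dt)^r` acting on
`ℂ[t,t⁻¹] t^{-1/2}`, in the basis `v_n = t^{n-1/2}`. -/
def diffOpMatrix (p : ℤ) (r : ℕ) : ℤ → ℤ → ℂ := fun i j =>
  if j = i + p then ((i : ℂ) - 1 / 2) ^ r else 0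

/-- `ξ(s) = (2^s - 1) ζ(s)`, the analytic continuation of `∑_{n ≥ 1} (n - 1/2)^{-s}`. -/
def xi (s : ℂ) : ℂ := ((2 : ℂ) ^ s - 1) * riemannZeta s

/-- The lift `D̃_r` of `D_r = (t d/dt)^r`: the operator `σ(D_r)` corrected by the regularized
value `(-1)^r ξ(-r)` of the divergent sum `∑_{m ≤ 0} (m - 1/2)^r`. -/
def Dtilde (r : ℕ) : Module.End ℂ Wedge :=
  sigma (diffOpMatrix 0 r) + ((-1 : ℂ) ^ r * xi (-(r : ℂ))) • (1 : Module.End ℂ Wedge)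

/-- The diagonal entry of `D̃_r` at the basis vector `v_S`; by `Dtilde_basisVec` the `v_S` form a
simultaneous eigenbasis of all the `D̃_r`, so this is the eigenvalue of `D̃_r` on `v_S`. -/
def eig (r : ℕ) (S : Maya) : ℂ := Dtilde r (basisVec S) S

open Classical in
theorem sigmaElem_diag (m : ℤ) (S : Maya) :
    sigmaElem m m (basisVec S) =
      ((if m ∈ S.1 then (1 : ℂ) else 0) - (if m ≤ 0 then 1 else 0)) • basisVec S := by
  have hmove : m ∈ S.1 → S.move m m = S := fun h => Subtype.ext (by
    change insert m (S.1 \ {m}) = S.1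
    rw [Set.insert_sdiff_singleton, Set.insert_eq_of_mem h])
  have h1 : elemAct m m (basisVec S) = (if m ∈ S.1 then (1 : ℂ) else 0) • basisVec S := by
    unfold elemAct
    rw [basisVec, Finsupp.linearCombination_single, one_smul]
    by_cases h : m ∈ S.1
    · simp [h, hmove h, basisVec]
    · simp [h]
  simp only [sigmaElem, LinearMap.sub_apply, LinearMap.smul_apply, h1, sub_smul, true_and,
    Module.End.one_apply]

/-- The eigenvalue of `D̃_r` on `v_S`, explicitly. -/
theorem Dtilde_basisVec_explicit (r : ℕ) (S : Maya) :
    Dtilde r (basisVec S) =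
      ((∑ m ∈ S.2.1.toFinset, ((m : ℂ) - 1 / 2) ^ r)
        - (∑ m ∈ S.2.2.toFinset, ((m : ℂ) - 1 / 2) ^ r)
        + (-1 : ℂ) ^ r * xi (-(r : ℂ))) • basisVec S := by
  classical
  have key : sigma (diffOpMatrix 0 r) (basisVec S) =
      ((∑ m ∈ S.2.1.toFinset, ((m : ℂ) - 1 / 2) ^ r)
        - (∑ m ∈ S.2.2.toFinset, ((m : ℂ) - 1 / 2) ^ r)) • basisVec S := by
    have hd : Disjoint S.2.1.toFinset S.2.2.toFinset := by
      rw [Finset.disjoint_left]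
      intro m h1 h2
      simp only [Set.Finite.mem_toFinset] at h1 h2
      exact h2.2 h1.1
    have e : sigma (diffOpMatrix 0 r) (basisVec S) =
        ∑ᶠ p : ℤ × ℤ, diffOpMatrix 0 r p.1 p.2 • sigmaElem p.1 p.2 (basisVec S) := by
      unfold sigma
      conv_lhs => rw [basisVec, Finsupp.linearCombination_single, one_smul]
    rw [e, finsum_eq_sum_of_support_subset
      (s := (S.2.1.toFinset ∪ S.2.2.toFinset).image fun m : ℤ => (m, m))]
    · rw [Finset.sum_image (by intro a _ b _ h; exact congrArg Prod.fst h),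
        Finset.sum_union hd, sub_smul, Finset.sum_smul, Finset.sum_smul, sub_eq_add_neg,
        ← Finset.sum_neg_distrib]
      congr 1
      · refine Finset.sum_congr rfl fun m hm => ?_
        rw [Set.Finite.mem_toFinset] at hm
        have h0 : ¬ m ≤ 0 := not_le.mpr hm.2
        rw [sigmaElem_diag, if_pos hm.1, if_neg h0]
        simp [diffOpMatrix]
      · refine Finset.sum_congr rfl fun m hm => ?_
        rw [Set.Finite.mem_toFinset] at hm
        have h0 : m ≤ 0 := hm.1
        rw [sigmaElem_diag, if_neg hm.2, if_pos h0]
        simp [diffOpMatrix]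
    · rintro ⟨i, j⟩ hp
      rw [Function.mem_support] at hp
      by_cases hij : j = i
      · subst hij
        simp only [sigmaElem_diag] at hp
        rw [Finset.mem_coe, Finset.mem_image]
        refine ⟨j, ?_, rfl⟩
        simp only [Finset.mem_union, Set.Finite.mem_toFinset]
        by_contra hcon
        rw [not_or] at hcon
        apply hp
        by_cases hjS : j ∈ S.1
        · have : j ≤ 0 := not_lt.mp fun h => hcon.1 ⟨hjS, h⟩
          simp [hjS, this]
        · have : ¬ j ≤ 0 := fun h => hcon.2 ⟨h, hjS⟩
          simp [hjS, this]
      · exact absurd (by simp [diffOpMatrix, hij]) hp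
  simp only [Dtilde, LinearMap.add_apply, key, LinearMap.smul_apply, Module.End.one_apply, add_smul]

theorem eig_eq (r : ℕ) (S : Maya) :
    eig r S = (∑ m ∈ S.2.1.toFinset, ((m : ℂ) - 1 / 2) ^ r)
        - (∑ m ∈ S.2.2.toFinset, ((m : ℂ) - 1 / 2) ^ r)
        + (-1 : ℂ) ^ r * xi (-(r : ℂ)) := by
  rw [eig, Dtilde_basisVec_explicit]
  simp [basisVec]

/-- The vectors `v_S` are simultaneous eigenvectors of all the operators `D̃_r`. -/
theorem Dtilde_basisVec (r : ℕ) (S : Maya) : Dtilde r (basisVec S) = eig r S • basisVec S := by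
  rw [Dtilde_basisVec_explicit, eig_eq]

/-! ### The characters, as formal power series in the `τ_r`, `r ≠ 1` -/

/-- The diagonal entry at `v_S` of the operator
`exp(2πi τ₁ D̃_1) ∏_r (2πi D̃_r)^{a_r}`, i.e. of the derivative `∂^A/∂τ^A` at
`τ_r = 0` (`r ≠ 1`) of `exp(2πi ∑_r τ_r D̃_r)`. -/
def diagEntry {P : ℕ → Prop} (A : {r : ℕ // P r} →₀ ℕ) (τ₁ : UpperHalfPlane) (S : Maya) : ℂ :=
  Complex.exp (2 * Real.pi * Complex.I * (τ₁ : ℂ) * eig 1 S) *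
    A.prod fun r a => (2 * Real.pi * Complex.I * eig r.1 S) ^ a

/-- `A! = ∏ a_r!`. -/
def multiFactorial {P : ℕ → Prop} (A : {r : ℕ // P r} →₀ ℕ) : ℕ :=
  A.prod fun _ a => a.factorial

/-- The weight `wt(A) = ∑ (r + 1) a_r` of a multi-index. -/
def wt {P : ℕ → Prop} (A : {r : ℕ // P r} →₀ ℕ) : ℕ :=
  A.sum fun r a => (r.1 + 1) * a

/-- The character `Ω(τ₀, τ₁, τ₂, …) = Trace exp(2πi ∑_{r ≥ 0} τ_r D̃_r)` of the infinite wedge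
space, as a formal power series in `τ₀, τ₂, τ₃, …` whose coefficients are functions of `τ₁`. -/
def Omega (τ₁ : UpperHalfPlane) : MvPowerSeries {r : ℕ // r ≠ 1} ℂ := fun A =>
  ((multiFactorial A : ℕ) : ℂ)⁻¹ * ∑' S : Maya, diagEntry A τ₁ S

/-- The charge zero character `V(τ₁, τ₂, …)`: the trace of `exp(2πi ∑_{r ≥ 1} τ_r D̃_r)` on the
eigenspace `D̃_0 = 0`, as a formal power series in `τ₂, τ₃, …` whose coefficients are functions
of `τ₁`. -/
def V (τ₁ : UpperHalfPlane) : MvPowerSeries {r : ℕ // 2 ≤ r} ℂ := fun B =>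
  ((multiFactorial B : ℕ) : ℂ)⁻¹ * ∑' S : {S : Maya // eig 0 S = 0}, diagEntry B τ₁ S.1

/-! ### Quasimodular forms of integral and half-integral weight -/

/-- `f` has a Fourier expansion `∑_{n ≥ -n₀} a_n e^{2πi n τ / ℓ}`, convergent on the whole upper
half-plane, with only finitely many negative exponents. (Such an `f` is holomorphic.) -/
def HasFourierExpansion (f : UpperHalfPlane → ℂ) : Prop :=
  ∃ (ℓ n₀ : ℕ) (a : ℕ → ℂ), 0 < ℓ ∧ ∀ τ : UpperHalfPlane,
    HasSum (fun n : ℕ => a n *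
      Complex.exp (2 * Real.pi * Complex.I * ((n : ℂ) - n₀) * (τ : ℂ) / ℓ)) (f τ)

/-- The function `∑_{m ≤ N} f_m(τ) y^{-m}`, where `y = Im τ`. -/
def almostHolo (N : ℕ) (f : ℕ → UpperHalfPlane → ℂ) (τ : UpperHalfPlane) : ℂ :=
  ∑ m ∈ Finset.range (N + 1), f m τ * ((τ.im : ℂ) ^ m)⁻¹

/-- Almost holomorphic functions, meromorphic at `i∞`. -/
def IsAlmostHolomorphic (F : UpperHalfPlane → ℂ) : Prop :=
  ∃ (N : ℕ) (f : ℕ → UpperHalfPlane → ℂ),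
    (∀ m, HasFourierExpansion (f m)) ∧ F = almostHolo N f

/-- `cτ + d`. -/
def cd (γ : SL(2, ℤ)) (τ : UpperHalfPlane) : ℂ := (γ 1 0 : ℂ) * (τ : ℂ) + (γ 1 1 : ℂ)

/-- The theta function `θ(τ) = ∑_{n ∈ ℤ} e^{2πi n² τ}`. -/
def theta (τ : UpperHalfPlane) : ℂ := jacobiTheta (2 * (τ : ℂ))

/-- The automorphy factor of weight `κ/2`: it is `(cτ+d)^{κ/2}` for `κ` even (integral weight), and
`(θ(γτ)/θ(τ))^κ` for `κ` odd (half-integral weight; here `γ` is to be taken in `Γ₀(4)`). -/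
def automorphy (κ : ℤ) (γ : SL(2, ℤ)) (τ : UpperHalfPlane) : ℂ :=
  if Even κ then cd γ τ ^ (κ / 2) else (theta (γ • τ) / theta τ) ^ κ

/-- `(cτ+d)^{-κ/2} F(γτ)`, with the principal branch of the power. It serves only to look at `F`
near the cusp `γ∞`, for which the choice of the branch is immaterial. -/
def slash (κ : ℤ) (γ : SL(2, ℤ)) (F : UpperHalfPlane → ℂ) (τ : UpperHalfPlane) : ℂ :=
  cd γ τ ^ (-(κ : ℂ) / 2) * F (γ • τ)

/-- `F` is an almost holomorphic modular form of weight `κ/2` for `Γ`: it transforms with weight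
`κ/2` under `Γ`, and it is almost holomorphic and meromorphic at every cusp. -/
def IsAlmostHolomorphicModular (Γ : Subgroup SL(2, ℤ)) (κ : ℤ) (F : UpperHalfPlane → ℂ) : Prop :=
  (∀ γ ∈ Γ, ∀ τ : UpperHalfPlane, F (γ • τ) = automorphy κ γ τ * F τ) ∧
  ∀ γ : SL(2, ℤ), IsAlmostHolomorphic (slash κ γ F)

/-- `φ` is a quasimodular form of weight `κ/2` for `Γ`: it is the term `f_0` of an almost
holomorphic modular form `∑ f_m y^{-m}` of weight `κ/2`. -/
def IsQuasimodular (Γ : Subgroup SL(2, ℤ)) (κ : ℤ) (φ : UpperHalfPlane → ℂ) : Prop :=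
  ∃ (N : ℕ) (f : ℕ → UpperHalfPlane → ℂ), (∀ m, HasFourierExpansion (f m)) ∧ f 0 = φ ∧
    IsAlmostHolomorphicModular Γ κ (almostHolo N f)

/-- A series `∑_A f_A(τ₁) τ^A / A!` is quasimodular of weight `w ∈ ½ℤ` if, for some subgroup `Γ`
of finite index in `SL₂(ℤ)` (taken inside `Γ₀(4)`), each `f_A` is quasimodular for `Γ` of weight
`w + wt(A)`. -/
def IsQuasimodularSeries {P : ℕ → Prop} (w : ℚ)
    (F : UpperHalfPlane → MvPowerSeries {r : ℕ // P r} ℂ) : Prop :=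
  ∃ κ : ℤ, (κ : ℚ) = 2 * w ∧
    ∃ Γ : Subgroup SL(2, ℤ), Γ.FiniteIndex ∧ Γ ≤ CongruenceSubgroup.Gamma0 4 ∧
      ∀ A : {r : ℕ // P r} →₀ ℕ,
        IsQuasimodular Γ (κ + 2 * (wt A : ℤ))
          (fun τ₁ => (multiFactorial A : ℂ) * MvPowerSeries.coeff A (F τ₁))

end InfiniteWedge

end

noncomputable section

namespace InfiniteWedge

open UpperHalfPlane hiding I
open Complex Function Polynomial

/-! ### Holomorphic functions with a Fourier expansion at `i∞` -/

/-! Every index set is the translate, by its charge n, of a unique index set of charge zero. With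
the constants ξ(-r) included, the eigenvalues are regularized power sums of the numbers m - 1/2, m ∈
S. Translation therefore changes them by the binomial formula, with one anomalous term n^(r+1)/(r+1)
(`powSum_add`, `powSum_shift_zpow`); on charge zero, d_1 gains n²/2. Consequently the trace over all
S of a polynomial in the power sums, twisted by characteristics (a, b), is a finite sum ∑_j θ_j ·
tr_j, where θ_j is the theta constant `thetaCoeff a b j` and tr_j is the charge zero trace of the
j-th coefficient of the translated polynomial (`hasSum_twistedTerm`). The case a = b = 0 expresses Ω
through charge zero traces, so the difficulty lies in V.

For V take a = b = 1/2. The position m = 0 then contributes 0^r = 0 to every power sum with r ≥ 1,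
so adding or removing it only reverses the sign (-1)^charge, and the twisted trace of a monomial
without X_0 vanishes (`sum_thetaCoeff_mul_trace_eq_zero`). Here θ_0 = 0, and θ_1 is a nonzero
multiple of η³. The relation can thus be solved for tr_1 in terms of traces of lower weight, with
only powers of η in the denominator (`trace_lowering_mem`). The linear part of the translation is a
derivation with X_{s+1} ↦ (s+1) X_s, and X_0 acts by zero on charge zero. These two facts allow
every monomial to be reached by induction (`trace_monomial_single_add_mem`), starting from tr(1) =
const/η (`trace_one_mem`).

The modular input is that exp(πX²/(2y)) times the theta series, divided by η, is permuted by S and T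
up to roots of unity as the half-integral characteristics vary. Its Taylor coefficients are
polynomials in 1/y with constant term a multiple of θ_j/η, so θ_j is quasimodular of weight j + 1/2
(`thetaCoeff_mem_quasi`). Finiteness of the permuted set makes the stabilizers of finite index
(`finiteIndex_fixer`). All weights are reduced to zero by dividing by powers of η; quasimodular
functions of weight zero form an algebra. The half-integral automorphy factor is recovered because
θ/η is invariant under `level` and θ has no zeros (`isQuasimodular_of_mem_quasi`). -/

/-- Holomorphic functions on the upper half-plane which are invariant under some integral
translation and grow at most exponentially at `i∞`. -/
structure IsPeriodicHolo (f : ℍ → ℂ) : Prop where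
  holo : DifferentiableOn ℂ (f ∘ ofComplex) {z | 0 < z.im}
  periodic : ∃ l : ℕ, 0 < l ∧ ∀ τ : ℍ, f ((l : ℝ) +ᵥ τ) = f τ
  growth : ∃ C c : ℝ, ∀ τ : ℍ, 1 ≤ τ.im → ‖f τ‖ ≤ C * Real.exp (c * τ.im)

theorem periodic_comp_ofComplex {f : ℍ → ℂ} {l : ℝ} (h : ∀ τ : ℍ, f (l +ᵥ τ) = f τ) :
    Periodic (f ∘ ofComplex) (l : ℂ) := by
  intro z
  by_cases hz : 0 < z.im
  · have hz' : 0 < (z + (l : ℂ)).im := by simpa using hz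
    simp only [comp_apply, ofComplex_apply_of_im_pos hz, ofComplex_apply_of_im_pos hz']
    rw [← h ⟨z, hz⟩]
    congr 1
    ext
    simp [add_comm]
  · have hz' : (z + (l : ℂ)).im ≤ 0 := by simpa using hz
    simp only [comp_apply, ofComplex_apply_of_im_nonpos (not_lt.mp hz),
      ofComplex_apply_of_im_nonpos hz']

/-- Boundedness near i∞ removes the singularity at q = 0, so the function of q is holomorphic on the
whole unit disc and its Taylor series at 0 converges there. -/
theorem hasSum_cuspFunction {g : ℍ → ℂ} {l : ℕ} (hl : 0 < l)
    (hd : DifferentiableOn ℂ (g ∘ ofComplex) {z | 0 < z.im})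
    (hp : ∀ τ : ℍ, g ((l : ℝ) +ᵥ τ) = g τ) {C : ℝ} (hb : ∀ τ : ℍ, 1 ≤ τ.im → ‖g τ‖ ≤ C) :
    ∃ a : ℕ → ℂ, ∀ τ : ℍ, HasSum (fun n => a n * Periodic.qParam l τ ^ n) (g τ) := by
  have hl' : (0 : ℝ) < l := by exact_mod_cast hl
  have hper := periodic_comp_ofComplex hp
  have hopen : IsOpen {z : ℂ | 0 < z.im} := isOpen_lt continuous_const Complex.continuous_im
  set F := Periodic.cuspFunction l (g ∘ ofComplex) with hF
  have hdiff : DifferentiableOn ℂ F (Metric.ball 0 1) := by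
    intro q hq
    refine DifferentiableAt.differentiableWithinAt ?_
    by_cases hq0 : q = 0
    · subst hq0
      refine Periodic.differentiableAt_cuspFunction_zero hl' hper ?_ ?_
      · have : ∀ᶠ z in Filter.comap Complex.im Filter.atTop, (0 : ℝ) < z.im :=
          (Filter.eventually_gt_atTop (0 : ℝ)).comap _
        exact this.mono fun z hz => (hd z hz).differentiableAt (hopen.mem_nhds hz)
      · refine Asymptotics.IsBigO.of_bound C ?_
        have : ∀ᶠ z in Filter.comap Complex.im Filter.atTop, (1 : ℝ) ≤ z.im :=
          (Filter.eventually_ge_atTop (1 : ℝ)).comap _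
        refine this.mono fun z hz => ?_
        have hz0 : 0 < z.im := by linarith
        simpa [ofComplex_apply_of_im_pos hz0] using hb ⟨z, hz0⟩ hz
    · have him := Periodic.im_invQParam_pos_of_norm_lt_one hl' (by simpa using hq) hq0
      rw [← Periodic.qParam_right_inv hl'.ne' hq0]
      exact Periodic.differentiableAt_cuspFunction hl'.ne' hper
        ((hd _ him).differentiableAt (hopen.mem_nhds him))
  refine ⟨fun n => (n.factorial : ℂ)⁻¹ * iteratedDeriv n F 0, fun τ => ?_⟩
  have hq : Periodic.qParam l τ ∈ Metric.ball (0 : ℂ) 1 := by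
    simpa using Periodic.norm_qParam_lt_one hl' τ.im_pos
  have := Complex.hasSum_taylorSeries_on_ball hdiff hq
  have e : F (Periodic.qParam l τ) = g τ := by
    rw [hF, Periodic.eq_cuspFunction hl'.ne' hper]
    simp
  rw [e] at this
  refine this.congr_fun ?_
  intro n
  simp only [sub_zero, smul_eq_mul]
  ring

theorem differentiableOn_exp_comp (c : ℂ) :
    DifferentiableOn ℂ ((fun τ : ℍ => cexp (c * τ)) ∘ ofComplex) {z | 0 < z.im} := by
  have h : Differentiable ℂ fun z : ℂ => cexp (c * z) := by fun_prop
  refine h.differentiableOn.congr fun z hz => ?_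
  simp [ofComplex_apply_of_im_pos hz]

theorem IsPeriodicHolo.hasFourierExpansion {f : ℍ → ℂ} (hf : IsPeriodicHolo f) :
    HasFourierExpansion f := by
  obtain ⟨hd, ⟨l, hl, hp⟩, C, c, hb⟩ := hf
  have hl' : (0 : ℝ) < l := by exact_mod_cast hl
  have hlC : (l : ℂ) ≠ 0 := by exact_mod_cast hl.ne'
  -- Multiplication by exp(2πi n₀τ/ℓ) makes f bounded near i∞ once its decay beats the growth rate
  -- c; n₀ becomes the allowed order of the pole.
  obtain ⟨n₀, hn₀⟩ := exists_nat_ge (c * l / (2 * Real.pi))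
  have hn₀' : c ≤ 2 * Real.pi * n₀ / l := by
    rw [div_le_iff₀ (by positivity)] at hn₀
    rw [le_div_iff₀ hl']
    linarith
  set g : ℍ → ℂ := fun τ => f τ * cexp (2 * Real.pi * I * n₀ / l * τ) with hg
  obtain ⟨a, ha⟩ := hasSum_cuspFunction (g := g) (C := C) hl
    (hd.mul (differentiableOn_exp_comp _)) (fun τ => by
      simp only [hg, hp, UpperHalfPlane.coe_vadd]
      congr 1
      rw [mul_add, Complex.exp_add]
      have : cexp (2 * Real.pi * I * n₀ / l * ((l : ℝ) : ℂ)) = 1 := by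
        rw [Complex.exp_eq_one_iff]
        exact ⟨n₀, by push_cast; field_simp⟩
      rw [this, one_mul])
    (fun τ hτ => by
      have h1 : ‖cexp (2 * Real.pi * I * n₀ / l * τ)‖ = Real.exp (-(2 * Real.pi * n₀ / l) * τ.im) := by
        rw [Complex.norm_exp]
        congr 1
        have : 2 * Real.pi * I * n₀ / l * (τ : ℂ) = ((2 * Real.pi * n₀ / l : ℝ) : ℂ) * (τ * I) := by
          push_cast; ring
        rw [this, Complex.re_ofReal_mul]
        simp
      have hC : 0 ≤ C := by
        have := (norm_nonneg _).trans (hb τ hτ)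
        exact nonneg_of_mul_nonneg_left this (Real.exp_pos _)
      rw [hg, norm_mul, h1]
      calc ‖f τ‖ * Real.exp (-(2 * Real.pi * n₀ / l) * τ.im)
          ≤ C * Real.exp (c * τ.im) * Real.exp (-(2 * Real.pi * n₀ / l) * τ.im) := by
            gcongr; exact hb τ hτ
        _ = C * Real.exp ((c - 2 * Real.pi * n₀ / l) * τ.im) := by
            rw [mul_assoc, ← Real.exp_add]; ring_nf
        _ ≤ C * 1 := by
            gcongr
            rw [Real.exp_le_one_iff]
            exact mul_nonpos_of_nonpos_of_nonneg (by linarith) τ.im_pos.le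
        _ = C := mul_one C)
  refine ⟨l, n₀, a, hl, fun τ => ?_⟩
  have := (ha τ).mul_right (cexp (-(2 * Real.pi * I * n₀ / l * τ)))
  simp only [hg] at this
  rw [mul_assoc (f τ), ← Complex.exp_add, add_neg_cancel, Complex.exp_zero, mul_one] at this
  refine this.congr_fun ?_
  intro n
  rw [Periodic.qParam, ← Complex.exp_nat_mul, mul_assoc (a n), ← Complex.exp_add]
  congr 2
  push_cast
  field_simp
  ring

theorem IsPeriodicHolo.const (c : ℂ) : IsPeriodicHolo fun _ => c where
  holo := by simp [comp_def]
  periodic := ⟨1, one_pos, fun _ => rfl⟩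
  growth := ⟨‖c‖, 0, fun _ _ => by simp⟩

theorem vadd_mul_eq {α : Type*} {f : ℍ → α} {l : ℕ} (h : ∀ τ : ℍ, f ((l : ℝ) +ᵥ τ) = f τ) (k : ℕ)
    (τ : ℍ) : f (((k * l : ℕ) : ℝ) +ᵥ τ) = f τ := by
  induction k generalizing τ with
  | zero => simp
  | succ k ih =>
    have : (((k + 1) * l : ℕ) : ℝ) +ᵥ τ = (l : ℝ) +ᵥ (((k * l : ℕ) : ℝ) +ᵥ τ) := by
      rw [vadd_vadd]; congr 1; push_cast; ring
    rw [this, h, ih]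

theorem IsPeriodicHolo.common_period {f g : ℍ → ℂ} (hf : IsPeriodicHolo f) (hg : IsPeriodicHolo g) :
    ∃ l : ℕ, 0 < l ∧ (∀ τ : ℍ, f ((l : ℝ) +ᵥ τ) = f τ) ∧ ∀ τ : ℍ, g ((l : ℝ) +ᵥ τ) = g τ := by
  obtain ⟨l, hl, h⟩ := hf.periodic
  obtain ⟨k, hk, h'⟩ := hg.periodic
  exact ⟨l * k, Nat.mul_pos hl hk, by rw [mul_comm]; exact vadd_mul_eq h k, vadd_mul_eq h' l⟩

theorem IsPeriodicHolo.mul {f g : ℍ → ℂ} (hf : IsPeriodicHolo f) (hg : IsPeriodicHolo g) :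
    IsPeriodicHolo (f * g) where
  holo := hf.holo.mul hg.holo
  periodic := by
    obtain ⟨l, hl, h, h'⟩ := hf.common_period hg
    exact ⟨l, hl, fun τ => by simp [h, h']⟩
  growth := by
    obtain ⟨C, c, h⟩ := hf.growth
    obtain ⟨C', c', h'⟩ := hg.growth
    refine ⟨C * C', c + c', fun τ hτ => ?_⟩
    rw [Pi.mul_apply, norm_mul]
    calc _ ≤ (C * Real.exp (c * τ.im)) * (C' * Real.exp (c' * τ.im)) :=
          mul_le_mul (h τ hτ) (h' τ hτ) (norm_nonneg _) ((norm_nonneg _).trans (h τ hτ))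
      _ = _ := by rw [add_mul, Real.exp_add]; ring

theorem IsPeriodicHolo.add {f g : ℍ → ℂ} (hf : IsPeriodicHolo f) (hg : IsPeriodicHolo g) :
    IsPeriodicHolo (f + g) where
  holo := hf.holo.add hg.holo
  periodic := by
    obtain ⟨l, hl, h, h'⟩ := hf.common_period hg
    exact ⟨l, hl, fun τ => by simp [h, h']⟩
  growth := by
    obtain ⟨C, c, h⟩ := hf.growth
    obtain ⟨C', c', h'⟩ := hg.growth
    refine ⟨|C| + |C'|, max c c', fun τ hτ => ?_⟩
    rw [Pi.add_apply]
    refine (norm_add_le _ _).trans ?_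
    rw [add_mul]
    refine add_le_add ((h τ hτ).trans ?_) ((h' τ hτ).trans ?_)
    · exact mul_le_mul (le_abs_self C) (Real.exp_le_exp.2
        (mul_le_mul_of_nonneg_right (le_max_left _ _) τ.im_pos.le)) (Real.exp_pos _).le (abs_nonneg C)
    · exact mul_le_mul (le_abs_self C') (Real.exp_le_exp.2
        (mul_le_mul_of_nonneg_right (le_max_right _ _) τ.im_pos.le)) (Real.exp_pos _).le
        (abs_nonneg C')

/-- The algebra of periodic holomorphic functions of exponential growth. -/
def periodicHolo : Subalgebra ℂ (ℍ → ℂ) where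
  carrier := {f | IsPeriodicHolo f}
  mul_mem' := IsPeriodicHolo.mul
  add_mem' := IsPeriodicHolo.add
  algebraMap_mem' c := IsPeriodicHolo.const c

/-! ### Almost holomorphic functions, as polynomials in `1 / y` -/

/-- The value of a polynomial with function coefficients at `X = 1 / y`. -/
def evalInvIm : (ℍ → ℂ)[X] →ₐ[ℂ] (ℍ → ℂ) :=
  (Polynomial.aeval (R := ℍ → ℂ) (fun τ : ℍ => ((τ.im : ℂ))⁻¹)).restrictScalars ℂ

theorem evalInvIm_apply (p : (ℍ → ℂ)[X]) :
    evalInvIm p = almostHolo p.natDegree p.coeff := by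
  ext τ
  change (Polynomial.aeval (R := ℍ → ℂ) (fun τ : ℍ => ((τ.im : ℂ))⁻¹)) p τ = _
  rw [Polynomial.aeval_eq_sum_range, almostHolo, Finset.sum_apply]
  simp

/-- Polynomials in `1 / y` with periodic holomorphic coefficients. -/
def almostHoloPoly : Subalgebra ℂ (ℍ → ℂ)[X] where
  carrier := {p | ∀ m, p.coeff m ∈ periodicHolo}
  mul_mem' {p q} hp hq m := by
    rw [Polynomial.coeff_mul]
    exact sum_mem fun i _ => mul_mem (hp _) (hq _)
  add_mem' {p q} hp hq m := by
    rw [Polynomial.coeff_add]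
    exact add_mem (hp m) (hq m)
  algebraMap_mem' c m := by
    rw [Polynomial.algebraMap_apply, Polynomial.coeff_C]
    split_ifs
    · exact Subalgebra.algebraMap_mem _ c
    · exact zero_mem _

theorem C_mem_almostHoloPoly {f : ℍ → ℂ} (hf : f ∈ periodicHolo) :
    Polynomial.C f ∈ almostHoloPoly := fun m => by
  rw [Polynomial.coeff_C]
  split_ifs
  · exact hf
  · exact zero_mem _

theorem X_mem_almostHoloPoly : (Polynomial.X : (ℍ → ℂ)[X]) ∈ almostHoloPoly := fun m => by
  rw [Polynomial.coeff_X]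
  split_ifs
  · exact one_mem _
  · exact zero_mem _

/-- The algebra of almost holomorphic functions. -/
def almostHoloFun : Subalgebra ℂ (ℍ → ℂ) := almostHoloPoly.map evalInvIm

theorem isAlmostHolomorphic_of_mem {F : ℍ → ℂ} (hF : F ∈ almostHoloFun) :
    IsAlmostHolomorphic F := by
  obtain ⟨p, hp, rfl⟩ := hF
  exact ⟨p.natDegree, p.coeff, fun m => IsPeriodicHolo.hasFourierExpansion (hp m),
    evalInvIm_apply p⟩

theorem periodicHolo_le_almostHoloFun : periodicHolo ≤ almostHoloFun := fun f hf =>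
  ⟨Polynomial.C f, C_mem_almostHoloPoly hf, by
    change Polynomial.aeval (R := ℍ → ℂ) _ (Polynomial.C f) = f
    simp⟩

/-! ### Quasimodular functions of weight zero -/

/-- Composition with the action of `γ`, as an algebra homomorphism. -/
def compSMul (γ : SL(2, ℤ)) : (ℍ → ℂ) →ₐ[ℂ] (ℍ → ℂ) where
  toFun f τ := f (γ • τ)
  map_one' := rfl
  map_mul' _ _ := rfl
  map_zero' := rfl
  map_add' _ _ := rfl
  commutes' _ := rfl

/-- Polynomials in `1 / y` whose value is modular of weight zero for `Γ` and almost holomorphic at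
all cusps. -/
def weightZeroPoly (Γ : Subgroup SL(2, ℤ)) : Subalgebra ℂ (ℍ → ℂ)[X] :=
  almostHoloPoly ⊓ (⨅ γ ∈ Γ, AlgHom.equalizer ((compSMul γ).comp evalInvIm) evalInvIm) ⊓
    ⨅ γ, almostHoloFun.comap ((compSMul γ).comp evalInvIm)

/-- The algebra of quasimodular functions of weight zero. -/
def weightZeroQuasi (Γ : Subgroup SL(2, ℤ)) : Subalgebra ℂ (ℍ → ℂ) :=
  (weightZeroPoly Γ).map
    ((Polynomial.aeval (R := ℍ → ℂ) (0 : ℍ → ℂ)).restrictScalars ℂ)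

theorem mem_weightZeroPoly {Γ : Subgroup SL(2, ℤ)} {p : (ℍ → ℂ)[X]} :
    p ∈ weightZeroPoly Γ ↔ p ∈ almostHoloPoly ∧
      (∀ γ ∈ Γ, ∀ τ, evalInvIm p (γ • τ) = evalInvIm p τ) ∧
      ∀ γ : SL(2, ℤ), (fun τ => evalInvIm p (γ • τ)) ∈ almostHoloFun := by
  simp only [weightZeroPoly, Algebra.mem_inf, Algebra.mem_iInf, and_assoc, Subalgebra.mem_comap]
  refine and_congr_right fun _ => and_congr ?_ Iff.rfl
  refine forall₂_congr fun γ _ => ?_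
  exact funext_iff

/-- The constant coefficient is evaluation at X = 0, an algebra homomorphism. This is why products
stay quasimodular, with no appeal to uniqueness of the expansion in 1/y. -/
theorem mem_weightZeroQuasi {Γ : Subgroup SL(2, ℤ)} {φ : ℍ → ℂ} :
    φ ∈ weightZeroQuasi Γ ↔ ∃ p ∈ weightZeroPoly Γ, p.coeff 0 = φ := by
  simp only [weightZeroQuasi, Subalgebra.mem_map]
  refine exists_congr fun p => and_congr_right fun _ => ?_
  rw [Polynomial.coeff_zero_eq_aeval_zero]
  rfl

end InfiniteWedge

end

noncomputable section

namespace InfiniteWedge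

open UpperHalfPlane hiding I
open Complex Function

/-! ### Power series of entire functions -/

/-- `p` is the Taylor series of the entire function `f`. -/
def Represents (p : PowerSeries ℂ) (f : ℂ → ℂ) : Prop :=
  ∀ z, HasSum (fun j => PowerSeries.coeff j p * z ^ j) (f z)

/-- The identity principle; it converts each functional equation of a theta function into an
identity of Taylor series. -/
theorem Represents.unique {p q : PowerSeries ℂ} {f : ℂ → ℂ} (hp : Represents p f)
    (hq : Represents q f) : p = q := by
  have key : ∀ {p : PowerSeries ℂ}, Represents p f →
      HasFPowerSeriesAt f (FormalMultilinearSeries.ofScalars ℂ fun j => PowerSeries.coeff j p) 0 := by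
    intro p hp
    rw [hasFPowerSeriesAt_iff]
    refine Filter.Eventually.of_forall fun z => ?_
    simpa [mul_comm] using hp z
  have h := (key hp).eq_formalMultilinearSeries (key hq)
  ext j
  have := congrArg (fun P => FormalMultilinearSeries.coeff P j) h
  simpa [FormalMultilinearSeries.coeff_ofScalars] using this

theorem Represents.mul {p q : PowerSeries ℂ} {f g : ℂ → ℂ} (hp : Represents p f)
    (hq : Represents q g) : Represents (p * q) fun z => f z * g z := by
  intro z
  have h1 := (hp z).summable.norm
  have h2 := (hq z).summable.norm
  have h3 := summable_norm_sum_mul_antidiagonal_of_summable_norm h1 h2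
  have h4 := tsum_mul_tsum_eq_tsum_sum_antidiagonal_of_summable_norm h1 h2
  rw [(hp z).tsum_eq, (hq z).tsum_eq] at h4
  have h5 := h3.of_norm.hasSum
  rw [← h4] at h5
  refine h5.congr_fun fun j => ?_
  rw [PowerSeries.coeff_mul, Finset.sum_mul]
  refine Finset.sum_congr rfl fun x hx => ?_
  rw [← Finset.HasAntidiagonal.mem_antidiagonal.1 hx, pow_add]
  ring

theorem Represents.rescale {p : PowerSeries ℂ} {f : ℂ → ℂ} (hp : Represents p f) (s : ℂ) :
    Represents (PowerSeries.rescale s p) fun z => f (s * z) := by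
  intro z
  refine (hp (s * z)).congr_fun fun j => ?_
  rw [PowerSeries.coeff_rescale, mul_pow]
  ring

theorem Represents.smul {p : PowerSeries ℂ} {f : ℂ → ℂ} (hp : Represents p f) (s : ℂ) :
    Represents (s • p) fun z => s * f z := by
  intro z
  refine ((hp z).mul_left s).congr_fun fun j => ?_
  simp [mul_assoc]

/-- The power series of `exp (c z ^ 2)`. -/
def gaussPS (c : ℂ) : PowerSeries ℂ :=
  PowerSeries.mk fun j => if Even j then c ^ (j / 2) / (j / 2).factorial else 0

theorem represents_gaussPS (c : ℂ) : Represents (gaussPS c) fun z => cexp (c * z ^ 2) := by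
  intro z
  have h := NormedSpace.expSeries_div_hasSum_exp (c * z ^ 2)
  rw [← Complex.exp_eq_exp_ℂ] at h
  have hinj : Injective fun k : ℕ => 2 * k := fun a b h => by simpa using h
  refine (hinj.hasSum_iff ?_).1 (h.congr_fun fun k => ?_)
  · intro j hj
    have : ¬ Even j := fun ⟨k, hk⟩ => hj ⟨k, by simp only; omega⟩
    simp [gaussPS, this]
  · simp [gaussPS, mul_pow, pow_mul]
    ring

theorem gaussPS_add (a b : ℂ) : gaussPS (a + b) = gaussPS a * gaussPS b :=
  (represents_gaussPS _).unique (by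
    have := (represents_gaussPS a).mul (represents_gaussPS b)
    simpa only [← Complex.exp_add, ← add_mul] using this)

theorem rescale_gaussPS (s c : ℂ) : PowerSeries.rescale s (gaussPS c) = gaussPS (s ^ 2 * c) := by
  refine ((represents_gaussPS c).rescale s).unique ?_
  have := represents_gaussPS (s ^ 2 * c)
  convert this using 3
  ring

/-! ### Theta functions with characteristics -/

/-- The theta function with characteristics `a`, `b`. -/
def thetaFun (a b : ℝ) (z τ : ℂ) : ℂ :=
  cexp (Real.pi * I * a ^ 2 * τ + 2 * Real.pi * I * a * (z + b)) * jacobiTheta₂ (z + b + a * τ) τ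

/-- The Taylor coefficients (up to normalization) of the theta function at `z = 0`. -/
def thetaCoeff (a b : ℝ) (j : ℕ) (τ : ℂ) : ℂ :=
  ∑' n : ℤ, ((n : ℂ) + a) ^ j * cexp (2 * Real.pi * I * (n + a) * b + Real.pi * I * (n + a) ^ 2 * τ)

/-- The Taylor series of the theta function at `z = 0`. -/
def thetaPS (a b : ℝ) (τ : ℂ) : PowerSeries ℂ :=
  PowerSeries.mk fun j => (2 * Real.pi * I) ^ j / j.factorial * thetaCoeff a b j τ

theorem thetaFun_term (a b : ℝ) (z τ : ℂ) (n : ℤ) :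
    cexp (Real.pi * I * a ^ 2 * τ + 2 * Real.pi * I * a * (z + b)) *
      jacobiTheta₂_term n (z + b + a * τ) τ =
    cexp (2 * Real.pi * I * (n + a) * (z + b) + Real.pi * I * (n + a) ^ 2 * τ) := by
  rw [jacobiTheta₂_term, ← Complex.exp_add]
  ring_nf

theorem hasSum_thetaFun (a b : ℝ) (z : ℂ) {τ : ℂ} (hτ : 0 < τ.im) :
    HasSum (fun n : ℤ => cexp (2 * Real.pi * I * (n + a) * (z + b) + Real.pi * I * (n + a) ^ 2 * τ))
      (thetaFun a b z τ) :=
  ((hasSum_jacobiTheta₂_term _ hτ).mul_left _).congr_fun fun n => (thetaFun_term a b z τ n).symm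

theorem norm_theta_term (a b : ℝ) (n : ℤ) (τ : ℂ) :
    ‖cexp (2 * Real.pi * I * (n + a) * b + Real.pi * I * (n + a) ^ 2 * τ)‖ =
      Real.exp (-Real.pi * (n + a) ^ 2 * τ.im) := by
  rw [Complex.norm_exp]
  congr 1
  have : 2 * Real.pi * I * (n + a) * b + Real.pi * I * (n + a) ^ 2 * τ =
      ((2 * Real.pi * (n + a) * b : ℝ) : ℂ) * I + ((Real.pi * (n + a) ^ 2 : ℝ) : ℂ) * (τ * I) := by
    push_cast; ring
  rw [this, Complex.add_re, Complex.re_ofReal_mul, Complex.re_ofReal_mul]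
  simp

/-- Exponential bounds `exp (M |n + a|) q ^ {(n + a) ^ 2}` are summable. -/
theorem summable_exp_gauss (a M : ℝ) {y : ℝ} (hy : 0 < y) :
    Summable fun n : ℤ => Real.exp (M * |n + a|) * Real.exp (-Real.pi * (n + a) ^ 2 * y) := by
  have h : ∀ s : ℝ, Summable fun n : ℤ =>
      Real.exp (s * (n + a)) * Real.exp (-Real.pi * (n + a) ^ 2 * y) := by
    intro s
    -- At the imaginary argument z = -is/(2π) the theta series has positive terms and produces the
    -- factor exp(s(n+a)).
    have := (hasSum_thetaFun a 0 (-(s / (2 * Real.pi) : ℝ) * I) (τ := y * I) (by simpa)).summable.norm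
    refine this.congr fun n => ?_
    rw [Complex.norm_exp, ← Real.exp_add]
    congr 1
    obtain ⟨t, rfl⟩ : ∃ t, s = 2 * Real.pi * t := ⟨s / (2 * Real.pi), by field_simp⟩
    have e : 2 * Real.pi * I * (n + a) * (-(2 * Real.pi * t / (2 * Real.pi) : ℝ) * I + (0 : ℝ)) +
        Real.pi * I * (n + a) ^ 2 * (y * I) =
        ((2 * Real.pi * t * (n + a) + -Real.pi * (n + a) ^ 2 * y : ℝ) : ℂ) := by
      rw [mul_div_cancel_left₀ t (by positivity)]
      push_cast
      linear_combination (-(2 * Real.pi * t * (n + a)) + Real.pi * (n + a) ^ 2 * y : ℂ) * Complex.I_sq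
    rw [e, Complex.ofReal_re]
  refine Summable.of_nonneg_of_le (fun n => by positivity) (fun n => ?_) ((h M).add (h (-M)))
  rw [← add_mul]
  gcongr
  rcases abs_cases ((n : ℝ) + a) with ⟨h, _⟩ | ⟨h, _⟩ <;> rw [h]
  · linarith [Real.exp_pos (-M * (n + a))]
  · rw [mul_neg, ← neg_mul]; linarith [Real.exp_pos (M * (n + a))]

theorem summable_pow_gauss (a : ℝ) (j : ℕ) {y : ℝ} (hy : 0 < y) :
    Summable fun n : ℤ => |n + a| ^ j * Real.exp (-Real.pi * (n + a) ^ 2 * y) := by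
  refine Summable.of_nonneg_of_le (fun n => by positivity) (fun n => ?_)
    ((summable_exp_gauss a 1 hy).mul_left (j.factorial : ℝ))
  rw [← mul_assoc]
  gcongr
  have := Real.pow_div_factorial_le_exp |(n : ℝ) + a| (abs_nonneg _) j
  rw [div_le_iff₀ (by positivity)] at this
  rw [one_mul]
  linarith

theorem hasSum_thetaCoeff (a b : ℝ) (j : ℕ) {τ : ℂ} (hτ : 0 < τ.im) :
    HasSum (fun n : ℤ => ((n : ℂ) + a) ^ j *
      cexp (2 * Real.pi * I * (n + a) * b + Real.pi * I * (n + a) ^ 2 * τ)) (thetaCoeff a b j τ) := by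
  refine Summable.hasSum (Summable.of_norm ((summable_pow_gauss a j hτ).congr fun n => ?_))
  rw [norm_mul, norm_theta_term, norm_pow]
  congr 2
  rw [← Complex.ofReal_intCast, ← Complex.ofReal_add, Complex.norm_real, Real.norm_eq_abs]

/-- Expand exp(2πi(n+a)z) in powers of z and exchange the summations. The norms sum over j to
exp(2π|z||n+a|), which the Gaussian factor dominates. -/
theorem represents_thetaPS (a b : ℝ) {τ : ℂ} (hτ : 0 < τ.im) :
    Represents (thetaPS a b τ) fun z => thetaFun a b z τ := by
  intro z
  set F : ℤ × ℕ → ℂ := fun x => (2 * Real.pi * I * (x.1 + a) * z) ^ x.2 / x.2.factorial *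
    cexp (2 * Real.pi * I * (x.1 + a) * b + Real.pi * I * (x.1 + a) ^ 2 * τ) with hF
  have hn : ∀ n : ℤ, HasSum (fun j => F (n, j))
      (cexp (2 * Real.pi * I * (n + a) * (z + b) + Real.pi * I * (n + a) ^ 2 * τ)) := by
    intro n
    have h := NormedSpace.expSeries_div_hasSum_exp (2 * Real.pi * I * (n + a) * z)
    rw [← Complex.exp_eq_exp_ℂ] at h
    have := h.mul_right
      (cexp (2 * Real.pi * I * (n + a) * b + Real.pi * I * (n + a) ^ 2 * τ))
    rw [← Complex.exp_add] at this
    have e : 2 * Real.pi * I * (n + a) * (z + b) + Real.pi * I * (n + a) ^ 2 * τ =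
        2 * Real.pi * I * (n + a) * z +
          (2 * Real.pi * I * (n + a) * b + Real.pi * I * (n + a) ^ 2 * τ) := by ring
    rw [e]
    exact this
  have hs : Summable F := by
    refine Summable.of_norm ?_
    have hnorm : ∀ x : ℤ × ℕ, ‖F x‖ = (2 * Real.pi * ‖z‖ * |x.1 + a|) ^ x.2 / x.2.factorial *
        Real.exp (-Real.pi * (x.1 + a) ^ 2 * τ.im) := by
      intro x
      rw [hF, norm_mul, norm_theta_term, norm_div, norm_pow, Complex.norm_natCast]
      congr 3
      rw [← Complex.ofReal_intCast, ← Complex.ofReal_add, norm_mul, norm_mul, norm_mul, norm_mul,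
        Complex.norm_real, Complex.norm_real, Complex.norm_I, Real.norm_eq_abs,
        Real.norm_eq_abs, abs_of_pos Real.pi_pos]
      simp
      ring
    rw [summable_prod_of_nonneg fun x => norm_nonneg _]
    have hexp : ∀ n : ℤ, HasSum (fun j => ‖F (n, j)‖)
        (Real.exp (2 * Real.pi * ‖z‖ * |n + a|) * Real.exp (-Real.pi * (n + a) ^ 2 * τ.im)) := by
      intro n
      have h := NormedSpace.expSeries_div_hasSum_exp (2 * Real.pi * ‖z‖ * |n + a|)
      rw [← Real.exp_eq_exp_ℝ] at h
      exact (h.mul_right _).congr_fun fun j => hnorm _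
    refine ⟨fun n => (hexp n).summable, ?_⟩
    exact (summable_exp_gauss a (2 * Real.pi * ‖z‖) hτ).congr fun n => (hexp n).tsum_eq.symm
  have htot := hs.hasSum
  rw [(hs.hasSum.prod_fiberwise hn).unique (hasSum_thetaFun a b z hτ)] at htot
  have hswap := (Equiv.prodComm ℕ ℤ).hasSum_iff.2 htot
  refine hswap.prod_fiberwise fun j => ?_
  have := (hasSum_thetaCoeff a b j hτ).mul_left ((2 * Real.pi * I) ^ j / j.factorial * z ^ j)
  rw [thetaPS, PowerSeries.coeff_mk, mul_right_comm]
  refine this.congr_fun fun n => ?_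
  simp only [hF, comp_apply, Equiv.prodComm_apply, Prod.swap_prod_mk, mul_pow]
  ring

theorem exp_pi_I_sub_sq (n : ℤ) : cexp (Real.pi * I * (n ^ 2 - n : ℂ)) = 1 := by
  obtain ⟨k, hk⟩ := Int.even_mul_pred_self n
  rw [Complex.exp_eq_one_iff]
  refine ⟨k, ?_⟩
  have : (n : ℂ) * (n - 1) = k + k := by exact_mod_cast hk
  linear_combination Real.pi * I * this

/-- As n² and n have the same parity, the quadratic phase caused by τ + 1 is linear in n and can be
absorbed into b. -/
theorem thetaFun_T (a b : ℝ) (z : ℂ) {τ : ℂ} (hτ : 0 < τ.im) :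
    thetaFun a b z (τ + 1) =
      cexp (-(Real.pi * I * (a ^ 2 + a))) * thetaFun a (a + b + 1 / 2) z τ := by
  refine (hasSum_thetaFun a b z (τ := τ + 1) (by simpa)).unique ?_
  refine ((hasSum_thetaFun a (a + b + 1 / 2) z hτ).mul_left _).congr_fun fun n => ?_
  have e : 2 * Real.pi * I * (n + a) * (z + b) + Real.pi * I * (n + a) ^ 2 * (τ + 1) =
      -(Real.pi * I * (a ^ 2 + a)) + (2 * Real.pi * I * (n + a) * (z + (a + b + 1 / 2 : ℝ)) +
        Real.pi * I * (n + a) ^ 2 * τ) + Real.pi * I * (n ^ 2 - n) := by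
    push_cast
    ring
  rw [e, Complex.exp_add, exp_pi_I_sub_sq, mul_one, Complex.exp_add]

/-- Poisson summation, in the form `jacobiTheta₂_functional_equation`: the characteristics turn by
(a, b) ↦ (b, -a), and the only anomaly in z is a Gaussian. -/
theorem thetaFun_S (a b : ℝ) (z : ℂ) {τ : ℂ} (hτ : 0 < τ.im) :
    thetaFun a b (τ⁻¹ * z) (-τ⁻¹) = ((-I * τ) ^ (1 / 2 : ℂ) * cexp (2 * Real.pi * I * a * b)) *
      (cexp (Real.pi * I / τ * z ^ 2) * thetaFun b (-a) z τ) := by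
  have hτ0 : τ ≠ 0 := by rintro rfl; simp at hτ
  have hI : (-I * τ) ^ (1 / 2 : ℂ) ≠ 0 := by
    rw [Ne, Complex.cpow_eq_zero_iff]
    simp [hτ0]
  have h := jacobiTheta₂_functional_equation (z + (-a : ℝ) + b * τ) τ
  rw [thetaFun, thetaFun, h]
  have e : (z + (-a : ℝ) + b * τ) / τ = τ⁻¹ * z + b + a * -τ⁻¹ := by
    push_cast; field_simp; ring
  rw [e, neg_div, one_div τ]
  have hx : cexp (Real.pi * I * a ^ 2 * -τ⁻¹ + 2 * Real.pi * I * a * (τ⁻¹ * z + b)) =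
      cexp (2 * Real.pi * I * a * b) * cexp (Real.pi * I / τ * z ^ 2) *
        cexp (Real.pi * I * b ^ 2 * τ + 2 * Real.pi * I * b * (z + (-a : ℝ))) *
        cexp (-Real.pi * I * (z + (-a : ℝ) + b * τ) ^ 2 / τ) := by
    rw [← Complex.exp_add, ← Complex.exp_add, ← Complex.exp_add]
    congr 1
    push_cast
    field_simp
    ring
  rw [hx]
  generalize (-I * τ) ^ (1 / 2 : ℂ) = c at hI ⊢
  field_simp

theorem thetaFun_add_one_left (a b : ℝ) (z : ℂ) {τ : ℂ} (hτ : 0 < τ.im) :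
    thetaFun (a + 1) b z τ = thetaFun a b z τ := by
  refine (hasSum_thetaFun (a + 1) b z hτ).unique ?_
  refine ((Equiv.addRight (1 : ℤ)).hasSum_iff.2 (hasSum_thetaFun a b z hτ)).congr_fun fun n => ?_
  simp only [comp_apply, Equiv.coe_addRight]
  push_cast
  ring_nf

theorem thetaFun_add_one_right (a b : ℝ) (z : ℂ) {τ : ℂ} (hτ : 0 < τ.im) :
    thetaFun a (b + 1) z τ = cexp (2 * Real.pi * I * a) * thetaFun a b z τ := by
  refine (hasSum_thetaFun a (b + 1) z hτ).unique ?_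
  refine ((hasSum_thetaFun a b z hτ).mul_left _).congr_fun fun n => ?_
  rw [← Complex.exp_add, Complex.exp_eq_exp_iff_exists_int]
  refine ⟨n, ?_⟩
  push_cast
  ring

theorem thetaPS_T (a b : ℝ) {τ : ℂ} (hτ : 0 < τ.im) :
    thetaPS a b (τ + 1) = cexp (-(Real.pi * I * (a ^ 2 + a))) • thetaPS a (a + b + 1 / 2) τ := by
  refine (represents_thetaPS a b (τ := τ + 1) (by simpa)).unique ?_
  simp_rw [thetaFun_T a b _ hτ]
  exact (represents_thetaPS a _ hτ).smul _

theorem thetaPS_S (a b : ℝ) {τ : ℂ} (hτ : 0 < τ.im) :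
    PowerSeries.rescale τ⁻¹ (thetaPS a b (-τ⁻¹)) =
      ((-I * τ) ^ (1 / 2 : ℂ) * cexp (2 * Real.pi * I * a * b)) •
        (gaussPS (Real.pi * I / τ) * thetaPS b (-a) τ) := by
  have hτ' : 0 < (-τ⁻¹).im := by
    rw [Complex.neg_im, Complex.inv_im, neg_div, neg_neg]
    exact div_pos hτ (Complex.normSq_pos.2 (by rintro rfl; simp at hτ))
  refine ((represents_thetaPS a b hτ').rescale τ⁻¹).unique ?_
  simp_rw [thetaFun_S a b _ hτ]
  exact ((represents_gaussPS _).mul (represents_thetaPS b (-a) hτ)).smul _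

theorem thetaPS_add_one_left (a b : ℝ) {τ : ℂ} (hτ : 0 < τ.im) :
    thetaPS (a + 1) b τ = thetaPS a b τ := by
  refine (represents_thetaPS _ b hτ).unique ?_
  simp_rw [thetaFun_add_one_left a b _ hτ]
  exact represents_thetaPS a _ hτ

theorem thetaPS_add_one_right (a b : ℝ) {τ : ℂ} (hτ : 0 < τ.im) :
    thetaPS a (b + 1) τ = cexp (2 * Real.pi * I * a) • thetaPS a b τ := by
  refine (represents_thetaPS a _ hτ).unique ?_
  simp_rw [thetaFun_add_one_right a b _ hτ]
  exact (represents_thetaPS a _ hτ).smul _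

end InfiniteWedge

end

noncomputable section

namespace InfiniteWedge

open UpperHalfPlane hiding I
open Complex Function
open scoped ModularForm

/-! ### The Dedekind eta function -/

theorem eta_ne_zero (τ : ℍ) : η (τ : ℂ) ≠ 0 := ModularForm.eta_ne_zero τ.2

/-- The arguments -π/2 of -i and arg τ ∈ [0, π] add up inside the principal range, so the logarithm
is additive here. -/
theorem sqrt_I_inv_mul_sqrt (τ : ℍ) :
    (Complex.sqrt I)⁻¹ * Complex.sqrt τ = (-I * τ) ^ (1 / 2 : ℂ) := by
  have hlog : Complex.log (-I * τ) = Complex.log (-I) + Complex.log τ := by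
    refine Complex.log_mul (by simp) τ.ne_zero ?_
    have h1 := Complex.arg_le_pi (τ : ℂ)
    have h2 : 0 ≤ Complex.arg (τ : ℂ) := Complex.arg_nonneg_iff.2 τ.im_pos.le
    rw [Complex.arg_neg_I]
    constructor <;> linarith [Real.pi_pos]
  rw [Complex.sqrt, Complex.sqrt,
    Complex.cpow_def_of_ne_zero (x := -I * τ) (by simp [τ.ne_zero]), hlog,
    Complex.cpow_def_of_ne_zero τ.ne_zero, Complex.cpow_def_of_ne_zero Complex.I_ne_zero,
    ← Complex.exp_neg, ← Complex.exp_add, Complex.log_I, Complex.log_neg_I]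
  congr 1
  ring

theorem eta_S (τ : ℍ) : η (-(τ : ℂ)⁻¹) = (-I * τ) ^ (1 / 2 : ℂ) * η τ := by
  have h : η (-(τ : ℂ)⁻¹) = (Complex.sqrt I)⁻¹ * (Complex.sqrt τ * η τ) := by
    simpa [neg_div] using ModularForm.eta_comp_eq_csqrt_I_inv τ.2
  rw [h, ← mul_assoc, sqrt_I_inv_mul_sqrt]

theorem eta_T (τ : ℂ) : η (τ + 1) = cexp (Real.pi * I / 12) * η τ := by
  have h1 : ∀ n, ModularForm.eta_q n (τ + 1) = ModularForm.eta_q n τ := by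
    intro n
    rw [ModularForm.eta_q_eq_pow, ModularForm.eta_q_eq_pow]
    congr 1
    rw [mul_add, mul_one, Complex.exp_add, Complex.exp_two_pi_mul_I, mul_one]
  simp only [ModularForm.eta, h1]
  rw [Periodic.qParam, Periodic.qParam, ← mul_assoc, ← Complex.exp_add]
  congr 2
  push_cast
  ring

theorem sq_cpow_half {z : ℂ} : (z ^ (1 / 2 : ℂ)) ^ 2 = z := by
  rw [← Complex.cpow_nat_mul]
  norm_num

theorem tprod_one_sub_pow_ne_zero {q : ℂ} (hq : ‖q‖ < 1) : ∏' n : ℕ, (1 - q ^ (n + 1)) ≠ 0 := by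
  rcases eq_or_ne q 0 with rfl | h0
  · simp
  · have him := Periodic.im_invQParam_pos_of_norm_lt_one (h := 1) one_pos hq h0
    have := ModularForm.eta_tprod_ne_zero (z := Periodic.invQParam 1 q) him
    simpa only [ModularForm.eta_q, Periodic.qParam_right_inv one_ne_zero h0] using this

/-- As a function of q the product is continuous and has no zero on the closed disc of radius
e^(-2π), which contains q as soon as Im τ ≥ 1; compactness bounds it and its inverse. -/
theorem exists_bound_tprod : ∃ C : ℝ, ∀ τ : ℍ, 1 ≤ τ.im →
    ‖∏' n, (1 - ModularForm.eta_q n τ)‖ ≤ C ∧ ‖(∏' n, (1 - ModularForm.eta_q n τ))⁻¹‖ ≤ C := by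
  set g : ℂ → ℂ := fun q => ∏' n : ℕ, (1 - q ^ (n + 1))
  set r := Real.exp (-2 * Real.pi)
  have hr : r < 1 := by
    rw [Real.exp_lt_one_iff]
    linarith [Real.pi_pos]
  have hsub : Metric.closedBall (0 : ℂ) r ⊆ Metric.ball 0 1 := Metric.closedBall_subset_ball hr
  have hc : ContinuousOn g (Metric.closedBall 0 r) :=
    ModularForm.differentiableOn_tprod_one_sub_pow.continuousOn.mono hsub
  obtain ⟨C₁, h₁⟩ := (isCompact_closedBall (0 : ℂ) r).exists_bound_of_continuousOn hc
  obtain ⟨C₂, h₂⟩ := (isCompact_closedBall (0 : ℂ) r).exists_bound_of_continuousOn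
    (hc.inv₀ fun q hq => tprod_one_sub_pow_ne_zero (by simpa using hsub hq))
  refine ⟨max C₁ C₂, fun τ hτ => ?_⟩
  have hq : Periodic.qParam 1 (τ : ℂ) ∈ Metric.closedBall (0 : ℂ) r := by
    rw [mem_closedBall_zero_iff, Periodic.norm_qParam, Real.exp_le_exp]
    have : (τ : ℂ).im = τ.im := rfl
    rw [this]
    nlinarith [Real.pi_pos]
  exact ⟨(h₁ _ hq).trans (le_max_left _ _), (h₂ _ hq).trans (le_max_right _ _)⟩

theorem differentiableOn_eta :
    DifferentiableOn ℂ ((fun τ : ℍ => η (τ : ℂ)) ∘ ofComplex) {z | 0 < z.im} := by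
  have : DifferentiableOn ℂ ModularForm.eta {z | 0 < z.im} := fun z hz =>
    (ModularForm.differentiableAt_eta_of_mem_upperHalfPlaneSet hz).differentiableWithinAt
  exact this.congr fun z hz => by simp [ofComplex_apply_of_im_pos hz]

theorem eta_add_nat (τ : ℂ) (n : ℕ) : η (τ + n) = cexp (Real.pi * I / 12) ^ n * η τ := by
  induction n with
  | zero => simp
  | succ n ih =>
    rw [Nat.cast_succ, ← add_assoc, eta_T, ih, pow_succ]
    ring

theorem eta_vadd (τ : ℍ) : η (((24 : ℕ) : ℝ) +ᵥ τ : ℍ) = η (τ : ℂ) := by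
  have : ((((24 : ℕ) : ℝ) +ᵥ τ : ℍ) : ℂ) = τ + (24 : ℕ) := by
    rw [UpperHalfPlane.coe_vadd, add_comm]
    simp
  rw [this, eta_add_nat, ← Complex.exp_nat_mul]
  have : cexp ((24 : ℕ) * (Real.pi * I / 12)) = 1 :=
    Complex.exp_eq_one_iff.2 ⟨1, by push_cast; ring⟩
  rw [this, one_mul]

theorem eta_mem : (fun τ : ℍ => η (τ : ℂ)) ∈ periodicHolo where
  holo := differentiableOn_eta
  periodic := ⟨24, by norm_num, eta_vadd⟩
  growth := by
    obtain ⟨C, hC⟩ := exists_bound_tprod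
    refine ⟨C, -2 * Real.pi / 24, fun τ hτ => ?_⟩
    rw [ModularForm.eta, norm_mul, Periodic.norm_qParam, mul_comm]
    have e : -2 * Real.pi * (τ : ℂ).im / 24 = -2 * Real.pi / 24 * τ.im := by
      rw [UpperHalfPlane.coe_im]; ring
    rw [e]
    gcongr
    exact (hC τ hτ).1

/-- Exponential growth at i∞ is permitted, so division by η costs nothing: η has no zeros in ℍ and
1/η grows like e^(2πy/24). -/
theorem eta_inv_mem : (fun τ : ℍ => (η (τ : ℂ))⁻¹) ∈ periodicHolo where
  holo := differentiableOn_eta.inv fun z hz => by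
    simpa using eta_ne_zero _
  periodic := ⟨24, by norm_num, fun τ => by rw [eta_vadd]⟩
  growth := by
    obtain ⟨C, hC⟩ := exists_bound_tprod
    refine ⟨C, 2 * Real.pi / 24, fun τ hτ => ?_⟩
    rw [ModularForm.eta, mul_inv, norm_mul, norm_inv, Periodic.norm_qParam, ← Real.exp_neg, mul_comm]
    have e : -(-2 * Real.pi * (τ : ℂ).im / 24) = 2 * Real.pi / 24 * τ.im := by
      rw [UpperHalfPlane.coe_im]; ring
    rw [e]
    gcongr
    exact (hC τ hτ).2

theorem eta_zpow_mem (k : ℤ) : (fun τ : ℍ => η (τ : ℂ) ^ k) ∈ periodicHolo := by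
  obtain ⟨n, rfl | rfl⟩ := k.eq_nat_or_neg
  · have := pow_mem eta_mem n
    simp only [zpow_natCast]
    exact this
  · have := pow_mem eta_inv_mem n
    simp only [zpow_neg, zpow_natCast, ← inv_pow]
    exact this

/-! ### The action of the modular group on families of power series -/

theorem cd_eq_denom (γ : SL(2, ℤ)) (τ : ℍ) : cd γ τ = denom γ τ := by
  rw [ModularGroup.denom_apply, cd]

theorem cd_ne_zero (γ : SL(2, ℤ)) (τ : ℍ) : cd γ τ ≠ 0 := by
  rw [cd_eq_denom]
  exact denom_ne_zero _ τ

theorem cd_mul (γ δ : SL(2, ℤ)) (τ : ℍ) : cd (γ * δ) τ = cd γ (δ • τ) * cd δ τ := by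
  have h := cd_ne_zero δ τ
  unfold cd at h ⊢
  rw [UpperHalfPlane.specialLinearGroup_apply δ τ]
  simp only [Matrix.SpecialLinearGroup.coe_mul, Matrix.mul_apply, Fin.sum_univ_two]
  simp only [eq_intCast, Complex.ofReal_intCast]
  push_cast
  field_simp
  ring

theorem cd_one (τ : ℍ) : cd 1 τ = 1 := by simp [cd]

theorem cd_S (τ : ℍ) : cd ModularGroup.S τ = τ := by simp [cd, ModularGroup.S]

theorem cd_T (τ : ℍ) : cd ModularGroup.T τ = 1 := by simp [cd, ModularGroup.T]

theorem coe_S_smul (τ : ℍ) : ((ModularGroup.S • τ : ℍ) : ℂ) = -(τ : ℂ)⁻¹ := by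
  rw [modular_S_smul]
  simp [inv_neg]

theorem coe_T_smul (τ : ℍ) : ((ModularGroup.T • τ : ℍ) : ℂ) = (τ : ℂ) + 1 := by
  rw [modular_T_smul, UpperHalfPlane.coe_vadd, add_comm]
  simp

/-- The action `f ↦ f((cτ+d)⁻¹ X, γτ)` on families of power series. -/
def slashPS (γ : SL(2, ℤ)) (f : ℍ → PowerSeries ℂ) (τ : ℍ) : PowerSeries ℂ :=
  PowerSeries.rescale (cd γ τ)⁻¹ (f (γ • τ))

theorem slashPS_one (f : ℍ → PowerSeries ℂ) : slashPS 1 f = f := by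
  ext1 τ
  rw [slashPS, cd_one, inv_one, PowerSeries.rescale_one, one_smul]
  rfl

theorem slashPS_mul (γ δ : SL(2, ℤ)) (f : ℍ → PowerSeries ℂ) :
    slashPS (γ * δ) f = slashPS δ (slashPS γ f) := by
  ext1 τ
  rw [slashPS, slashPS, slashPS, PowerSeries.rescale_rescale, mul_smul, cd_mul, mul_inv]

/-- The subgroup fixing a family of power series. -/
def fixer (f : ℍ → PowerSeries ℂ) : Subgroup SL(2, ℤ) where
  carrier := {γ | slashPS γ f = f}
  one_mem' := slashPS_one f
  mul_mem' {γ δ} hγ hδ := by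
    change slashPS (γ * δ) f = f
    rw [slashPS_mul, hγ, hδ]
  inv_mem' {γ} hγ := by
    change slashPS γ⁻¹ f = f
    conv_lhs => rw [← show slashPS γ f = f from hγ]
    rw [← slashPS_mul, mul_inv_cancel, slashPS_one]

theorem slashPS_smul (γ : SL(2, ℤ)) (c : ℂ) (f : ℍ → PowerSeries ℂ) :
    slashPS γ (c • f) = c • slashPS γ f := by
  ext τ j
  simp only [slashPS, PowerSeries.coeff_rescale, Pi.smul_apply, PowerSeries.coeff_smul, smul_eq_mul]
  ring

theorem slashPS_mem {X : Set (ℍ → PowerSeries ℂ)} (hX : X.Finite)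
    (hS : ∀ f ∈ X, slashPS ModularGroup.S f ∈ X) (hT : ∀ f ∈ X, slashPS ModularGroup.T f ∈ X)
    (γ : SL(2, ℤ)) : ∀ f ∈ X, slashPS γ f ∈ X := by
  have hγ : γ ∈ Subgroup.closure {ModularGroup.S, ModularGroup.T} := by
    rw [SpecialLinearGroup.SL2Z_generators]; trivial
  induction hγ using Subgroup.closure_induction with
  | mem x hx => rcases hx with rfl | rfl <;> assumption
  | one => exact fun f hf => by rwa [slashPS_one]
  | mul x y _ _ hx hy => exact fun f hf => by rw [slashPS_mul]; exact hy _ (hx _ hf)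
  -- An injective self-map of a finite set is onto, so the inverse also preserves X.
  | inv x _ hx =>
    intro f hf
    have hinj : Set.InjOn (slashPS x) X := fun a _ b _ hab => by
      have := congrArg (slashPS x⁻¹) hab
      rwa [← slashPS_mul, ← slashPS_mul, mul_inv_cancel, slashPS_one, slashPS_one] at this
    have himage : slashPS x '' X = X := Set.eq_of_subset_of_ncard_le
      (by rintro _ ⟨a, ha, rfl⟩; exact hx a ha) hinj.ncard_image.ge hX
    rw [← himage] at hf
    obtain ⟨g, hg, rfl⟩ := hf
    rwa [← slashPS_mul, mul_inv_cancel, slashPS_one]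

/-- Orbit and stabilizer: the whole orbit of f lies in the finite set X. -/
theorem finiteIndex_fixer {X : Set (ℍ → PowerSeries ℂ)} (hX : X.Finite)
    (hS : ∀ f ∈ X, slashPS ModularGroup.S f ∈ X) (hT : ∀ f ∈ X, slashPS ModularGroup.T f ∈ X)
    {f : ℍ → PowerSeries ℂ} (hf : f ∈ X) : (fixer f).FiniteIndex := by
  have := hX.to_subtype
  -- `slashPS` is a right action; the inverse makes the orbit map constant on left cosets.
  let F : SL(2, ℤ) → X := fun γ => ⟨slashPS γ⁻¹ f, slashPS_mem hX hS hT _ _ hf⟩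
  have hF : ∀ γ δ : SL(2, ℤ), F γ = F δ ↔ γ⁻¹ * δ ∈ fixer f := by
    intro γ δ
    rw [Subtype.mk.injEq]
    change _ ↔ slashPS (γ⁻¹ * δ) f = f
    rw [slashPS_mul]
    constructor
    · intro h
      rw [h, ← slashPS_mul, inv_mul_cancel, slashPS_one]
    · intro h
      conv_rhs => rw [← h]
      rw [← slashPS_mul δ δ⁻¹, mul_inv_cancel, slashPS_one]
  have : Finite (SL(2, ℤ) ⧸ fixer f) := by
    refine Finite.of_injective (β := X)
      (Quotient.lift F fun γ δ h => (hF γ δ).2 (QuotientGroup.leftRel_apply.1 h)) ?_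
    rintro ⟨γ⟩ ⟨δ⟩ h
    exact QuotientGroup.eq.2 ((hF γ δ).1 h)
  exact Subgroup.finiteIndex_of_finite_quotient

/-- Invariance of one power series encodes all weights at once: rescaling X by (cτ+d)⁻¹ gives the
j-th coefficient weight j. -/
theorem coeff_smul_of_mem_fixer {f : ℍ → PowerSeries ℂ} {γ : SL(2, ℤ)} (h : γ ∈ fixer f) (j : ℕ)
    (τ : ℍ) : PowerSeries.coeff j (f (γ • τ)) = cd γ τ ^ j * PowerSeries.coeff j (f τ) := by
  have h' : slashPS γ f = f := h
  rw [← congrFun h' τ, slashPS, PowerSeries.coeff_rescale, ← mul_assoc, ← mul_pow,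
    mul_inv_cancel₀ (cd_ne_zero γ τ), one_pow, one_mul]

/-- The set of all twists by 24-th roots of unity of a finite family. -/
def rootTwists {ι : Type*} (f : ι → ℍ → PowerSeries ℂ) : Set (ℍ → PowerSeries ℂ) :=
  {g | ∃ ζ : ℂ, ζ ^ 24 = 1 ∧ ∃ i, g = ζ • f i}

theorem finite_rootTwists {ι : Type*} [Finite ι] (f : ι → ℍ → PowerSeries ℂ) :
    (rootTwists f).Finite := by
  have h1 : {ζ : ℂ | ζ ^ 24 = 1}.Finite := by
    refine (Polynomial.nthRootsFinset 24 (1 : ℂ)).finite_toSet.subset fun ζ hζ => ?_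
    simpa [Polynomial.mem_nthRootsFinset] using hζ
  refine ((h1.prod (Set.finite_univ (α := ι))).image fun x => x.1 • f x.2).subset ?_
  rintro g ⟨ζ, hζ, i, rfl⟩
  exact ⟨(ζ, i), ⟨hζ, trivial⟩, rfl⟩

theorem slashPS_mem_rootTwists {ι κ : Type*} {f : ι → ℍ → PowerSeries ℂ}
    {f' : κ → ℍ → PowerSeries ℂ} {γ : SL(2, ℤ)} (h : ∀ i, slashPS γ (f i) ∈ rootTwists f') :
    ∀ g ∈ rootTwists f, slashPS γ g ∈ rootTwists f' := by
  rintro _ ⟨ζ, hζ, i, rfl⟩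
  obtain ⟨ξ, hξ, k, hk⟩ := h i
  exact ⟨ζ * ξ, by rw [mul_pow, hζ, hξ, one_mul], k, by rw [slashPS_smul, hk, smul_smul]⟩

end InfiniteWedge

end

noncomputable section

namespace InfiniteWedge

open UpperHalfPlane hiding I
open Complex Function
open scoped ModularForm

/-! ### Completed theta series -/

/-- The completed Taylor series of the theta function with characteristics, divided by `η`. -/
def psi (a b : ℝ) (τ : ℍ) : PowerSeries ℂ :=
  (η (τ : ℂ))⁻¹ • (gaussPS (Real.pi / (2 * τ.im)) * thetaPS a b τ)

theorem rescale_smul (s c : ℂ) (p : PowerSeries ℂ) :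
    PowerSeries.rescale s (c • p) = c • PowerSeries.rescale s p := by
  ext j
  simp only [PowerSeries.coeff_rescale, PowerSeries.coeff_smul, smul_eq_mul]
  ring

/-- The Gaussian completion absorbs the anomaly exp(πiz²/τ): from Im(-1/τ) = y/(ττ̄) and τ̄ = τ -
2iy one gets τ⁻² · π/(2 Im(-1/τ)) + πi/τ = π/(2y). Division by η cancels (-iτ)^(1/2). -/
theorem slashPS_S_psi (a b : ℝ) :
    slashPS ModularGroup.S (psi a b) = cexp (2 * Real.pi * I * a * b) • psi b (-a) := by
  ext1 τ
  have hτ0 : (τ : ℂ) ≠ 0 := τ.ne_zero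
  have him : ((ModularGroup.S • τ).im : ℂ) = τ.im / ((τ : ℂ) * (starRingEnd ℂ) τ) := by
    rw [ModularGroup.im_smul_eq_div_normSq, ← cd_eq_denom, cd_S, Complex.mul_conj]
    push_cast
    rfl
  have hconj0 : (starRingEnd ℂ) (τ : ℂ) ≠ 0 := by simpa using hτ0
  have hy : ((τ.im : ℝ) : ℂ) ≠ 0 := by exact_mod_cast τ.im_pos.ne'
  have hconj : (starRingEnd ℂ) (τ : ℂ) = τ - 2 * I * (τ.im : ℂ) := by
    have := Complex.sub_conj (τ : ℂ)
    rw [UpperHalfPlane.coe_im] at this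
    push_cast at this
    linear_combination -this
  have hg : ((τ : ℂ)⁻¹) ^ 2 * (Real.pi / (2 * ((ModularGroup.S • τ).im : ℂ))) +
      Real.pi * I / τ = Real.pi / (2 * τ.im) := by
    rw [him, hconj]
    rw [hconj] at hconj0
    field_simp
    ring
  have hc : (-I * (τ : ℂ)) ^ (1 / 2 : ℂ) ≠ 0 := by
    rw [Ne, Complex.cpow_eq_zero_iff]
    simp [hτ0]
  rw [slashPS, psi, cd_S, rescale_smul, map_mul, rescale_gaussPS, coe_S_smul, thetaPS_S _ _ τ.im_pos,
    eta_S, mul_smul_comm, ← mul_assoc, ← gaussPS_add, hg, smul_smul, Pi.smul_apply, psi, smul_smul]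
  congr 1
  have := eta_ne_zero τ
  field_simp

theorem slashPS_T_psi (a b : ℝ) :
    slashPS ModularGroup.T (psi a b) =
      (cexp (-(Real.pi * I * (a ^ 2 + a))) * cexp (-(Real.pi * I / 12))) • psi a (a + b + 1 / 2) := by
  ext1 τ
  have him : (ModularGroup.T • τ).im = τ.im := by
    rw [modular_T_smul, UpperHalfPlane.vadd_im]
  rw [slashPS, psi, cd_T, inv_one, PowerSeries.rescale_one, RingHom.id_apply, him, coe_T_smul,
    thetaPS_T _ _ τ.im_pos, eta_T, Pi.smul_apply, psi, smul_smul, mul_smul_comm, smul_smul, mul_inv,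
    ← Complex.exp_neg]
  congr 1
  ring

theorem psi_add_one_left (a b : ℝ) : psi (a + 1) b = psi a b := by
  ext1 τ
  rw [psi, psi, thetaPS_add_one_left _ _ τ.im_pos]

theorem psi_add_one_right (a b : ℝ) : psi a (b + 1) = cexp (2 * Real.pi * I * a) • psi a b := by
  ext1 τ
  rw [psi, Pi.smul_apply, psi, thetaPS_add_one_right _ _ τ.im_pos, mul_smul_comm, smul_comm]

theorem psi_add_int_left (a b : ℝ) (m : ℤ) : psi (a + m) b = psi a b := by
  have h : Periodic (fun a => psi a b) 1 := fun a => psi_add_one_left a b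
  simpa using h.int_mul m a

theorem psi_add_int_right (a b : ℝ) (m : ℤ) :
    psi a (b + m) = cexp (2 * Real.pi * I * a) ^ m • psi a b := by
  have h0 : cexp (2 * Real.pi * I * a) ≠ 0 := Complex.exp_ne_zero _
  induction m with
  | zero => simp
  | succ n ih =>
    rw [Int.cast_add, Int.cast_one, ← add_assoc, psi_add_one_right, ih, smul_smul, zpow_add₀ h0,
      zpow_one, mul_comm]
  | pred n ih =>
    have := psi_add_one_right a (b + ((-(n : ℤ) - 1 : ℤ) : ℝ))
    have e : b + ((-(n : ℤ) - 1 : ℤ) : ℝ) + 1 = b + ((-(n : ℤ) : ℤ) : ℝ) := by push_cast; ring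
    rw [e, ih] at this
    rw [zpow_sub₀ h0, zpow_one, div_eq_mul_inv, mul_comm, ← smul_smul, this, smul_smul,
      inv_mul_cancel₀ h0, one_smul]

/-- The completed theta series with half-integral characteristics. -/
def psiHalf (x : Fin 2 × Fin 2) : ℍ → PowerSeries ℂ := psi ((x.1 : ℕ) / 2) ((x.2 : ℕ) / 2)

theorem exp_pow_24_eq_one {z : ℂ} (k : ℤ) (h : 12 * z = k * (Real.pi * I)) :
    cexp z ^ 24 = 1 := by
  rw [← Complex.exp_nat_mul, Complex.exp_eq_one_iff]
  exact ⟨k, by push_cast; linear_combination 2 * h⟩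

theorem int_half_eq (k : ℤ) : ∃ (i : Fin 2) (m : ℤ), (k : ℝ) / 2 = (i : ℕ) / 2 + m := by
  rcases Int.even_or_odd' k with ⟨m, rfl | rfl⟩
  · exact ⟨0, m, by push_cast; simp⟩
  · exact ⟨1, m, by push_cast; simp; ring⟩

/-- Integral shifts of half-integral characteristics cost only a sign, so four pairs suffice. -/
theorem psi_mem_rootTwists (k l : ℤ) : psi (k / 2) (l / 2) ∈ rootTwists psiHalf := by
  obtain ⟨i, m, hi⟩ := int_half_eq k
  obtain ⟨j, n, hj⟩ := int_half_eq l
  refine ⟨cexp (2 * Real.pi * I * ((i : ℕ) / 2 : ℝ)) ^ n, ?_, (i, j), ?_⟩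
  · rw [← zpow_natCast, zpow_comm, zpow_natCast, exp_pow_24_eq_one (12 * (i : ℕ)), one_zpow]
    push_cast
    ring
  · rw [hi, hj, psi_add_int_left, psi_add_int_right]
    rfl

theorem slashPS_S_mem_psiHalf : ∀ g ∈ rootTwists psiHalf,
    slashPS ModularGroup.S g ∈ rootTwists psiHalf := by
  refine slashPS_mem_rootTwists fun x => ?_
  obtain ⟨ζ, hζ, i, hi⟩ := psi_mem_rootTwists (x.2 : ℕ) (-(x.1 : ℕ))
  rw [psiHalf, slashPS_S_psi]
  have e : -(((x.1 : ℕ) : ℝ) / 2) = ((-(x.1 : ℕ) : ℤ) : ℝ) / 2 := by push_cast; ring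
  rw [e, ← Int.cast_natCast (x.2 : ℕ), hi, smul_smul]
  refine ⟨_, ?_, i, rfl⟩
  rw [mul_pow, hζ, mul_one]
  refine exp_pow_24_eq_one (6 * (x.1 : ℕ) * (x.2 : ℕ)) ?_
  push_cast
  ring

theorem slashPS_T_mem_psiHalf : ∀ g ∈ rootTwists psiHalf,
    slashPS ModularGroup.T g ∈ rootTwists psiHalf := by
  refine slashPS_mem_rootTwists fun x => ?_
  obtain ⟨ζ, hζ, i, hi⟩ := psi_mem_rootTwists (x.1 : ℕ) ((x.1 : ℕ) + (x.2 : ℕ) + 1)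
  rw [psiHalf, slashPS_T_psi]
  have e : ((x.1 : ℕ) : ℝ) / 2 + ((x.2 : ℕ) : ℝ) / 2 + 1 / 2 =
      (((x.1 : ℕ) + (x.2 : ℕ) + 1 : ℤ) : ℝ) / 2 := by push_cast; ring
  rw [e, ← Int.cast_natCast (x.1 : ℕ), hi, smul_smul]
  refine ⟨_, ?_, i, rfl⟩
  rw [mul_pow, hζ, mul_one, ← Complex.exp_add]
  -- The integer is 12 times the phase -(a² + a) - 1/12 at a = x.1/2.
  refine exp_pow_24_eq_one (-3 * (x.1 : ℕ) ^ 2 - 6 * (x.1 : ℕ) - 1) ?_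
  push_cast
  ring

theorem slashPS_psiHalf_mem (γ : SL(2, ℤ)) (x : Fin 2 × Fin 2) :
    slashPS γ (psiHalf x) ∈ rootTwists psiHalf :=
  slashPS_mem (finite_rootTwists _) slashPS_S_mem_psiHalf slashPS_T_mem_psiHalf γ _
    ⟨1, one_pow _, x, (one_smul _ _).symm⟩

theorem finiteIndex_fixer_psiHalf (x : Fin 2 × Fin 2) : (fixer (psiHalf x)).FiniteIndex :=
  finiteIndex_fixer (finite_rootTwists _) slashPS_S_mem_psiHalf slashPS_T_mem_psiHalf
    ⟨1, one_pow _, x, (one_smul _ _).symm⟩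

/-! ### The square of the eta function -/

/-- The weight one form `η²`, as a family of power series. -/
def etaSq (τ : ℍ) : PowerSeries ℂ := PowerSeries.monomial 1 (η (τ : ℂ) ^ 2)

theorem slashPS_S_etaSq : slashPS ModularGroup.S etaSq = (-I) • etaSq := by
  ext τ j
  have := τ.ne_zero
  rw [slashPS, etaSq, PowerSeries.coeff_rescale, Pi.smul_apply, PowerSeries.coeff_smul, etaSq,
    PowerSeries.coeff_monomial, PowerSeries.coeff_monomial, cd_S, coe_S_smul, eta_S, mul_pow,
    sq_cpow_half]
  split_ifs with h
  · subst h
    simp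
    field_simp
  · simp

theorem slashPS_T_etaSq : slashPS ModularGroup.T etaSq = cexp (Real.pi * I / 12) ^ 2 • etaSq := by
  ext τ j
  rw [slashPS, etaSq, PowerSeries.coeff_rescale, Pi.smul_apply, PowerSeries.coeff_smul, etaSq,
    PowerSeries.coeff_monomial, PowerSeries.coeff_monomial, cd_T, coe_T_smul, eta_T, mul_pow]
  split_ifs with h <;> simp

theorem etaSq_mem_rootTwists : etaSq ∈ rootTwists fun _ : Unit => etaSq :=
  ⟨1, one_pow _, (), (one_smul _ _).symm⟩

theorem slashPS_S_mem_etaSq : ∀ g ∈ rootTwists fun _ : Unit => etaSq,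
    slashPS ModularGroup.S g ∈ rootTwists fun _ : Unit => etaSq :=
  slashPS_mem_rootTwists fun _ => ⟨-I, by
    rw [show (24 : ℕ) = 4 * 6 from rfl, pow_mul, neg_pow, Complex.I_pow_four]; norm_num, (),
    slashPS_S_etaSq⟩

theorem slashPS_T_mem_etaSq : ∀ g ∈ rootTwists fun _ : Unit => etaSq,
    slashPS ModularGroup.T g ∈ rootTwists fun _ : Unit => etaSq :=
  slashPS_mem_rootTwists fun _ => ⟨_, by
    rw [← pow_mul, Nat.mul_comm, pow_mul, exp_pow_24_eq_one 1 (by push_cast; ring), one_pow], (),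
    slashPS_T_etaSq⟩

theorem finiteIndex_fixer_etaSq : (fixer etaSq).FiniteIndex :=
  finiteIndex_fixer (finite_rootTwists _) slashPS_S_mem_etaSq slashPS_T_mem_etaSq
    etaSq_mem_rootTwists

/-- Placing η² in degree one lets the rescaling supply its factor cτ + d; what remains is a 24-th
root of unity ε. -/
theorem exists_eta_sq_smul (γ : SL(2, ℤ)) : ∃ ε : ℂ, ε ≠ 0 ∧ ∀ τ : ℍ,
    η ((γ • τ : ℍ) : ℂ) ^ 2 = ε * cd γ τ * η (τ : ℂ) ^ 2 := by
  obtain ⟨ε, hε, _, h⟩ := slashPS_mem (finite_rootTwists _) slashPS_S_mem_etaSq slashPS_T_mem_etaSq γ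
    _ etaSq_mem_rootTwists
  refine ⟨ε, by rintro rfl; simp at hε, fun τ => ?_⟩
  have := congrArg (PowerSeries.coeff 1) (congrFun h τ)
  simp only [slashPS, PowerSeries.coeff_rescale, Pi.smul_apply, PowerSeries.coeff_smul, etaSq,
    PowerSeries.coeff_monomial_same, pow_one, smul_eq_mul] at this
  have h0 := cd_ne_zero γ τ
  field_simp at this
  linear_combination this

theorem eta_sq_smul {γ : SL(2, ℤ)} (h : γ ∈ fixer etaSq) (τ : ℍ) :
    η ((γ • τ : ℍ) : ℂ) ^ 2 = cd γ τ * η (τ : ℂ) ^ 2 := by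
  have := coeff_smul_of_mem_fixer h 1 τ
  simpa [etaSq, PowerSeries.coeff_monomial_same] using this

end InfiniteWedge

end

noncomputable section

namespace InfiniteWedge

open UpperHalfPlane hiding I
open Complex Function
open scoped ModularForm

/-! ### The theta function `θ(τ) = ∑ q^{n²}` divided by `η` -/

theorem hasSum_int_even_add_odd {f : ℤ → ℂ} {m m' : ℂ} (he : HasSum (fun k : ℤ => f (2 * k)) m)
    (ho : HasSum (fun k : ℤ => f (2 * k + 1)) m') : HasSum f (m + m') := by
  have hinj : Injective fun k : ℤ => 2 * k := fun a b h => by simpa using h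
  have hinj' : Injective fun k : ℤ => 2 * k + 1 := fun a b h => by simpa using h
  refine HasSum.add_isCompl ?_ (hinj.hasSum_range_iff.2 he) (hinj'.hasSum_range_iff.2 ho)
  have h1 : Set.range (fun k : ℤ => 2 * k) = {n | Even n} := by
    ext n
    simp [even_iff_exists_two_mul]
  have h2 : Set.range (fun k : ℤ => 2 * k + 1) = {n | Odd n} := by
    ext n
    simp [Odd]
  rw [h1, h2]
  exact Int.isCompl_even_odd

/-- The two theta series `∑ q^{n²}` and `∑ q^{(n+1/2)²}`. -/
def thetaTwo (a : ℝ) (τ : ℂ) : ℂ := thetaFun a 0 0 (2 * τ)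

theorem hasSum_thetaTwo (a : ℝ) {τ : ℂ} (hτ : 0 < τ.im) :
    HasSum (fun n : ℤ => cexp (2 * Real.pi * I * (n + a) ^ 2 * τ)) (thetaTwo a τ) := by
  refine (hasSum_thetaFun a 0 0 (τ := 2 * τ) (by simpa)).congr_fun fun n => ?_
  congr 1
  push_cast
  ring

theorem theta_eq_thetaTwo (τ : ℍ) : theta τ = thetaTwo 0 τ := by
  rw [theta, jacobiTheta_eq_jacobiTheta₂, thetaTwo, thetaFun]
  simp

theorem thetaFun_half_add (τ : ℍ) :
    thetaFun 0 0 0 ((τ : ℂ) / 2) = thetaTwo 0 τ + thetaTwo (1 / 2) τ := by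
  refine (hasSum_thetaFun 0 0 0 (τ := (τ : ℂ) / 2) (by simpa using τ.im_pos)).unique ?_
  refine hasSum_int_even_add_odd ((hasSum_thetaTwo 0 τ.im_pos).congr_fun fun n => ?_)
    ((hasSum_thetaTwo (1 / 2) τ.im_pos).congr_fun fun n => ?_)
  all_goals
    congr 1
    push_cast
    ring

theorem thetaFun_half_sub (τ : ℍ) :
    thetaFun 0 (-(1 / 2)) 0 ((τ : ℂ) / 2) = thetaTwo 0 τ - thetaTwo (1 / 2) τ := by
  refine (hasSum_thetaFun 0 (-(1 / 2)) 0 (τ := (τ : ℂ) / 2) (by simpa using τ.im_pos)).unique ?_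
  rw [sub_eq_add_neg]
  refine hasSum_int_even_add_odd ((hasSum_thetaTwo 0 τ.im_pos).congr_fun fun n => ?_)
    ((hasSum_thetaTwo (1 / 2) τ.im_pos).neg.congr_fun fun n => ?_)
  · rw [Complex.exp_eq_exp_iff_exists_int]
    refine ⟨-n, ?_⟩
    push_cast
    ring
  · rw [neg_eq_neg_one_mul (cexp _), ← Complex.exp_pi_mul_I, ← Complex.exp_add,
      Complex.exp_eq_exp_iff_exists_int]
    refine ⟨-n - 1, ?_⟩
    push_cast
    ring

theorem cpow_half_div_two {z : ℂ} (hz : z ≠ 0) :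
    (z / 2) ^ (1 / 2 : ℂ) = (Real.sqrt 2 : ℂ)⁻¹ * z ^ (1 / 2 : ℂ) := by
  have h2 : z / 2 = ((1 / 2 : ℝ) : ℂ) * z := by push_cast; ring
  rw [Complex.cpow_def_of_ne_zero hz, Complex.cpow_def_of_ne_zero (div_ne_zero hz two_ne_zero), h2,
    Complex.log_ofReal_mul (by norm_num) hz, add_mul, Complex.exp_add]
  congr 1
  have : (Real.log (1 / 2) : ℂ) * (1 / 2) = ((Real.log (1 / 2) * (1 / 2) : ℝ) : ℂ) := by
    push_cast; ring
  rw [this, ← Complex.ofReal_exp, ← Complex.ofReal_inv, ← Real.rpow_def_of_pos (by norm_num),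
    ← Real.sqrt_eq_rpow, one_div, Real.sqrt_inv]

/-- Under τ ↦ -1/τ the argument 2τ becomes -1/(τ/2), so inversion leads to a theta series at τ/2;
sorting its terms by the parity of n returns to 2τ. -/
theorem thetaTwo_zero_S (τ : ℍ) : thetaTwo 0 (-(τ : ℂ)⁻¹) =
    (Real.sqrt 2 : ℂ)⁻¹ * (-I * τ) ^ (1 / 2 : ℂ) * (thetaTwo 0 τ + thetaTwo (1 / 2) τ) := by
  have h := thetaFun_S 0 0 0 (τ := (τ : ℂ) / 2) (by simpa using τ.im_pos)
  have e : (2 : ℂ) * -(τ : ℂ)⁻¹ = -((τ : ℂ) / 2)⁻¹ := by rw [inv_div]; ring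
  rw [thetaTwo, e]
  rw [mul_zero] at h
  rw [h, neg_zero, thetaFun_half_add, ← mul_div_assoc, cpow_half_div_two (by simp [τ.ne_zero])]
  simp

theorem thetaTwo_half_S (τ : ℍ) : thetaTwo (1 / 2) (-(τ : ℂ)⁻¹) =
    (Real.sqrt 2 : ℂ)⁻¹ * (-I * τ) ^ (1 / 2 : ℂ) * (thetaTwo 0 τ - thetaTwo (1 / 2) τ) := by
  have h := thetaFun_S (1 / 2) 0 0 (τ := (τ : ℂ) / 2) (by simpa using τ.im_pos)
  have e : (2 : ℂ) * -(τ : ℂ)⁻¹ = -((τ : ℂ) / 2)⁻¹ := by rw [inv_div]; ring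
  rw [thetaTwo, e]
  rw [mul_zero] at h
  rw [h, thetaFun_half_sub, ← mul_div_assoc, cpow_half_div_two (by simp [τ.ne_zero])]
  simp

theorem thetaTwo_zero_T (τ : ℍ) : thetaTwo 0 ((τ : ℂ) + 1) = thetaTwo 0 τ := by
  refine (hasSum_thetaTwo 0 (τ := (τ : ℂ) + 1) (by simpa using τ.im_pos)).unique
    ((hasSum_thetaTwo 0 τ.im_pos).congr_fun fun n => ?_)
  rw [Complex.exp_eq_exp_iff_exists_int]
  refine ⟨n ^ 2, ?_⟩
  push_cast
  ring

theorem thetaTwo_half_T (τ : ℍ) : thetaTwo (1 / 2) ((τ : ℂ) + 1) = I * thetaTwo (1 / 2) τ := by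
  refine (hasSum_thetaTwo (1 / 2) (τ := (τ : ℂ) + 1) (by simpa using τ.im_pos)).unique
    (((hasSum_thetaTwo (1 / 2) τ.im_pos).mul_left I).congr_fun fun n => ?_)
  have hI : ∀ w : ℂ, I * w = cexp (Real.pi / 2 * I) * w := fun w => by
    rw [Complex.exp_pi_div_two_mul_I]
  rw [hI, ← Complex.exp_add, Complex.exp_eq_exp_iff_exists_int]
  refine ⟨n ^ 2 + n, ?_⟩
  push_cast
  ring

/-- The function `(c ∑ q^{n²} + d ∑ q^{(n+1/2)²}) / η`. -/
def thetaPair (c : ℂ × ℂ) (τ : ℍ) : PowerSeries ℂ :=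
  PowerSeries.C ((c.1 * thetaTwo 0 τ + c.2 * thetaTwo (1 / 2) τ) / η (τ : ℂ))

theorem rescale_C (s c : ℂ) : PowerSeries.rescale s (PowerSeries.C c) = PowerSeries.C c := by
  ext j
  rw [PowerSeries.coeff_rescale, PowerSeries.coeff_C]
  split_ifs with h
  · simp [h]
  · simp

theorem smul_thetaPair (s : ℂ) (c : ℂ × ℂ) : s • thetaPair c = thetaPair (s • c) := by
  ext1 τ
  rw [Pi.smul_apply, thetaPair, thetaPair, PowerSeries.smul_eq_C_mul, ← map_mul]
  congr 1
  simp only [Prod.smul_fst, Prod.smul_snd, smul_eq_mul]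
  ring

theorem slashPS_S_thetaPair (c : ℂ × ℂ) : slashPS ModularGroup.S (thetaPair c) =
    thetaPair ((Real.sqrt 2 : ℂ)⁻¹ • (c.1 + c.2, c.1 - c.2)) := by
  ext1 τ
  have h0 := eta_ne_zero τ
  have hc : (-I * (τ : ℂ)) ^ (1 / 2 : ℂ) ≠ 0 := by
    rw [Ne, Complex.cpow_eq_zero_iff]
    simp [τ.ne_zero]
  rw [slashPS, thetaPair, rescale_C, thetaPair, coe_S_smul, eta_S, thetaTwo_zero_S, thetaTwo_half_S]
  congr 1
  simp only [Prod.smul_fst, Prod.smul_snd, smul_eq_mul]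
  generalize (-I * (τ : ℂ)) ^ (1 / 2 : ℂ) = u at hc ⊢
  field_simp
  ring

theorem slashPS_T_thetaPair (c : ℂ × ℂ) : slashPS ModularGroup.T (thetaPair c) =
    thetaPair (cexp (-(Real.pi * I / 12)) • (c.1, I * c.2)) := by
  ext1 τ
  have h0 := eta_ne_zero τ
  rw [slashPS, thetaPair, rescale_C, thetaPair, coe_T_smul, eta_T, thetaTwo_zero_T, thetaTwo_half_T]
  congr 1
  simp only [Prod.smul_fst, Prod.smul_snd, smul_eq_mul, Complex.exp_neg]
  have := Complex.exp_ne_zero (Real.pi * I / 12)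
  field_simp

/-- Coefficient vectors of the six functions permuted up to roots of unity by the modular group. -/
def thetaVec : Fin 6 → ℂ × ℂ :=
  ![(Real.sqrt 2, 0), (0, Real.sqrt 2), (1, 1), (1, -1), (1, I), (1, -I)]

theorem thetaPair_mem {c : ℂ × ℂ} (ζ : ℂ) (hζ : ζ ^ 24 = 1) (i : Fin 6) (h : c = ζ • thetaVec i) :
    thetaPair c ∈ rootTwists fun i => thetaPair (thetaVec i) :=
  ⟨ζ, hζ, i, by rw [smul_thetaPair, h]⟩

theorem sqrt_two_sq : (Real.sqrt 2 : ℂ) ^ 2 = 2 := by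
  rw [← Complex.ofReal_pow, Real.sq_sqrt (by norm_num)]
  norm_num

theorem sqrt_two_ne_zero : (Real.sqrt 2 : ℂ) ≠ 0 := by
  intro h
  have := sqrt_two_sq
  rw [h] at this
  norm_num at this

theorem inv_sqrt_two_mul_pow {w : ℂ} (hw : w ^ 8 = 16) : ((Real.sqrt 2 : ℂ)⁻¹ * w) ^ 24 = 1 := by
  have h : (Real.sqrt 2 : ℂ) ^ 24 = 2 ^ 12 := by
    rw [show (24 : ℕ) = 2 * 12 from rfl, pow_mul, sqrt_two_sq]
  rw [mul_pow, inv_pow, h, show (24 : ℕ) = 8 * 3 from rfl, pow_mul, hw]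
  norm_num

/-- Up to the multiplier of η, the generators S and T act on coefficient pairs by the Hadamard
matrix and by diag(1, i). The six vectors, all of length √2, are eigenvectors of the three Pauli
matrices, and these two matrices permute them up to roots of unity. -/
theorem slashPS_S_mem_thetaPair : ∀ g ∈ rootTwists fun i => thetaPair (thetaVec i),
    slashPS ModularGroup.S g ∈ rootTwists fun i => thetaPair (thetaVec i) := by
  refine slashPS_mem_rootTwists fun i => ?_
  rw [slashPS_S_thetaPair]
  have h2 := sqrt_two_sq
  have h0 := sqrt_two_ne_zero
  have hI := Complex.I_sq
  fin_cases i
  · refine thetaPair_mem 1 (one_pow _) 2 ?_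
    simp [thetaVec]
  · refine thetaPair_mem 1 (one_pow _) 3 ?_
    simp [thetaVec]
  · refine thetaPair_mem 1 (one_pow _) 0 ?_
    simp [thetaVec]
    field_simp
    linear_combination -h2
  · refine thetaPair_mem 1 (one_pow _) 1 ?_
    simp [thetaVec]
    field_simp
    linear_combination -h2
  -- (1 + i, 1 - i) = (1 + i)(1, -i), and (1 + i)/√2 is an eighth root of unity.
  · refine thetaPair_mem ((Real.sqrt 2 : ℂ)⁻¹ * (1 + I)) (inv_sqrt_two_mul_pow ?_) 5 ?_
    · have : (1 + I) ^ 2 = 2 * I := by linear_combination hI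
      rw [show (8 : ℕ) = 2 * 4 from rfl, pow_mul, this, mul_pow, Complex.I_pow_four]
      norm_num
    · simp [thetaVec]
      linear_combination (Real.sqrt 2 : ℂ)⁻¹ * hI
  · refine thetaPair_mem ((Real.sqrt 2 : ℂ)⁻¹ * (1 - I)) (inv_sqrt_two_mul_pow ?_) 4 ?_
    · have : (1 - I) ^ 2 = -2 * I := by linear_combination hI
      rw [show (8 : ℕ) = 2 * 4 from rfl, pow_mul, this, mul_pow, Complex.I_pow_four]
      norm_num
    · simp [thetaVec]
      constructor
      · ring
      · linear_combination (Real.sqrt 2 : ℂ)⁻¹ * hI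

theorem slashPS_T_mem_thetaPair : ∀ g ∈ rootTwists fun i => thetaPair (thetaVec i),
    slashPS ModularGroup.T g ∈ rootTwists fun i => thetaPair (thetaVec i) := by
  refine slashPS_mem_rootTwists fun i => ?_
  rw [slashPS_T_thetaPair]
  have hε : cexp (-(Real.pi * I / 12)) ^ 24 = 1 :=
    exp_pow_24_eq_one (-1) (by push_cast; ring)
  have hI : I ^ 24 = 1 := by
    rw [show (24 : ℕ) = 4 * 6 from rfl, pow_mul, Complex.I_pow_four, one_pow]
  fin_cases i
  · exact thetaPair_mem _ hε 0 (by simp [thetaVec])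
  · refine thetaPair_mem (cexp (-(Real.pi * I / 12)) * I) (by rw [mul_pow, hε, hI, one_mul]) 1 ?_
    simp [thetaVec, mul_assoc]
  · exact thetaPair_mem _ hε 4 (by simp [thetaVec])
  · exact thetaPair_mem _ hε 5 (by simp [thetaVec])
  · exact thetaPair_mem _ hε 3 (by simp [thetaVec])
  · exact thetaPair_mem _ hε 2 (by simp [thetaVec])

theorem finiteIndex_fixer_thetaPair (i : Fin 6) : (fixer (thetaPair (thetaVec i))).FiniteIndex :=
  finiteIndex_fixer (finite_rootTwists fun i => thetaPair (thetaVec i)) slashPS_S_mem_thetaPair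
    slashPS_T_mem_thetaPair ⟨1, one_pow _, i, (one_smul _ _).symm⟩

/-! ### The level -/

/-- The subgroup of finite index for which the characters are quasimodular. -/
def level : Subgroup SL(2, ℤ) :=
  CongruenceSubgroup.Gamma0 4 ⊓ (fixer (thetaPair (thetaVec 0)) ⊓
    (fixer etaSq ⊓ (fixer (psiHalf (0, 0)) ⊓ fixer (psiHalf (1, 1)))))

theorem finiteIndex_level : level.FiniteIndex := by
  have := finiteIndex_fixer_thetaPair 0
  have := finiteIndex_fixer_etaSq
  have := finiteIndex_fixer_psiHalf (0, 0)
  have := finiteIndex_fixer_psiHalf (1, 1)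
  unfold level
  infer_instance

/-- On `level` the functions θ and η have the same automorphy factor, so the half-integral factor
can be computed from η. -/
theorem theta_div_eta_smul {γ : SL(2, ℤ)} (h : γ ∈ level) (τ : ℍ) :
    theta (γ • τ) / η ((γ • τ : ℍ) : ℂ) = theta τ / η (τ : ℂ) := by
  have := coeff_smul_of_mem_fixer h.2.1 0 τ
  simp only [thetaPair, thetaVec, PowerSeries.coeff_zero_C, pow_zero, one_mul] at this
  simp only [Matrix.cons_val_zero, zero_mul, add_zero, mul_div_assoc] at this
  rw [theta_eq_thetaTwo, theta_eq_thetaTwo]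
  exact mul_left_cancel₀ sqrt_two_ne_zero this

end InfiniteWedge

end

noncomputable section

namespace InfiniteWedge

open UpperHalfPlane hiding I
open Complex Function
open scoped ModularForm

/-! ### Theta constants are periodic holomorphic functions -/

theorem norm_thetaCoeff_term (a b : ℝ) (j : ℕ) (n : ℤ) (τ : ℂ) :
    ‖((n : ℂ) + a) ^ j * cexp (2 * Real.pi * I * (n + a) * b + Real.pi * I * (n + a) ^ 2 * τ)‖ =
      |n + a| ^ j * Real.exp (-Real.pi * (n + a) ^ 2 * τ.im) := by
  rw [norm_mul, norm_theta_term, norm_pow]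
  congr 2
  rw [← Complex.ofReal_intCast, ← Complex.ofReal_add, Complex.norm_real, Real.norm_eq_abs]

theorem differentiableOn_thetaCoeff (a b : ℝ) (j : ℕ) :
    DifferentiableOn ℂ (thetaCoeff a b j) {z | 0 < z.im} := by
  intro z hz
  have hz' : 0 < z.im / 2 := half_pos hz
  have hopen : IsOpen {w : ℂ | z.im / 2 < w.im} := isOpen_lt continuous_const Complex.continuous_im
  have : DifferentiableOn ℂ (thetaCoeff a b j) {w | z.im / 2 < w.im} := by
    refine Complex.differentiableOn_tsum_of_summable_norm (summable_pow_gauss a j hz')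
      (fun n => by fun_prop) hopen fun n w hw => ?_
    rw [norm_thetaCoeff_term]
    have hw' : z.im / 2 < w.im := hw
    have h2 : 0 ≤ Real.pi * ((n : ℝ) + a) ^ 2 := by positivity
    gcongr ?_ * Real.exp ?_
    nlinarith
  exact (this.differentiableAt (hopen.mem_nhds (show z.im / 2 < z.im from half_lt_self hz))).differentiableWithinAt

/-- For y ≥ 1 each exponent satisfies (n+a)²y ≥ (n+a)² + m(y - 1); the constant is the series of
norms at y = 1 times e^(πm). -/
theorem norm_thetaCoeff_le (a b : ℝ) (j : ℕ) {m : ℝ} (hm : ∀ n : ℤ, m ≤ (n + a) ^ 2) :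
    ∃ C : ℝ, ∀ τ : ℂ, 1 ≤ τ.im → ‖thetaCoeff a b j τ‖ ≤ C * Real.exp (-Real.pi * m * τ.im) := by
  refine ⟨(∑' n : ℤ, |n + a| ^ j * Real.exp (-Real.pi * (n + a) ^ 2 * 1)) * Real.exp (Real.pi * m),
    fun τ hτ => ?_⟩
  have h1 := (summable_pow_gauss a j one_pos).hasSum.mul_right
    (Real.exp (Real.pi * m) * Real.exp (-Real.pi * m * τ.im))
  rw [mul_assoc]
  refine tsum_of_norm_bounded h1 fun n => ?_
  rw [norm_thetaCoeff_term, mul_assoc (|(n : ℝ) + a| ^ j)]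
  refine mul_le_mul_of_nonneg_left ?_ (pow_nonneg (abs_nonneg _) _)
  rw [← Real.exp_add, ← Real.exp_add, Real.exp_le_exp]
  nlinarith [hm n, Real.pi_pos, mul_nonneg (mul_nonneg Real.pi_pos.le (sub_nonneg.2 (hm n)))
    (sub_nonneg.2 hτ)]

theorem thetaCoeff_mem (k l : ℤ) (j : ℕ) :
    (fun τ : ℍ => thetaCoeff (k / 2) (l / 2) j τ) ∈ periodicHolo where
  holo := (differentiableOn_thetaCoeff (k / 2) (l / 2) j).congr fun z hz => by
    simp [ofComplex_apply_of_im_pos hz]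
  periodic := by
    -- 8π(n + k/2)² = 2π(2n + k)², so 8 is a period.
    refine ⟨8, by norm_num, fun τ => ?_⟩
    have e : ((((8 : ℕ) : ℝ) +ᵥ τ : ℍ) : ℂ) = τ + 8 := by
      rw [UpperHalfPlane.coe_vadd, add_comm]
      simp
    rw [e]
    refine (hasSum_thetaCoeff _ _ j (by simpa using τ.im_pos)).unique
      ((hasSum_thetaCoeff _ _ j τ.im_pos).congr_fun fun n => ?_)
    congr 1
    rw [Complex.exp_eq_exp_iff_exists_int]
    refine ⟨(2 * n + k) ^ 2, ?_⟩
    push_cast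
    ring
  growth := by
    obtain ⟨C, hC⟩ := norm_thetaCoeff_le (k / 2) (l / 2) j (m := 0) fun n => by positivity
    exact ⟨C, _, fun τ hτ => hC τ hτ⟩

/-! ### Quasimodular functions of a given weight -/

/-- Quasimodular functions of weight `κ / 2` for `level`. -/
def quasi (κ : ℤ) : Submodule ℂ (ℍ → ℂ) :=
  (Subalgebra.toSubmodule (weightZeroQuasi level)).comap
    (LinearMap.mulRight ℂ fun τ : ℍ => η (τ : ℂ) ^ (-κ))

theorem mem_quasi {κ : ℤ} {φ : ℍ → ℂ} :
    φ ∈ quasi κ ↔ (φ * fun τ : ℍ => η (τ : ℂ) ^ (-κ)) ∈ weightZeroQuasi level := Iff.rfl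

theorem mul_mem_quasi {κ κ' : ℤ} {φ ψ : ℍ → ℂ} (hφ : φ ∈ quasi κ) (hψ : ψ ∈ quasi κ') :
    φ * ψ ∈ quasi (κ + κ') := by
  rw [mem_quasi] at *
  have := mul_mem hφ hψ
  convert this using 1
  ext τ
  simp only [Pi.mul_apply]
  rw [neg_add, zpow_add₀ (eta_ne_zero τ)]
  ring

theorem eta_zpow_mem_quasi (κ : ℤ) : (fun τ : ℍ => η (τ : ℂ) ^ κ) ∈ quasi κ := by
  rw [mem_quasi]
  convert one_mem (weightZeroQuasi level) using 1
  ext τ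
  simp only [Pi.mul_apply, Pi.one_apply]
  rw [← zpow_add₀ (eta_ne_zero τ), add_neg_cancel, zpow_zero]

/-- The coefficients of `exp (π X² / (2y))` as polynomials in `1 / y`. -/
def gaussCoeff (i : ℕ) : ℂ := if Even i then (Real.pi / 2) ^ (i / 2) / (i / 2).factorial else 0

theorem coeff_gaussPS (i : ℕ) (τ : ℍ) :
    PowerSeries.coeff i (gaussPS (Real.pi / (2 * τ.im))) =
      gaussCoeff i * ((τ.im : ℂ)⁻¹) ^ (i / 2) := by
  rw [gaussPS, PowerSeries.coeff_mk, gaussCoeff]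
  split_ifs
  · rw [← div_div, div_eq_mul_inv _ (τ.im : ℂ), mul_pow]
    ring
  · simp

/-- The `j`-th coefficient of a completed theta series as a polynomial in `1 / y`. -/
def psiPoly (a b : ℝ) (j : ℕ) : Polynomial (ℍ → ℂ) :=
  ∑ i ∈ Finset.HasAntidiagonal.antidiagonal j, Polynomial.C (fun τ : ℍ => gaussCoeff i.1 *
    ((2 * Real.pi * I) ^ i.2 / i.2.factorial) * (thetaCoeff a b i.2 τ * (η (τ : ℂ))⁻¹)) *
      Polynomial.X ^ (i.1 / 2)

theorem evalInvIm_C (f : ℍ → ℂ) : evalInvIm (Polynomial.C f) = f := by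
  change Polynomial.aeval (R := ℍ → ℂ) _ (Polynomial.C f) = f
  simp

theorem evalInvIm_X : evalInvIm Polynomial.X = fun τ : ℍ => ((τ.im : ℂ))⁻¹ := by
  change Polynomial.aeval (R := ℍ → ℂ) _ Polynomial.X = _
  simp

theorem evalInvIm_psiPoly (a b : ℝ) (j : ℕ) (τ : ℍ) :
    evalInvIm (psiPoly a b j) τ = PowerSeries.coeff j (psi a b τ) := by
  rw [psiPoly, map_sum, Finset.sum_apply, psi, PowerSeries.coeff_smul, PowerSeries.coeff_mul,
    smul_eq_mul, Finset.mul_sum]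
  refine Finset.sum_congr rfl fun i _ => ?_
  rw [map_mul, map_pow, evalInvIm_C, evalInvIm_X, Pi.mul_apply, Pi.pow_apply, coeff_gaussPS, thetaPS,
    PowerSeries.coeff_mk]
  ring

/-- Only the constant term of the Gaussian is free of 1/y. Odd degrees, notably i = 1 where i / 2 =
0, are excluded because the Gaussian is even. -/
theorem psiPoly_coeff_zero (a b : ℝ) (j : ℕ) : (psiPoly a b j).coeff 0 = fun τ : ℍ =>
    (2 * Real.pi * I) ^ j / j.factorial * (thetaCoeff a b j τ * (η (τ : ℂ))⁻¹) := by
  rw [psiPoly, Polynomial.finsetSum_coeff, Finset.sum_eq_single (0, j)]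
  · ext τ
    simp [gaussCoeff]
  · rintro ⟨i, k⟩ hik hne
    rw [Polynomial.coeff_C_mul, Polynomial.coeff_X_pow]
    by_cases h : Even i
    · have : ¬ (0 = i / 2) := by
        intro h0
        obtain ⟨m, rfl⟩ := h
        have : m + m = 0 := by omega
        rw [Finset.HasAntidiagonal.mem_antidiagonal] at hik
        apply hne
        ext <;> simp <;> omega
      simp [this]
    · ext τ
      simp [gaussCoeff, h]
  · simp

theorem psiPoly_mem (k l : ℤ) (j : ℕ) : psiPoly (k / 2) (l / 2) j ∈ almostHoloPoly := by
  refine sum_mem fun i _ => mul_mem (C_mem_almostHoloPoly ?_) (pow_mem X_mem_almostHoloPoly _)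
  have h1 := mul_mem (thetaCoeff_mem k l i.2) eta_inv_mem
  exact periodicHolo.smul_mem h1 (gaussCoeff i.1 * ((2 * Real.pi * I) ^ i.2 / i.2.factorial))

theorem coeff_psiHalf_mem (x : Fin 2 × Fin 2) (j : ℕ) :
    (fun τ => PowerSeries.coeff j (psiHalf x τ)) ∈ almostHoloFun := by
  have := psiPoly_mem (x.1 : ℕ) (x.2 : ℕ) j
  rw [Int.cast_natCast, Int.cast_natCast] at this
  exact ⟨_, this, funext fun τ => evalInvIm_psiPoly _ _ j τ⟩

theorem eta_zpow_neg_two_mul (τ : ℍ) (j : ℕ) :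
    η (τ : ℂ) ^ (-(2 * j : ℤ)) = ((η (τ : ℂ) ^ 2) ^ j)⁻¹ := by
  rw [zpow_neg, ← pow_mul]
  norm_cast

/-- The j-th completed coefficient has weight j, so dividing it by (η²)^j gives weight zero. Its
part free of 1/y is a nonzero multiple of the theta constant over η^(1+2j). At the other cusps the
same shape recurs with another half-integral characteristic and a constant factor. -/
theorem thetaCoeff_mem_quasi {x : Fin 2 × Fin 2} (hx : level ≤ fixer (psiHalf x)) (j : ℕ) :
    (fun τ : ℍ => thetaCoeff ((x.1 : ℕ) / 2) ((x.2 : ℕ) / 2) j τ) ∈ quasi (1 + 2 * j) := by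
  have hc : ((2 * Real.pi * I) ^ j / (j.factorial : ℂ)) ≠ 0 := by
    have := Real.pi_ne_zero
    have := Nat.factorial_ne_zero j
    simp [*]
  set p := Polynomial.C (fun τ : ℍ => η (τ : ℂ) ^ (-(2 * j : ℤ))) *
    psiPoly ((x.1 : ℕ) / 2) ((x.2 : ℕ) / 2) j with hp
  have hpe : ∀ τ, evalInvIm p τ =
      ((η (τ : ℂ) ^ 2) ^ j)⁻¹ * PowerSeries.coeff j (psiHalf x τ) := fun τ => by
    rw [hp, map_mul, evalInvIm_C, Pi.mul_apply, evalInvIm_psiPoly, eta_zpow_neg_two_mul]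
    rfl
  have hmem : p ∈ weightZeroPoly level := by
    rw [mem_weightZeroPoly]
    refine ⟨mul_mem (C_mem_almostHoloPoly (eta_zpow_mem _)) ?_, fun γ hγ τ => ?_, fun γ => ?_⟩
    · have := psiPoly_mem (x.1 : ℕ) (x.2 : ℕ) j
      rwa [Int.cast_natCast, Int.cast_natCast] at this
    · have h0 := cd_ne_zero γ τ
      have h1 := eta_ne_zero τ
      rw [hpe, hpe, coeff_smul_of_mem_fixer (hx hγ), eta_sq_smul hγ.2.2.1, mul_pow]
      field_simp
    · obtain ⟨ε, hε, h⟩ := exists_eta_sq_smul γ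
      obtain ⟨ζ, -, y, hy⟩ := slashPS_psiHalf_mem γ x
      have key : (fun τ => evalInvIm p (γ • τ)) = (ζ * (ε ^ j)⁻¹) •
          ((fun τ : ℍ => η (τ : ℂ) ^ (-(2 * j : ℤ))) *
            fun τ => PowerSeries.coeff j (psiHalf y τ)) := by
        ext τ
        have h0 := cd_ne_zero γ τ
        have h1 := eta_ne_zero τ
        have h2 := congrArg (PowerSeries.coeff j) (congrFun hy τ)
        rw [slashPS, PowerSeries.coeff_rescale, Pi.smul_apply, PowerSeries.coeff_smul, smul_eq_mul]
          at h2
        rw [hpe, h, Pi.smul_apply, Pi.mul_apply, eta_zpow_neg_two_mul, smul_eq_mul]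
        calc _ = (ε ^ j)⁻¹ * ((η (τ : ℂ) ^ 2) ^ j)⁻¹ *
              ((cd γ τ)⁻¹ ^ j * PowerSeries.coeff j (psiHalf x (γ • τ))) := by
              rw [mul_pow, mul_pow, inv_pow]
              field_simp
          _ = _ := by rw [h2]; ring
      rw [key]
      exact almostHoloFun.smul_mem
        (mul_mem (periodicHolo_le_almostHoloFun (eta_zpow_mem _)) (coeff_psiHalf_mem y j)) _
  rw [mem_quasi]
  have h1 : p.coeff 0 ∈ weightZeroQuasi level := mem_weightZeroQuasi.2 ⟨p, hmem, rfl⟩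
  have h2 := (weightZeroQuasi level).smul_mem h1 ((2 * Real.pi * I) ^ j / (j.factorial : ℂ))⁻¹
  convert h2 using 1
  rw [hp, Polynomial.coeff_C_mul, psiPoly_coeff_zero]
  ext τ
  simp only [Pi.mul_apply, Pi.smul_apply, smul_eq_mul]
  rw [neg_add, zpow_add₀ (eta_ne_zero τ), zpow_neg_one]
  generalize (2 * Real.pi * I) ^ j / (j.factorial : ℂ) = c at hc ⊢
  field_simp

/-! ### Comparison with the automorphy factors -/

theorem continuous_eta : Continuous fun τ : ℍ => η (τ : ℂ) :=
  continuous_iff_continuousAt.2 fun τ =>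
    (ModularForm.differentiableAt_eta_of_mem_upperHalfPlaneSet τ.2).continuousAt.comp
      UpperHalfPlane.continuous_coe.continuousAt

theorem continuous_cd_cpow (γ : SL(2, ℤ)) (s : ℂ) : Continuous fun τ : ℍ => cd γ τ ^ s := by
  by_cases hc : γ 1 0 = 0
  · simp only [cd, hc]
    simpa using continuous_const
  · rw [continuous_iff_continuousAt]
    intro τ
    have hmem : cd γ τ ∈ Complex.slitPlane := by
      refine Complex.mem_slitPlane_iff.2 (Or.inr ?_)
      have : (cd γ τ).im = γ 1 0 * τ.im := by simp [cd]
      rw [this]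
      exact mul_ne_zero (by exact_mod_cast hc) τ.im_pos.ne'
    have h1 : Continuous fun τ : ℍ => cd γ τ := by
      unfold cd
      exact (continuous_const.mul UpperHalfPlane.continuous_coe).add continuous_const
    exact (continuousAt_cpow_const hmem).comp h1.continuousAt

theorem continuous_smul_SL2Z (γ : SL(2, ℤ)) : Continuous fun τ : ℍ => γ • τ := by
  simp only [ModularGroup.sl_moeb]
  exact continuous_const_smul _

/-- η(γτ) and ε^(1/2)(cτ+d)^(1/2)η(τ) have equal squares. Both are continuous and the second has no
zero on the connected upper half-plane, so they agree up to one global sign. -/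
theorem exists_cpow_mul_eta_zpow (κ : ℤ) (γ : SL(2, ℤ)) : ∃ c : ℂ, ∀ τ : ℍ,
    cd γ τ ^ (-(κ : ℂ) / 2) * η ((γ • τ : ℍ) : ℂ) ^ κ = c * η (τ : ℂ) ^ κ := by
  obtain ⟨ε, hε, h⟩ := exists_eta_sq_smul γ
  have hs : ∃ s : ℂ, s ≠ 0 ∧ ∀ τ : ℍ,
      η ((γ • τ : ℍ) : ℂ) = s * (cd γ τ ^ (1 / 2 : ℂ) * η (τ : ℂ)) := by
    have hs0 : ε ^ (1 / 2 : ℂ) ≠ 0 := by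
      rw [Ne, Complex.cpow_eq_zero_iff]
      simp [hε]
    have hcd0 : ∀ τ, cd γ τ ^ (1 / 2 : ℂ) ≠ 0 := fun τ => by
      rw [Ne, Complex.cpow_eq_zero_iff]
      simp [cd_ne_zero γ τ]
    rcases IsPreconnected.eq_or_eq_neg_of_sq_eq (S := Set.univ)
      (f := fun τ : ℍ => η ((γ • τ : ℍ) : ℂ))
      (g := fun τ : ℍ => ε ^ (1 / 2 : ℂ) * (cd γ τ ^ (1 / 2 : ℂ) * η (τ : ℂ))) isPreconnected_univ
      (continuous_eta.comp (continuous_smul_SL2Z γ)).continuousOn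
      (continuous_const.mul ((continuous_cd_cpow γ _).mul continuous_eta)).continuousOn
      (fun τ _ => by
        simp only [Pi.pow_apply, mul_pow, sq_cpow_half]
        rw [h, mul_assoc])
      (fun {τ} _ => mul_ne_zero hs0 (mul_ne_zero (hcd0 τ) (eta_ne_zero τ))) with h' | h'
    · exact ⟨_, hs0, fun τ => h' (Set.mem_univ τ)⟩
    · refine ⟨-ε ^ (1 / 2 : ℂ), neg_ne_zero.2 hs0, fun τ => ?_⟩
      rw [neg_mul]
      exact h' (Set.mem_univ τ)
  obtain ⟨s, hs0, hs⟩ := hs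
  refine ⟨s ^ κ, fun τ => ?_⟩
  have hcd : cd γ τ ^ (1 / 2 : ℂ) ≠ 0 := by
    rw [Ne, Complex.cpow_eq_zero_iff]
    simp [cd_ne_zero γ τ]
  have e : cd γ τ ^ (-(κ : ℂ) / 2) = (cd γ τ ^ (1 / 2 : ℂ)) ^ (-κ) := by
    rw [← Complex.cpow_mul_int]
    congr 1
    push_cast
    ring
  rw [e, hs, mul_zpow, mul_zpow, zpow_neg]
  have := zpow_ne_zero κ hcd
  field_simp

/-- Multiply the weight zero form by η^κ. For even κ the factor comes from η²(γτ) = (cτ+d)η²(τ), for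
odd κ from the invariance of θ/η. -/
theorem isQuasimodular_of_mem_quasi (hθ : ∀ τ, theta τ ≠ 0) {κ : ℤ} {φ : ℍ → ℂ} (h : φ ∈ quasi κ) :
    IsQuasimodular level κ φ := by
  rw [mem_quasi, mem_weightZeroQuasi] at h
  obtain ⟨p, hp, hφ⟩ := h
  rw [mem_weightZeroPoly] at hp
  obtain ⟨hp1, hp2, hp3⟩ := hp
  set q := Polynomial.C (fun τ : ℍ => η (τ : ℂ) ^ κ) * p with hq
  have hqmem : q ∈ almostHoloPoly := mul_mem (C_mem_almostHoloPoly (eta_zpow_mem κ)) hp1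
  have hqe : ∀ τ, evalInvIm q τ = η (τ : ℂ) ^ κ * evalInvIm p τ := fun τ => by
    rw [hq, map_mul, evalInvIm_C, Pi.mul_apply]
  refine ⟨q.natDegree, q.coeff, fun m => IsPeriodicHolo.hasFourierExpansion (hqmem m), ?_, ?_⟩
  · rw [hq, Polynomial.coeff_C_mul, hφ]
    ext τ
    simp only [Pi.mul_apply]
    rw [mul_left_comm, ← zpow_add₀ (eta_ne_zero τ), add_neg_cancel, zpow_zero, mul_one]
  rw [← evalInvIm_apply]
  refine ⟨fun γ hγ τ => ?_, fun γ => ?_⟩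
  · rw [hqe, hqe, hp2 γ hγ, ← mul_assoc]
    congr 1
    have h0 := eta_ne_zero τ
    rw [automorphy]
    split_ifs with hκ
    · obtain ⟨m, rfl⟩ := hκ
      rw [← two_mul, Int.mul_ediv_cancel_left _ two_ne_zero, zpow_mul, zpow_mul]
      have h1 := eta_sq_smul hγ.2.2.1 τ
      rw [← zpow_natCast, ← zpow_natCast] at h1
      rw [show (2 : ℤ) = ((2 : ℕ) : ℤ) from rfl, h1, mul_zpow]
    · have h1 := theta_div_eta_smul hγ τ
      rw [← mul_zpow]
      congr 1
      have h2 := hθ τ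
      have h3 := eta_ne_zero (γ • τ)
      field_simp at h1 ⊢
      linear_combination -h1
  · apply isAlmostHolomorphic_of_mem
    obtain ⟨c, hc⟩ := exists_cpow_mul_eta_zpow κ γ
    have e : slash κ γ (evalInvIm q) =
        c • ((fun τ : ℍ => η (τ : ℂ) ^ κ) * fun τ => evalInvIm p (γ • τ)) := by
      ext τ
      rw [slash, hqe, ← mul_assoc, hc, Pi.smul_apply, Pi.mul_apply, smul_eq_mul, mul_assoc]
    rw [e]
    exact almostHoloFun.smul_mem
      (mul_mem (periodicHolo_le_almostHoloFun (eta_zpow_mem κ)) (hp3 γ)) c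

end InfiniteWedge

end

noncomputable section

namespace InfiniteWedge

open UpperHalfPlane hiding I
open Complex Function
open scoped ModularForm

/-! ### The odd theta constant is a multiple of `η³` -/

/-- The quotient of the derivative of the odd theta function by `η³`. -/
def oddRatio (τ : ℍ) : ℂ := thetaCoeff (1 / 2) (1 / 2) 1 τ / η (τ : ℂ) ^ 3

theorem coeff_one_psi (a b : ℝ) (τ : ℍ) :
    PowerSeries.coeff 1 (psi a b τ) = 2 * Real.pi * I * thetaCoeff a b 1 τ / η (τ : ℂ) := by
  have h : Finset.HasAntidiagonal.antidiagonal 1 = {((0 : ℕ), 1), (1, 0)} := rfl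
  rw [psi, PowerSeries.coeff_smul, PowerSeries.coeff_mul, h, Finset.sum_pair (by simp)]
  simp [gaussPS, thetaPS]
  ring

theorem oddRatio_eq (τ : ℍ) : oddRatio τ =
    (2 * Real.pi * I)⁻¹ * (PowerSeries.coeff 1 (psi (1 / 2) (1 / 2) τ) / η (τ : ℂ) ^ 2) := by
  have h := eta_ne_zero τ
  have := Complex.two_pi_I_ne_zero
  rw [coeff_one_psi, oddRatio]
  field_simp

theorem exp_half_char : cexp (2 * Real.pi * I * ((1 / 2 : ℝ) : ℂ)) = -1 := by
  rw [← Complex.exp_pi_mul_I]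
  congr 1
  push_cast
  ring

/-- Inversion gives i·psi(1/2, -1/2), and moving b back to 1/2 gives -i, the same multiplier as that
of η². -/
theorem oddRatio_S (τ : ℍ) : oddRatio (ModularGroup.S • τ) = oddRatio τ := by
  have h := eta_ne_zero τ
  have h0 := τ.ne_zero
  have h1 := slashPS_S_psi (1 / 2) (1 / 2)
  have h2 := psi_add_one_right (1 / 2) (-(1 / 2))
  rw [show (-(1 / 2) + 1 : ℝ) = 1 / 2 by norm_num, exp_half_char] at h2
  have h3 := congrArg (PowerSeries.coeff 1) (congrFun h1 τ)
  have h4 := congrArg (PowerSeries.coeff 1) (congrFun h2 τ)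
  have hI : cexp (2 * Real.pi * I * ((1 / 2 : ℝ) : ℂ) * ((1 / 2 : ℝ) : ℂ)) = I := by
    conv_rhs => rw [← Complex.exp_pi_div_two_mul_I]
    congr 1
    push_cast
    ring
  rw [slashPS, PowerSeries.coeff_rescale, Pi.smul_apply, PowerSeries.coeff_smul, cd_S, pow_one, hI,
    smul_eq_mul] at h3
  rw [Pi.smul_apply, PowerSeries.coeff_smul, smul_eq_mul] at h4
  rw [oddRatio_eq, oddRatio_eq, coe_S_smul, eta_S, mul_pow, sq_cpow_half, h4]
  have h5 : PowerSeries.coeff 1 (psi (1 / 2) (1 / 2) (ModularGroup.S • τ)) =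
      τ * I * PowerSeries.coeff 1 (psi (1 / 2) (-(1 / 2)) τ) := by
    rw [mul_assoc, ← h3, mul_inv_cancel_left₀ h0]
  rw [h5]
  congr 1
  have := Complex.I_ne_zero
  field_simp

theorem oddRatio_T (τ : ℍ) : oddRatio (ModularGroup.T • τ) = oddRatio τ := by
  have h := eta_ne_zero τ
  have h1 := slashPS_T_psi (1 / 2) (1 / 2)
  have h2 := psi_add_one_right (1 / 2) (1 / 2)
  rw [show (1 / 2 + 1 / 2 + 1 / 2 : ℝ) = 1 / 2 + 1 by norm_num, h2, exp_half_char, smul_smul] at h1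
  have h3 := congrArg (PowerSeries.coeff 1) (congrFun h1 τ)
  rw [slashPS, PowerSeries.coeff_rescale, Pi.smul_apply, PowerSeries.coeff_smul, cd_T, inv_one,
    one_pow, one_mul, smul_eq_mul] at h3
  have hc : cexp (-(Real.pi * I * (((1 / 2 : ℝ) : ℂ) ^ 2 + ((1 / 2 : ℝ) : ℂ)))) *
      cexp (-(Real.pi * I / 12)) * -1 = cexp (Real.pi * I / 12) ^ 2 := by
    rw [← Complex.exp_pi_mul_I, ← Complex.exp_add, ← Complex.exp_add, ← Complex.exp_nat_mul]
    congr 1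
    push_cast
    ring
  rw [oddRatio_eq, oddRatio_eq, coe_T_smul, eta_T, mul_pow, h3, hc]
  have := Complex.exp_ne_zero (Real.pi * I / 12)
  field_simp

theorem oddRatio_mem : oddRatio ∈ periodicHolo := by
  have h := mul_mem (thetaCoeff_mem 1 1 1) (eta_zpow_mem (-3))
  convert h using 1
  ext τ
  rw [oddRatio, Pi.mul_apply, Int.cast_one, div_eq_mul_inv, zpow_neg]
  norm_cast

/-- Since (n + 1/2)² ≥ 1/4, the numerator is O(e^(-πy/4)), exactly the order of η³. -/
theorem oddRatio_bounded : IsBoundedAtImInfty oddRatio := by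
  rw [isBoundedAtImInfty_iff]
  obtain ⟨C, hC⟩ := norm_thetaCoeff_le (1 / 2) (1 / 2) 1 (m := 1 / 4) fun n => by
    have : (0 : ℝ) ≤ (n : ℝ) ^ 2 + n := by
      have : (0 : ℤ) ≤ n ^ 2 + n := by nlinarith [Int.even_mul_succ_self n, sq_nonneg (2 * n + 1)]
      exact_mod_cast this
    nlinarith
  obtain ⟨C', hC'⟩ := exists_bound_tprod
  refine ⟨C * C' ^ 3, 1, fun τ hτ => ?_⟩
  have h1 := hC τ hτ
  have h2 := (hC' τ hτ).2
  have hnorm : ‖(η (τ : ℂ) ^ 3)⁻¹‖ ≤ Real.exp (Real.pi * (1 / 4) * τ.im) * C' ^ 3 := by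
    rw [ModularForm.eta, mul_pow, mul_inv, norm_mul, ← inv_pow, ← inv_pow, norm_pow, norm_pow,
      norm_inv, Periodic.norm_qParam, ← Real.exp_neg, ← Real.exp_nat_mul]
    have e : ((3 : ℕ) : ℝ) * -(-2 * Real.pi * (τ : ℂ).im / 24) = Real.pi * (1 / 4) * τ.im := by
      rw [UpperHalfPlane.coe_im]; push_cast; ring
    rw [e]
    gcongr
  rw [oddRatio, div_eq_mul_inv, norm_mul]
  calc _ ≤ (C * Real.exp (-Real.pi * (1 / 4) * (τ : ℂ).im)) *
        (Real.exp (Real.pi * (1 / 4) * τ.im) * C' ^ 3) :=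
        mul_le_mul h1 hnorm (norm_nonneg _) ((norm_nonneg _).trans h1)
    _ = C * C' ^ 3 * (Real.exp (-Real.pi * (1 / 4) * τ.im) *
        Real.exp (Real.pi * (1 / 4) * τ.im)) := by rw [UpperHalfPlane.coe_im]; ring
    _ = _ := by rw [← Real.exp_add]; ring_nf; simp

/-- `oddRatio` as a modular form of weight zero. -/
def oddRatioForm : ModularForm 𝒮ℒ 0 :=
  have hS : oddRatio ∣[(0 : ℤ)] ModularGroup.S = oddRatio := by
    ext τ
    rw [ModularForm.SL_slash_apply, oddRatio_S]
    simp
  have hT : oddRatio ∣[(0 : ℤ)] ModularGroup.T = oddRatio := by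
    ext τ
    rw [ModularForm.SL_slash_apply, oddRatio_T]
    simp
  { toFun := oddRatio
    slash_action_eq' := fun A hA => by
      obtain ⟨A, rfl⟩ := hA
      exact SlashInvariantForm.slash_action_generators_SL2Z hS hT A
    holo' := UpperHalfPlane.mdifferentiable_iff.2 oddRatio_mem.holo
    bdd_at_cusps' := fun hc => by
      rw [OnePoint.isBoundedAt_iff_forall_SL2Z hc]
      intro γ _
      rw [SlashInvariantForm.slash_action_generators_SL2Z hS hT]
      exact oddRatio_bounded }

/-- Jacobi's derivative formula up to its constant: the quotient by η³ is a modular form of level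
one and weight zero, hence constant. -/
theorem exists_thetaCoeff_eq : ∃ c : ℂ, ∀ τ : ℍ,
    thetaCoeff (1 / 2) (1 / 2) 1 τ = c * η (τ : ℂ) ^ 3 := by
  obtain ⟨c, hc⟩ := ModularFormClass.levelOne_weight_zero_const oddRatioForm
  refine ⟨c, fun τ => ?_⟩
  have h : oddRatio τ = c := congrFun hc τ
  rw [← h, oddRatio, div_mul_cancel₀ _ (pow_ne_zero _ (eta_ne_zero τ))]

end InfiniteWedge

end

noncomputable section

namespace InfiniteWedge

open Function

/-! ### Regularized power sums -/

/-- The regularized value `B_{r+1}(x) / (r+1)` of `-∑_{n ≥ 0} (n + x)^r`. -/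
def bern (r : ℕ) (x : ℂ) : ℂ :=
  ((Polynomial.bernoulli (r + 1)).map (algebraMap ℚ ℂ)).eval x / (r + 1)

theorem bern_add_one (r : ℕ) (x : ℂ) : bern r (x + 1) = bern r x + x ^ r := by
  have h := congrArg (fun p => (p.map (algebraMap ℚ ℂ)).eval x)
    (Polynomial.bernoulli_comp_one_add_X (r + 1))
  have hr : (r : ℂ) + 1 ≠ 0 := by exact_mod_cast r.succ_ne_zero
  simp only [Polynomial.map_comp, Polynomial.eval_comp, Polynomial.map_add, Polynomial.map_one,
    Polynomial.map_X, Polynomial.eval_add, Polynomial.eval_one, Polynomial.eval_X] at h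
  rw [bern, bern, add_comm x 1, h]
  simp
  field_simp

theorem iterate_derivative_bernoulli (n k : ℕ) (h : k ≤ n) :
    Polynomial.derivative^[k] (Polynomial.bernoulli n) =
      (n.descFactorial k : ℚ) • Polynomial.bernoulli (n - k) := by
  induction k with
  | zero => simp
  | succ k ih =>
    rw [Function.iterate_succ_apply', ih (by omega), Polynomial.derivative_smul,
      Polynomial.derivative_bernoulli, Nat.descFactorial_succ]
    rw [show n - k - 1 = n - (k + 1) by omega, ← nsmul_eq_mul, ← Nat.cast_smul_eq_nsmul ℚ,
      smul_smul]
    push_cast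
    rw [mul_comm]

theorem bernoulli_eval_add (n : ℕ) (x y : ℂ) :
    ((Polynomial.bernoulli n).map (algebraMap ℚ ℂ)).eval (y + x) =
      ∑ k ∈ Finset.range (n + 1),
        (n.choose k : ℂ) * ((Polynomial.bernoulli (n - k)).map (algebraMap ℚ ℂ)).eval x * y ^ k := by
  set B := (Polynomial.bernoulli n).map (algebraMap ℚ ℂ) with hB
  have hdeg : B.natDegree < n + 1 := by
    refine Nat.lt_succ_of_le ((Polynomial.natDegree_map_le).trans ?_)
    rw [Polynomial.bernoulli_def]
    refine Polynomial.natDegree_sum_le_of_forall_le _ _ fun i _ =>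
      (Polynomial.natDegree_monomial_le _).trans (Nat.lt_succ_iff.1 (Finset.mem_range.1 ‹_›))
  rw [← Polynomial.taylor_eval, Polynomial.eval_eq_sum_range' (n := n + 1)
    (by rwa [Polynomial.natDegree_taylor])]
  refine Finset.sum_congr rfl fun k hk => ?_
  have hk' : k ≤ n := Nat.lt_succ_iff.1 (Finset.mem_range.1 hk)
  rw [Polynomial.taylor_coeff]
  congr 1
  have h1 := congrArg (Polynomial.eval x)
    (congrFun (Polynomial.factorial_smul_hasseDeriv (R := ℂ) k) B)
  have h2 : (k.factorial • Polynomial.hasseDeriv (R := ℂ) k) B =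
      (k.factorial : ℂ) • Polynomial.hasseDeriv k B := by
    rw [LinearMap.smul_apply, Nat.cast_smul_eq_nsmul]
  rw [h2, hB, Polynomial.iterate_derivative_map, iterate_derivative_bernoulli n k hk'] at h1
  simp only [Polynomial.map_smul, Polynomial.eval_smul, smul_eq_mul, map_natCast] at h1
  have hf : (k.factorial : ℂ) ≠ 0 := by exact_mod_cast k.factorial_ne_zero
  refine mul_left_cancel₀ hf ?_
  rw [Nat.descFactorial_eq_factorial_mul_choose] at h1
  push_cast at h1
  rw [← mul_assoc, ← h1]

/-- The Appell property of Bernoulli polynomials; the last summand comes from B_0 = 1 and is the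
anomaly of the regularization. -/
theorem bern_add (r : ℕ) (x b : ℂ) : bern r (x + b) =
    (∑ i ∈ Finset.range (r + 1), (r.choose i : ℂ) * bern i x * b ^ (r - i)) +
      b ^ (r + 1) / (r + 1) := by
  have hr : (r : ℂ) + 1 ≠ 0 := by exact_mod_cast r.succ_ne_zero
  rw [bern, add_comm x b, bernoulli_eval_add, Finset.sum_range_succ, add_div]
  congr 1
  · rw [Finset.sum_div, ← Finset.sum_range_reflect]
    refine Finset.sum_congr rfl fun i hi => ?_
    have hi' : i ≤ r := Nat.lt_succ_iff.1 (Finset.mem_range.1 hi)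
    have hi0 : (i : ℂ) + 1 ≠ 0 := by exact_mod_cast i.succ_ne_zero
    rw [show r + 1 - 1 - i = r - i by omega, show r + 1 - (r - i) = i + 1 by omega, bern]
    have hc : ((r + 1).choose (r - i) : ℂ) * (i + 1) = (r + 1) * r.choose i := by
      have h1 : (r + 1).choose (r - i) = (r + 1).choose (i + 1) := by
        rw [← Nat.choose_symm (by omega : i + 1 ≤ r + 1)]
        congr 1
        omega
      rw [h1]
      exact_mod_cast (Nat.add_one_mul_choose_eq r i).symm
    rw [div_eq_iff hr, (eq_div_iff hi0).2 hc]
    ring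
  · simp

/-- From B_{r+1}(1/2) = (2^(-r) - 1) B_{r+1} and the values of ζ at -r. The constant in D̃_r is
thereby the regularized sum over the vacuum positions. -/
theorem bern_half (r : ℕ) : bern r (1 / 2) = (-1 : ℂ) ^ r * xi (-(r : ℂ)) := by
  have hr : (r : ℂ) + 1 ≠ 0 := by exact_mod_cast r.succ_ne_zero
  have h := bernoulliFun_eval_half (r + 1)
  have h2 : ((Polynomial.bernoulli (r + 1)).map (algebraMap ℚ ℂ)).eval (1 / 2) =
      ((bernoulliFun (r + 1) 2⁻¹ : ℝ) : ℂ) := by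
    rw [bernoulliFun, Polynomial.eval_map, Polynomial.eval_map, ← Complex.ofRealHom_eq_coe,
      Polynomial.hom_eval₂]
    congr 1
    simp
  rw [bern, h2, h, xi, riemannZeta_neg_nat_eq_bernoulli]
  have h1 : ((-1 : ℂ) ^ r) * (-1) ^ r = 1 := by rw [← mul_pow]; simp
  have h3 : (2 : ℂ) ^ (-(r : ℂ)) = ((2 : ℂ) ^ r)⁻¹ := by
    rw [Complex.cpow_neg, Complex.cpow_natCast]
  rw [h3]
  push_cast
  rw [pow_succ]
  have h4 : (2 : ℂ) / (2 ^ r * 2) = (2 ^ r)⁻¹ := by field_simp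
  rw [h4]
  linear_combination -(((2 : ℂ) ^ r)⁻¹ - 1) * (bernoulli (r + 1) : ℂ) / (r + 1) * h1

theorem bern_one_one : bern 1 1 = 1 / 12 := by
  rw [bern, Polynomial.eval_one_map, Polynomial.bernoulli_eval_one, bernoulli'_two]
  norm_num

end InfiniteWedge

end

noncomputable section

namespace InfiniteWedge

open Function

/-! ### Occupation numbers -/

open Classical in
/-- The occupation number of the position `m`, relative to the vacuum. -/
def occ (S : Maya) (m : ℤ) : ℤ := (if m ∈ S.1 then 1 else 0) - (if m ≤ 0 then 1 else 0)

/-- The finite set of positions at which `S` differs from the vacuum. -/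
def Maya.diff (S : Maya) : Finset ℤ := S.2.1.toFinset ∪ S.2.2.toFinset

theorem mem_diff {S : Maya} {m : ℤ} : m ∈ S.diff ↔ (m ∈ S.1 ∧ 0 < m) ∨ (m ≤ 0 ∧ m ∉ S.1) := by
  simp [Maya.diff]

theorem occ_of_mem_diff {S : Maya} {m : ℤ} (h : m ∈ S.diff) : occ S m = if m ≤ 0 then -1 else 1 := by
  rcases mem_diff.1 h with ⟨h1, h2⟩ | ⟨h1, h2⟩
  · simp [occ, h1, not_le.2 h2]
  · simp [occ, h1, h2]

theorem occ_of_notMem_diff {S : Maya} {m : ℤ} (h : m ∉ S.diff) : occ S m = 0 := by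
  rw [mem_diff, not_or] at h
  by_cases h1 : m ∈ S.1
  · have : m ≤ 0 := not_lt.1 fun h2 => h.1 ⟨h1, h2⟩
    simp [occ, h1, this]
  · have : ¬ m ≤ 0 := fun h2 => h.2 ⟨h2, h1⟩
    simp [occ, h1, this]

/-- The sum of `g` over the positions of `S`, relative to the vacuum. -/
def relSum (S : Maya) (g : ℤ → ℂ) : ℂ := ∑ᶠ m, (occ S m : ℂ) * g m

theorem relSum_eq_sum (S : Maya) (g : ℤ → ℂ) : relSum S g = ∑ m ∈ S.diff, (occ S m : ℂ) * g m := by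
  refine finsum_eq_sum_of_support_subset _ fun m hm => ?_
  by_contra h
  exact hm (by simp [occ_of_notMem_diff h])

theorem finite_support_occ_mul (S : Maya) (g : ℤ → ℂ) :
    (support fun m => (occ S m : ℂ) * g m).Finite :=
  S.diff.finite_toSet.subset fun m hm => by
    by_contra h
    exact hm (by simp [occ_of_notMem_diff h])

theorem relSum_eq (S : Maya) (g : ℤ → ℂ) :
    relSum S g = ∑ m ∈ S.2.1.toFinset, g m - ∑ m ∈ S.2.2.toFinset, g m := by
  have hd : Disjoint S.2.1.toFinset S.2.2.toFinset := by
    rw [Finset.disjoint_left]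
    intro m h1 h2
    simp only [Set.Finite.mem_toFinset] at h1 h2
    exact h2.2 h1.1
  rw [relSum_eq_sum, Maya.diff, Finset.sum_union hd, sub_eq_add_neg, ← Finset.sum_neg_distrib]
  congr 1 <;> refine Finset.sum_congr rfl fun m hm => ?_ <;> rw [Set.Finite.mem_toFinset] at hm
  · have h1 : m ∈ S.1 := hm.1
    have h2 : ¬ m ≤ 0 := not_le.2 hm.2
    simp [occ, h1, h2]
  · have h1 : m ≤ 0 := hm.1
    have h2 : m ∉ S.1 := hm.2
    simp [occ, h1, h2]

/-- The charge of an index set. -/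
def Maya.charge (S : Maya) : ℤ := ∑ m ∈ S.diff, occ S m

theorem relSum_one (S : Maya) : relSum S (fun _ => 1) = S.charge := by
  rw [relSum_eq_sum, Maya.charge]
  push_cast
  simp

/-- The regularized power sum `∑_{m ∈ S} (m - 1/2 + a)^r`. -/
def powSum (r : ℕ) (a : ℂ) (S : Maya) : ℂ :=
  relSum S (fun m => ((m : ℂ) - 1 / 2 + a) ^ r) + bern r (1 / 2 + a)

theorem powSum_zero_right (r : ℕ) (S : Maya) : powSum r 0 S = eig r S := by
  rw [powSum, eig_eq, relSum_eq, add_zero, bern_half]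
  simp

theorem powSum_add (r : ℕ) (b : ℂ) (S : Maya) : powSum r b S =
    (∑ i ∈ Finset.range (r + 1), (r.choose i : ℂ) * eig i S * b ^ (r - i)) + b ^ (r + 1) / (r + 1) := by
  rw [powSum, bern_add, ← add_assoc]
  congr 1
  simp_rw [← powSum_zero_right, powSum, add_zero]
  simp_rw [mul_add, add_mul]
  rw [Finset.sum_add_distrib]
  congr 1
  simp_rw [relSum_eq_sum, Finset.mul_sum, Finset.sum_mul]
  rw [Finset.sum_comm]
  refine Finset.sum_congr rfl fun m _ => ?_
  rw [add_pow, Finset.mul_sum]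
  refine Finset.sum_congr rfl fun i _ => ?_
  ring

theorem eig_zero_eq_charge (S : Maya) : eig 0 S = S.charge := by
  rw [← powSum_zero_right, powSum, add_zero, bern_half, ← relSum_one]
  simp [xi]

theorem powSum_zero_left (b : ℂ) (S : Maya) : powSum 0 b S = S.charge + b := by
  rw [powSum_add, ← eig_zero_eq_charge]
  simp

/-- At charge zero a translation by b adds b²/2, which is the exponent of a theta series. -/
theorem powSum_one_left (b : ℂ) (S : Maya) :
    powSum 1 b S = eig 1 S + S.charge * b + b ^ 2 / 2 := by
  rw [powSum_add, ← eig_zero_eq_charge]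
  simp [Finset.sum_range_succ]
  ring

/-! ### Translation -/

/-- Translation of index sets by one. -/
def Maya.shift : Equiv.Perm Maya where
  toFun S := ⟨{m | m - 1 ∈ S.1}, by
    constructor
    · refine ((S.2.1.image (· + 1)).insert 1).subset ?_
      rintro m ⟨h1, h2⟩
      rcases eq_or_ne m 1 with rfl | h
      · exact Set.mem_insert _ _
      · have h2' : 0 < m := h2
        exact Set.mem_insert_of_mem _ ⟨m - 1, ⟨h1, show 0 < m - 1 by omega⟩, by simp⟩
    · refine (S.2.2.image (· + 1)).subset ?_
      rintro m ⟨h1, h2⟩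
      have h1' : m ≤ 0 := h1
      exact ⟨m - 1, ⟨show m - 1 ≤ 0 by omega, h2⟩, by simp⟩⟩
  invFun S := ⟨{m | m + 1 ∈ S.1}, by
    constructor
    · refine (S.2.1.image (· - 1)).subset ?_
      rintro m ⟨h1, h2⟩
      have h2' : 0 < m := h2
      exact ⟨m + 1, ⟨h1, show 0 < m + 1 by omega⟩, by simp⟩
    · refine ((S.2.2.image (· - 1)).insert 0).subset ?_
      rintro m ⟨h1, h2⟩
      rcases eq_or_ne m 0 with rfl | h
      · exact Set.mem_insert _ _
      · have h1' : m ≤ 0 := h1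
        exact Set.mem_insert_of_mem _ ⟨m + 1, ⟨show m + 1 ≤ 0 by omega, h2⟩, by simp⟩⟩
  left_inv S := Subtype.ext (by ext m; simp)
  right_inv S := Subtype.ext (by ext m; simp)

theorem occ_shift (S : Maya) (m : ℤ) :
    occ (Maya.shift S) (m + 1) = occ S m + if m = 0 then 1 else 0 := by
  have h : m + 1 ∈ (Maya.shift S).1 ↔ m ∈ S.1 := by simp [Maya.shift]
  by_cases hm : m ∈ S.1 <;> simp only [occ, h, hm] <;> split_ifs <;> omega

theorem relSum_shift (S : Maya) (g : ℤ → ℂ) :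
    relSum (Maya.shift S) g = relSum S (fun m => g (m + 1)) + g 1 := by
  have h1 : relSum (Maya.shift S) g =
      ∑ᶠ m, ((occ S m : ℂ) * g (m + 1) + if m = 0 then g 1 else 0) := by
    rw [relSum, ← finsum_comp_equiv (Equiv.addRight (1 : ℤ))]
    refine finsum_congr fun m => ?_
    rw [Equiv.coe_addRight, occ_shift]
    split_ifs with h
    · subst h; push_cast; ring_nf
    · simp
  rw [h1, finsum_add_distrib (finite_support_occ_mul S _)
    ((Set.finite_singleton (0 : ℤ)).subset fun m hm => by
      by_contra h
      exact hm (by simp [show m ≠ 0 from h]))]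
  congr 1
  rw [finsum_eq_single _ 0 fun m hm => if_neg hm, if_pos rfl]

/-- The boundary term (1/2 + a)^r created by the shift is exactly the difference of the Bernoulli
terms, so regularized sums are translation covariant. -/
theorem powSum_shift (r : ℕ) (a : ℂ) (S : Maya) :
    powSum r a (Maya.shift S) = powSum r (a + 1) S := by
  rw [powSum, powSum, relSum_shift, ← add_assoc (1 / 2 : ℂ), bern_add_one, add_assoc]
  congr 1
  · congr 1
    ext m
    push_cast
    ring
  · push_cast
    ring

theorem powSum_shift_zpow (r : ℕ) (a : ℂ) (S : Maya) (n : ℤ) :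
    powSum r a ((Maya.shift ^ n) S) = powSum r (a + n) S := by
  induction n generalizing a with
  | zero => simp
  | succ n ih =>
    rw [add_comm (n : ℤ) 1, zpow_one_add, Equiv.Perm.mul_apply, powSum_shift, ih]
    push_cast
    ring_nf
  | pred n ih =>
    have h : (Maya.shift ^ (-(n : ℤ))) S = Maya.shift ((Maya.shift ^ (-(n : ℤ) - 1)) S) := by
      rw [← Equiv.Perm.mul_apply, ← zpow_one_add]
      congr 2
      ring
    have := ih (a - 1)
    rw [h, powSum_shift, sub_add_cancel] at this
    rw [this]
    push_cast
    ring_nf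

theorem charge_shift_zpow (S : Maya) (n : ℤ) : ((Maya.shift ^ n) S).charge = S.charge + n := by
  have := powSum_shift_zpow 0 0 S n
  rw [powSum_zero_left, powSum_zero_left] at this
  have h : (((Maya.shift ^ n) S).charge : ℂ) = ((S.charge + n : ℤ) : ℂ) := by
    push_cast
    linear_combination this
  exact_mod_cast h

/-- Index sets of charge zero. -/
abbrev Maya₀ : Type := {S : Maya // eig 0 S = 0}

theorem Maya₀.charge_eq (S : Maya₀) : S.1.charge = 0 := by
  have := S.2
  rw [eig_zero_eq_charge] at this
  exact_mod_cast this

/-- Every index set is uniquely a translate of one of charge zero. -/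
def chargeEquiv : ℤ × Maya₀ ≃ Maya where
  toFun x := (Maya.shift ^ x.1) x.2.1
  invFun S := (S.charge, ⟨(Maya.shift ^ (-S.charge)) S, by
    rw [eig_zero_eq_charge, charge_shift_zpow]
    simp⟩)
  left_inv := by
    rintro ⟨n, S⟩
    have h : ((Maya.shift ^ n) S.1).charge = n := by rw [charge_shift_zpow, S.charge_eq, zero_add]
    ext1
    · exact h
    · apply Subtype.ext
      simp only [h]
      rw [← Equiv.Perm.mul_apply, ← zpow_add, neg_add_cancel, zpow_zero, Equiv.Perm.one_apply]
  right_inv S := by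
    simp only
    rw [← Equiv.Perm.mul_apply, ← zpow_add, add_neg_cancel, zpow_zero, Equiv.Perm.one_apply]

/-! ### Adding or removing the position zero -/

/-- Adding or removing the position zero. -/
def Maya.toggle : Equiv.Perm Maya := Involutive.toPerm
  (fun S => ⟨symmDiff S.1 {0}, by
    constructor
    · refine S.2.1.subset ?_
      rintro m ⟨h1, h2⟩
      have h2' : 0 < m := h2
      rcases h1 with h1 | h1
      · exact ⟨h1.1, h2⟩
      · exact absurd h1.1 (by simpa using h2'.ne')
    · refine (S.2.2.insert 0).subset ?_
      rintro m ⟨h1, h2⟩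
      rcases eq_or_ne m 0 with rfl | h
      · exact Set.mem_insert _ _
      · refine Set.mem_insert_of_mem _ ⟨h1, fun h3 => h2 (Or.inl ⟨h3, by simpa using h⟩)⟩⟩)
  fun S => Subtype.ext (symmDiff_symmDiff_cancel_right _ _)

theorem occ_toggle (S : Maya) (m : ℤ) :
    occ (Maya.toggle S) m = occ S m + if m = 0 then -1 - 2 * occ S 0 else 0 := by
  have h : m ∈ (Maya.toggle S).1 ↔ (m ∈ S.1 ∧ m ≠ 0) ∨ (m = 0 ∧ m ∉ S.1) := by
    simp [Maya.toggle, Involutive.toPerm, Set.mem_symmDiff]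
  by_cases hm : m = 0
  · subst hm
    by_cases h0 : (0 : ℤ) ∈ S.1 <;> simp [occ, h, h0]
  · by_cases h0 : m ∈ S.1 <;> simp [occ, h, hm, h0]

theorem relSum_toggle (S : Maya) (g : ℤ → ℂ) :
    relSum (Maya.toggle S) g = relSum S g + (-1 - 2 * occ S 0) * g 0 := by
  have h1 : relSum (Maya.toggle S) g =
      ∑ᶠ m, ((occ S m : ℂ) * g m + if m = 0 then (-1 - 2 * occ S 0) * g 0 else 0) := by
    refine finsum_congr fun m => ?_
    rw [occ_toggle]
    split_ifs with h
    · subst h; push_cast; ring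
    · simp
  rw [h1, finsum_add_distrib (finite_support_occ_mul S _)
    ((Set.finite_singleton (0 : ℤ)).subset fun m hm => by
      by_contra h
      exact hm (by simp [show m ≠ 0 from h]))]
  congr 1
  rw [finsum_eq_single _ 0 fun m hm => if_neg hm, if_pos rfl]

/-- At a = 1/2 the position zero contributes 0^r, which vanishes unless r = 0. -/
theorem powSum_toggle (r : ℕ) (hr : r ≠ 0) (S : Maya) :
    powSum r (1 / 2) (Maya.toggle S) = powSum r (1 / 2) S := by
  rw [powSum, powSum, relSum_toggle]
  simp [hr]

theorem charge_toggle (S : Maya) : (Maya.toggle S).charge = S.charge + (-1 - 2 * occ S 0) := by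
  have := relSum_toggle S fun _ => 1
  rw [relSum_one, relSum_one, mul_one] at this
  exact_mod_cast this

/-! ### Index sets as finite sets of positions -/

/-- Index sets correspond to finite sets of integers. -/
def diffEquiv : Maya ≃ Finset ℤ where
  toFun := Maya.diff
  invFun F := ⟨symmDiff (F : Set ℤ) (Set.Iic 0), by
    constructor
    · refine F.finite_toSet.subset ?_
      rintro m ⟨h1, h2⟩
      rcases h1 with h1 | h1
      · exact h1.1
      · exact absurd (show m ≤ 0 from h1.1) (not_le.2 (show 0 < m from h2))
    · refine F.finite_toSet.subset ?_
      rintro m ⟨h1, h2⟩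
      by_contra h
      exact h2 (Or.inr ⟨h1, h⟩)⟩
  left_inv S := Subtype.ext (by
    ext m
    simp only [Set.mem_symmDiff, Finset.mem_coe, mem_diff, Set.mem_Iic]
    by_cases h1 : m ∈ S.1 <;> by_cases h2 : m ≤ 0 <;> simp [h1, h2]
    all_goals omega)
  right_inv F := by
    ext m
    rw [mem_diff]
    simp only [Set.mem_symmDiff, Finset.mem_coe, Set.mem_Iic]
    by_cases h1 : m ∈ F <;> by_cases h2 : m ≤ 0 <;> simp [h1, h2]
    all_goals omega

theorem neg_one_zpow_charge (S : Maya) : (-1 : ℂ) ^ S.charge = ∏ _m ∈ S.diff, (-1 : ℂ) := by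
  have key : ∀ F : Finset ℤ, (-1 : ℂ) ^ (∑ m ∈ F, occ S m) = ∏ m ∈ F, (-1 : ℂ) ^ occ S m := by
    intro F
    induction F using Finset.cons_induction with
    | empty => simp
    | cons a s ha ih => rw [Finset.sum_cons, Finset.prod_cons, zpow_add₀ (by simp), ih]
  rw [Maya.charge, key]
  refine Finset.prod_congr rfl fun m hm => ?_
  rw [occ_of_mem_diff hm]
  split_ifs <;> simp

end InfiniteWedge

end

noncomputable section

namespace InfiniteWedge

open UpperHalfPlane hiding I
open Complex Function

/-! ### Absolute convergence -/

/-- The sum of the distances `|m - 1/2 + a|` of the excited positions from the Fermi level. -/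
def energy (a : ℝ) (S : Maya) : ℝ := ∑ m ∈ S.diff, |(m : ℝ) - 1 / 2 + a|

theorem energy_nonneg (a : ℝ) (S : Maya) : 0 ≤ energy a S :=
  Finset.sum_nonneg fun _ _ => abs_nonneg _

/-- For |a| ≤ 1/2 the sign of m - 1/2 + a agrees with the occupation number: nonnegative for
particles, nonpositive for holes. -/
theorem powSum_one_eq_energy {a : ℝ} (h1 : -(1 / 2) ≤ a) (h2 : a ≤ 1 / 2) (S : Maya) :
    powSum 1 a S = energy a S + bern 1 (1 / 2 + a) := by
  rw [powSum, relSum_eq_sum, energy]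
  congr 1
  push_cast
  refine Finset.sum_congr rfl fun m hm => ?_
  rw [occ_of_mem_diff hm]
  split_ifs with h
  · have h' : (m : ℝ) ≤ 0 := by exact_mod_cast h
    rw [abs_of_nonpos (by linarith)]
    push_cast
    ring
  · have h' : (1 : ℝ) ≤ m := by exact_mod_cast (not_le.1 h)
    rw [abs_of_nonneg (by linarith)]
    push_cast
    ring

theorem eig_one_eq_energy (S : Maya) : eig 1 S = energy 0 S + bern 1 (1 / 2) := by
  have := powSum_one_eq_energy (a := 0) (by norm_num) (by norm_num) S
  rwa [ofReal_zero, powSum_zero_right, add_zero] at this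

/-- Each excited position has distance from the Fermi level between 1/2 and the total energy. The
lower bound trades the number of positions for a factor 2 and one more power of the energy. -/
theorem norm_eig_le (r : ℕ) (S : Maya) :
    ‖eig r S‖ ≤ 2 * energy 0 S ^ (r + 1) + ‖bern r (1 / 2)‖ := by
  rw [← powSum_zero_right, powSum, add_zero]
  refine (norm_add_le _ _).trans (add_le_add_left ?_ _)
  rw [relSum_eq_sum]
  refine (norm_sum_le _ _).trans ?_
  have hle : ∀ m ∈ S.diff, ‖(occ S m : ℂ) * ((m : ℂ) - 1 / 2 + 0) ^ r‖ ≤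
      2 * energy 0 S ^ r * |(m : ℝ) - 1 / 2 + 0| := by
    intro m hm
    have h1 : ‖(occ S m : ℂ)‖ = 1 := by
      rw [occ_of_mem_diff hm]
      split_ifs <;> simp
    have h2 : ‖(m : ℂ) - 1 / 2 + 0‖ = |(m : ℝ) - 1 / 2 + 0| := by
      rw [← Real.norm_eq_abs, ← Complex.norm_real]
      push_cast
      rfl
    have h3 : |(m : ℝ) - 1 / 2 + 0| ≤ energy 0 S :=
      Finset.single_le_sum (f := fun m : ℤ => |(m : ℝ) - 1 / 2 + 0|) (fun _ _ => abs_nonneg _) hm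
    have h4 : 1 ≤ 2 * |(m : ℝ) - 1 / 2 + 0| := by
      rcases le_or_gt m 0 with h | h
      · have h' : (m : ℝ) ≤ 0 := by exact_mod_cast h
        rw [abs_of_nonpos (by linarith)]
        linarith
      · have h' : (1 : ℝ) ≤ m := by exact_mod_cast h
        rw [abs_of_nonneg (by linarith)]
        linarith
    rw [norm_mul, norm_pow, h1, h2, one_mul]
    calc |(m : ℝ) - 1 / 2 + 0| ^ r ≤ energy 0 S ^ r * 1 := by
          rw [mul_one]
          exact pow_le_pow_left₀ (abs_nonneg _) h3 r
      _ ≤ energy 0 S ^ r * (2 * |(m : ℝ) - 1 / 2 + 0|) :=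
          mul_le_mul_of_nonneg_left h4 (pow_nonneg (energy_nonneg _ _) _)
      _ = _ := by ring
  refine (Finset.sum_le_sum hle).trans (le_of_eq ?_)
  rw [← Finset.mul_sum, ← energy]
  ring

/-- Polynomial growth in the energy is absorbed by an arbitrarily small exponential. All s > 0 are
treated together because multiplication by a variable uses the bound at s/2. -/
theorem exists_norm_eval_eig_le (f : MvPolynomial ℕ ℂ) : ∀ s : ℝ, 0 < s → ∃ C : ℝ, 0 ≤ C ∧
    ∀ S : Maya, ‖MvPolynomial.eval (fun r => eig r S) f‖ ≤ C * Real.exp (s * energy 0 S) := by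
  have hexp : ∀ (s : ℝ) (S : Maya), 0 < s → 1 ≤ Real.exp (s * energy 0 S) := fun s S hs =>
    Real.one_le_exp (mul_nonneg hs.le (energy_nonneg _ _))
  induction f using MvPolynomial.induction_on with
  | C a =>
    refine fun s hs => ⟨‖a‖, norm_nonneg _, fun S => ?_⟩
    rw [MvPolynomial.eval_C]
    exact le_mul_of_one_le_right (norm_nonneg _) (hexp s S hs)
  | add p q hp hq =>
    intro s hs
    obtain ⟨C, hC0, hC⟩ := hp s hs
    obtain ⟨D, hD0, hD⟩ := hq s hs
    refine ⟨C + D, add_nonneg hC0 hD0, fun S => ?_⟩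
    rw [map_add, add_mul]
    exact (norm_add_le _ _).trans (add_le_add (hC S) (hD S))
  | mul_X p r hp =>
    intro s hs
    obtain ⟨C, hC0, hC⟩ := hp (s / 2) (half_pos hs)
    have hs2 : 0 < (s / 2) ^ (r + 1) := by positivity
    refine ⟨C * (2 * (((r + 1).factorial : ℝ) / (s / 2) ^ (r + 1)) + ‖bern r (1 / 2)‖),
      by positivity, fun S => ?_⟩
    have h1 : energy 0 S ^ (r + 1) ≤
        (r + 1).factorial / (s / 2) ^ (r + 1) * Real.exp (s / 2 * energy 0 S) := by
      have := Real.pow_div_factorial_le_exp (s / 2 * energy 0 S)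
        (mul_nonneg (half_pos hs).le (energy_nonneg _ _)) (r + 1)
      rw [div_le_iff₀ (by positivity), mul_pow] at this
      rw [div_mul_eq_mul_div, le_div_iff₀ hs2]
      linarith
    have h2 : ‖eig r S‖ ≤ (2 * (((r + 1).factorial : ℝ) / (s / 2) ^ (r + 1)) + ‖bern r (1 / 2)‖) *
        Real.exp (s / 2 * energy 0 S) := by
      refine (norm_eig_le r S).trans ?_
      rw [add_mul, mul_assoc]
      refine add_le_add (mul_le_mul_of_nonneg_left h1 zero_le_two) ?_
      exact le_mul_of_one_le_right (norm_nonneg _) (hexp _ S (half_pos hs))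
    rw [map_mul, MvPolynomial.eval_X, norm_mul]
    refine (mul_le_mul (hC S) h2 (norm_nonneg _) (by positivity)).trans (le_of_eq ?_)
    rw [show s * energy 0 S = s / 2 * energy 0 S + s / 2 * energy 0 S by ring, Real.exp_add]
    ring

theorem summable_exp_neg_abs (a : ℝ) {t : ℝ} (ht : 0 < t) :
    Summable fun m : ℤ => Real.exp (-t * |(m : ℝ) + a|) := by
  have hg : Summable fun n : ℕ => Real.exp (t * |a|) * Real.exp (n * -t) :=
    (Real.summable_exp_nat_mul_iff.2 (neg_neg_of_pos ht)).mul_left _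
  have hle : ∀ (m : ℤ) (n : ℕ), (n : ℝ) ≤ |(m : ℝ)| →
      Real.exp (-t * |(m : ℝ) + a|) ≤ Real.exp (t * |a|) * Real.exp (n * -t) := by
    intro m n h
    rw [← Real.exp_add, Real.exp_le_exp]
    have : |(m : ℝ)| ≤ |(m : ℝ) + a| + |a| := by
      have := abs_sub (m + a : ℝ) a
      simpa using this
    nlinarith
  refine Summable.of_nat_of_neg_add_one ?_ ?_
  · exact Summable.of_nonneg_of_le (fun n => (Real.exp_pos _).le)
      (fun n => hle _ n (by simp)) hg
  · refine Summable.of_nonneg_of_le (fun n => (Real.exp_pos _).le) (fun n => hle _ n ?_) hg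
    push_cast
    rw [abs_neg, abs_of_nonneg (by positivity)]
    linarith

/-- Index sets are finite sets of excited positions and the energy is additive over them, so this is
the expansion of ∏(1 + e^(-t|m - 1/2 + a|)). -/
theorem summable_exp_neg_energy (a : ℝ) {t : ℝ} (ht : 0 < t) :
    Summable fun S : Maya => Real.exp (-t * energy a S) := by
  have h := summable_finsetProd_of_summable_nonneg (fun m : ℤ => (Real.exp_pos _).le)
    (summable_exp_neg_abs (-(1 / 2) + a) ht)
  refine (diffEquiv.summable_iff.2 h).congr fun S => ?_
  simp only [comp_apply]
  rw [energy, Finset.mul_sum, Real.exp_sum]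
  refine Finset.prod_congr rfl fun m _ => ?_
  rw [← add_assoc, ← sub_eq_add_neg]

theorem norm_exp_mul_eig_one (τ : ℍ) (S : Maya) : ‖cexp (2 * Real.pi * I * τ * eig 1 S)‖ =
    Real.exp (-(2 * Real.pi * τ.im) * energy 0 S) * ‖cexp (2 * Real.pi * I * τ * bern 1 (1 / 2))‖ := by
  rw [eig_one_eq_energy, mul_add, Complex.exp_add, norm_mul, Complex.norm_exp]
  congr 2
  simp

theorem summable_norm_eig (f : MvPolynomial ℕ ℂ) (τ : ℍ) : Summable fun S : Maya =>
    ‖cexp (2 * Real.pi * I * τ * eig 1 S) * MvPolynomial.eval (fun r => eig r S) f‖ := by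
  -- Half of the decay rate 2πy is spent on the polynomial factor.
  have ht : 0 < Real.pi * τ.im := mul_pos Real.pi_pos τ.im_pos
  obtain ⟨C, hC0, hC⟩ := exists_norm_eval_eig_le f _ ht
  refine Summable.of_nonneg_of_le (fun S => norm_nonneg _) (fun S => ?_)
    ((summable_exp_neg_energy 0 ht).mul_left (‖cexp (2 * Real.pi * I * τ * bern 1 (1 / 2))‖ * C))
  rw [norm_mul, norm_exp_mul_eig_one]
  refine (mul_le_mul_of_nonneg_left (hC S) (by positivity)).trans (le_of_eq ?_)
  have : Real.exp (-(Real.pi * τ.im) * energy 0 S) = Real.exp (-(2 * Real.pi * τ.im) * energy 0 S) *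
      Real.exp (Real.pi * τ.im * energy 0 S) := by
    rw [← Real.exp_add]
    ring_nf
  rw [this]
  ring

/-! ### The charge zero traces -/

/-- The trace of `q^{D̃_1} f(D̃_0, D̃_1, …)` on the charge zero part. -/
def chargeZeroTrace (f : MvPolynomial ℕ ℂ) (τ : ℍ) : ℂ :=
  ∑' S : Maya₀, cexp (2 * Real.pi * I * τ * eig 1 S.1) * MvPolynomial.eval (fun r => eig r S.1) f

theorem summable_norm_chargeZero (f : MvPolynomial ℕ ℂ) (τ : ℍ) : Summable fun S : Maya₀ =>
    ‖cexp (2 * Real.pi * I * τ * eig 1 S.1) * MvPolynomial.eval (fun r => eig r S.1) f‖ :=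
  (summable_norm_eig f τ).subtype _

theorem hasSum_chargeZeroTrace (f : MvPolynomial ℕ ℂ) (τ : ℍ) : HasSum (fun S : Maya₀ =>
    cexp (2 * Real.pi * I * τ * eig 1 S.1) * MvPolynomial.eval (fun r => eig r S.1) f)
      (chargeZeroTrace f τ) :=
  (summable_norm_chargeZero f τ).of_norm.hasSum

/-- The charge zero trace as a linear map. -/
def traceMap : MvPolynomial ℕ ℂ →ₗ[ℂ] (ℍ → ℂ) where
  toFun := chargeZeroTrace
  map_add' f g := funext fun τ => by
    refine (hasSum_chargeZeroTrace (f + g) τ).unique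
      (((hasSum_chargeZeroTrace f τ).add (hasSum_chargeZeroTrace g τ)).congr_fun fun S => ?_)
    simp [mul_add]
  map_smul' c f := funext fun τ => by
    refine (hasSum_chargeZeroTrace (c • f) τ).unique
      (((hasSum_chargeZeroTrace f τ).mul_left c).congr_fun fun S => ?_)
    simp [MvPolynomial.smul_eval]
    ring

theorem traceMap_apply (f : MvPolynomial ℕ ℂ) (τ : ℍ) : traceMap f τ = chargeZeroTrace f τ := rfl

theorem traceMap_X_zero_mul (f : MvPolynomial ℕ ℂ) : traceMap (MvPolynomial.X 0 * f) = 0 := by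
  ext τ
  refine (hasSum_chargeZeroTrace _ τ).unique (hasSum_zero.congr_fun fun S => ?_)
  simp [S.2]

/-! ### Translation of polynomials in the power sums -/

/-- The substitution that expresses the power sums of a translate through the power sums. -/
def translate : MvPolynomial ℕ ℂ →ₐ[ℂ] Polynomial (MvPolynomial ℕ ℂ) :=
  MvPolynomial.aeval fun r =>
    (∑ i ∈ Finset.range (r + 1), Polynomial.C (MvPolynomial.C (r.choose i : ℂ) * MvPolynomial.X i) *
      Polynomial.X ^ (r - i)) +
      Polynomial.C (MvPolynomial.C ((r : ℂ) + 1)⁻¹) * Polynomial.X ^ (r + 1)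

theorem translate_X (r : ℕ) : translate (MvPolynomial.X r) =
    (∑ i ∈ Finset.range (r + 1), Polynomial.C (MvPolynomial.C (r.choose i : ℂ) * MvPolynomial.X i) *
      Polynomial.X ^ (r - i)) +
      Polynomial.C (MvPolynomial.C ((r : ℂ) + 1)⁻¹) * Polynomial.X ^ (r + 1) :=
  MvPolynomial.aeval_X _ _

theorem eval_powSum (f : MvPolynomial ℕ ℂ) (b : ℂ) (S : Maya) :
    MvPolynomial.eval (fun r => powSum r b S) f =
      Polynomial.eval₂ (MvPolynomial.eval fun r => eig r S) b (translate f) := by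
  induction f using MvPolynomial.induction_on with
  | C a =>
    rw [MvPolynomial.eval_C, ← MvPolynomial.algebraMap_eq, AlgHom.commutes,
      Polynomial.algebraMap_apply, Polynomial.eval₂_C, MvPolynomial.algebraMap_eq,
      MvPolynomial.eval_C]
  | add p q hp hq => rw [map_add, map_add, Polynomial.eval₂_add, hp, hq]
  | mul_X p r hp =>
    rw [map_mul, map_mul, Polynomial.eval₂_mul, hp, MvPolynomial.eval_X, translate_X, powSum_add]
    simp [Polynomial.eval₂_add, Polynomial.eval₂_finsetSum, Polynomial.eval₂_mul, div_eq_inv_mul]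

/-- The summand of the twisted trace over all charges, in the variables translated by `a`. -/
def twistedTerm (a b : ℝ) (f : MvPolynomial ℕ ℂ) (τ : ℍ) (S : Maya) : ℂ :=
  cexp (2 * Real.pi * I * (S.charge + a) * b) * cexp (2 * Real.pi * I * τ * powSum 1 a S) *
    MvPolynomial.eval (fun r => powSum r a S) f

theorem hasSum_mul {ι κ : Type*} {f : ι → ℂ} {g : κ → ℂ} {s t : ℂ}
    (hf : HasSum f s) (hg : HasSum g t) : HasSum (fun x : ι × κ => f x.1 * g x.2) (s * t) :=
  hf.mul hg (summable_mul_of_summable_norm hf.summable.norm hg.summable.norm)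

/-- Write S as the translate by n of a set of charge zero. Then q^{d_1} splits off q^{(n+a)²/2}, and
f becomes a polynomial in n + a with charge zero coefficients, so the double sum factors degree by
degree. -/
theorem hasSum_twistedTerm (a b : ℝ) (f : MvPolynomial ℕ ℂ) (τ : ℍ) {N : ℕ}
    (hN : (translate f).natDegree < N) : HasSum (twistedTerm a b f τ)
      (∑ j ∈ Finset.range N, thetaCoeff a b j τ * traceMap ((translate f).coeff j) τ) := by
  have h : ∀ j ∈ Finset.range N, HasSum (fun x : ℤ × Maya₀ => ((x.1 : ℂ) + a) ^ j *
      cexp (2 * Real.pi * I * (x.1 + a) * b + Real.pi * I * (x.1 + a) ^ 2 * τ) *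
      (cexp (2 * Real.pi * I * τ * eig 1 x.2.1) *
        MvPolynomial.eval (fun r => eig r x.2.1) ((translate f).coeff j)))
      (thetaCoeff a b j τ * traceMap ((translate f).coeff j) τ) := by
    intro j _
    rw [traceMap_apply]
    have h1 := hasSum_thetaCoeff a b j (τ := (τ : ℂ)) τ.im_pos
    have h2 := hasSum_chargeZeroTrace ((translate f).coeff j) τ
    have h3 := hasSum_mul h1 h2
    exact h3
  rw [← chargeEquiv.hasSum_iff]
  refine (hasSum_sum h).congr_fun fun x => ?_
  have hc : ((Maya.shift ^ x.1) x.2.1).charge = x.1 := by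
    rw [charge_shift_zpow, x.2.charge_eq, zero_add]
  change twistedTerm a b f τ ((Maya.shift ^ x.1) x.2.1) = _
  simp only [twistedTerm, hc, powSum_shift_zpow]
  rw [eval_powSum, Polynomial.eval₂_eq_sum_range' _ hN, Finset.mul_sum]
  refine Finset.sum_congr rfl fun j _ => ?_
  rw [powSum_one_left, x.2.charge_eq, Int.cast_zero, zero_mul, add_zero, ← Complex.exp_add]
  have : cexp (2 * Real.pi * I * (x.1 + a) * b + 2 * Real.pi * I * τ * (eig 1 x.2.1 + (a + x.1) ^ 2 / 2)) =
      cexp (2 * Real.pi * I * (x.1 + a) * b + Real.pi * I * (x.1 + a) ^ 2 * τ) *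
        cexp (2 * Real.pi * I * τ * eig 1 x.2.1) := by
    rw [← Complex.exp_add]
    ring_nf
  rw [this, add_comm (a : ℂ) x.1]
  ring

end InfiniteWedge

end

noncomputable section

namespace InfiniteWedge

open UpperHalfPlane hiding I
open Complex Function
open scoped ModularForm

/-! ### Product formulas -/

theorem hasSum_prod_diff {g : ℤ → ℂ} (hg : Summable fun m => ‖g m‖) :
    HasSum (fun S : Maya => ∏ m ∈ S.diff, g m) (∏' m, (1 + g m)) := by
  have h := summable_finsetProd_of_summable_norm hg
  rw [tprod_one_add h]
  have := diffEquiv.hasSum_iff.2 h.hasSum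
  exact this

theorem norm_exp_mul_abs (τ : ℍ) (x : ℝ) :
    ‖cexp (2 * Real.pi * I * τ * (|x| : ℝ))‖ = Real.exp (-(2 * Real.pi * τ.im) * |x|) := by
  rw [Complex.norm_exp]
  congr 1
  simp

theorem exp_mul_energy (a : ℝ) (τ : ℍ) (S : Maya) :
    cexp (2 * Real.pi * I * τ * energy a S) =
      ∏ m ∈ S.diff, cexp (2 * Real.pi * I * τ * (|(m : ℝ) - 1 / 2 + a| : ℝ)) := by
  rw [energy, ofReal_sum, Finset.mul_sum, Complex.exp_sum]

/-- For f = 1 without twist the trace is also a power of q times ∏(1 + q^|m - 1/2|), a convergent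
product none of whose factors vanishes. -/
theorem thetaCoeff_zero_zero_mul_trace_one_ne_zero (τ : ℍ) :
    thetaCoeff 0 0 0 τ * traceMap 1 τ ≠ 0 := by
  have ht : 0 < 2 * Real.pi * τ.im := by have := τ.im_pos; positivity
  set g : ℤ → ℂ := fun m => cexp (2 * Real.pi * I * τ * (|(m : ℝ) - 1 / 2 + (0 : ℝ)| : ℝ)) with hg
  have hgn : ∀ m, ‖g m‖ = Real.exp (-(2 * Real.pi * τ.im) * |(m : ℝ) + (-(1 / 2))|) := by
    intro m
    rw [hg, norm_exp_mul_abs, add_zero, sub_eq_add_neg]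
  have hs : Summable fun m => ‖g m‖ := by
    simp_rw [hgn]
    exact summable_exp_neg_abs _ ht
  have hne : ∏' m, (1 + g m) ≠ 0 := by
    refine tprod_one_add_ne_zero_of_summable (fun m hm => ?_) hs
    have h1 : ‖g m‖ = 1 := by rw [← norm_neg, ← eq_neg_of_add_eq_zero_left hm, norm_one]
    rw [hgn, Real.exp_eq_one_iff] at h1
    rcases mul_eq_zero.1 h1 with h1 | h1
    · linarith
    · rw [abs_eq_zero] at h1
      have h2 : ((2 * m : ℤ) : ℝ) = (1 : ℤ) := by
        push_cast
        linarith
      have := Int.cast_injective h2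
      omega
  have h0 := hasSum_twistedTerm 0 0 1 τ (N := 1) (by simp)
  have h1 := ((hasSum_prod_diff hs).mul_left (cexp (2 * Real.pi * I * τ * bern 1 (1 / 2))))
  have h2 : thetaCoeff 0 0 0 τ * traceMap 1 τ =
      cexp (2 * Real.pi * I * τ * bern 1 (1 / 2)) * ∏' m, (1 + g m) := by
    rw [Finset.sum_range_one, map_one, Polynomial.coeff_one_zero] at h0
    refine h0.unique (h1.congr_fun fun S => ?_)
    rw [twistedTerm, ofReal_zero, powSum_zero_right, eig_one_eq_energy,
      mul_add (2 * Real.pi * I * (τ : ℂ)), Complex.exp_add,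
      exp_mul_energy, hg]
    simp
    ring
  rw [h2]
  exact mul_ne_zero (Complex.exp_ne_zero _) hne

theorem theta_ne_zero (τ : ℍ) : theta τ ≠ 0 := by
  have hτ : 0 < (2 * (τ : ℂ)).im := by
    have := τ.im_pos
    simpa using this
  have h := left_ne_zero_of_mul (thetaCoeff_zero_zero_mul_trace_one_ne_zero ⟨2 * (τ : ℂ), hτ⟩)
  have h2 : theta τ = thetaCoeff 0 0 0 (2 * (τ : ℂ)) := by
    refine ((hasSum_thetaCoeff 0 0 0 hτ).unique ?_).symm
    have := hasSum_jacobiTheta₂_term 0 hτ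
    rw [← jacobiTheta_eq_jacobiTheta₂] at this
    refine this.congr_fun fun n => ?_
    simp [jacobiTheta₂_term]
  rw [h2]
  exact h

/-! ### The odd theta characteristic -/

theorem exp_half_mul (c : ℤ) :
    cexp (2 * Real.pi * I * (c + (1 / 2 : ℝ)) * (1 / 2 : ℝ)) = I * (-1) ^ c := by
  have h : cexp (c * (Real.pi * I)) = (-1) ^ c := by
    rw [Complex.exp_int_mul, Complex.exp_pi_mul_I]
  have h2 : 2 * Real.pi * I * (c + (1 / 2 : ℝ)) * (1 / 2 : ℝ) =
      Real.pi / 2 * I + c * (Real.pi * I) := by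
    push_cast
    ring
  rw [h2, Complex.exp_add, Complex.exp_pi_div_two_mul_I, h]

/-- The substitution n ↦ -1 - n preserves (n + 1/2)² and reverses (-1)^n: this theta function is
odd. -/
theorem thetaCoeff_half_half_zero {τ : ℂ} (hτ : 0 < τ.im) : thetaCoeff (1 / 2) (1 / 2) 0 τ = 0 := by
  have h := hasSum_thetaCoeff (1 / 2) (1 / 2) 0 hτ
  have h2 := ((Equiv.subLeft (-1 : ℤ)).hasSum_iff.2 h).neg
  have h3 := h.unique (h2.congr_fun fun n => ?_)
  · exact self_eq_neg.1 h3
  · simp only [comp_apply, Equiv.subLeft_apply, Complex.exp_add, exp_half_mul, pow_zero, one_mul]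
    rw [zpow_sub₀ (by simp)]
    have h4 : ((-1 : ℂ) ^ n)⁻¹ = (-1) ^ n := by
      rw [← inv_zpow]
      norm_num
    rw [div_eq_mul_inv ((-1 : ℂ) ^ (-1 : ℤ)), h4]
    push_cast
    ring_nf

theorem neg_one_zpow_charge_toggle (S : Maya) :
    (-1 : ℂ) ^ (Maya.toggle S).charge = -(-1) ^ S.charge := by
  rw [charge_toggle, zpow_add₀ (by simp), zpow_sub₀ (by simp), zpow_mul]
  simp

/-- Toggling the position zero changes the parity of the charge and, in the absence of X_0, nothing
else, so the terms of the twisted trace cancel in pairs. -/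
theorem sum_thetaCoeff_mul_trace_eq_zero {d : ℕ →₀ ℕ} (hd : d 0 = 0) (τ : ℍ) {N : ℕ}
    (hN : (translate (MvPolynomial.monomial d 1)).natDegree < N) :
    ∑ j ∈ Finset.range N, thetaCoeff (1 / 2) (1 / 2) j τ *
      traceMap ((translate (MvPolynomial.monomial d 1)).coeff j) τ = 0 := by
  have h := hasSum_twistedTerm (1 / 2) (1 / 2) _ τ hN
  have h2 := (Maya.toggle.hasSum_iff.2 h).neg
  refine self_eq_neg.1 (h.unique (h2.congr_fun fun S => ?_))
  have h3 : MvPolynomial.eval (fun r => powSum r ((1 / 2 : ℝ) : ℂ) (Maya.toggle S))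
      (MvPolynomial.monomial d 1) =
      MvPolynomial.eval (fun r => powSum r ((1 / 2 : ℝ) : ℂ) S) (MvPolynomial.monomial d 1) := by
    rw [MvPolynomial.eval_monomial, MvPolynomial.eval_monomial]
    congr 1
    refine Finsupp.prod_congr fun r hr => ?_
    have hr0 : r ≠ 0 := by
      rintro rfl
      exact Finsupp.mem_support_iff.1 hr hd
    have := powSum_toggle r hr0 S
    push_cast
    rw [this]
  simp only [comp_apply, twistedTerm, h3, exp_half_mul, neg_one_zpow_charge_toggle]
  have := powSum_toggle 1 one_ne_zero S
  push_cast
  rw [this]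
  ring

theorem translate_X_zero : translate (MvPolynomial.X 0) =
    Polynomial.C (MvPolynomial.X 0) + Polynomial.X := by
  simp [translate_X]

/-- At m = 0 the factor -1 from the charge meets the factor -1 from 1 + 2 · occ, hence the value 1
there. -/
theorem prod_diff_eq (τ : ℍ) (S : Maya) :
    ∏ m ∈ S.diff, (if m = 0 then 1 else -cexp (2 * Real.pi * I * τ * (|(m : ℝ)| : ℝ))) =
      (-1 : ℂ) ^ S.charge * cexp (2 * Real.pi * I * τ * energy (1 / 2) S) * (1 + 2 * occ S 0) := by
  have h : (1 + 2 * (occ S 0 : ℂ)) = ∏ m ∈ S.diff, if m = 0 then -1 else 1 := by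
    rw [Finset.prod_ite_eq']
    split_ifs with h0
    · rw [occ_of_mem_diff h0]
      norm_num
    · rw [occ_of_notMem_diff h0]
      norm_num
  rw [h, neg_one_zpow_charge, exp_mul_energy, ← Finset.prod_mul_distrib, ← Finset.prod_mul_distrib]
  refine Finset.prod_congr rfl fun m _ => ?_
  split_ifs with hm
  · simp [hm]
  · simp

/-- X_0 translates to X_0 + X, so its twisted trace is θ_1 · tr(1). Adding the toggled sum replaces
the factor charge + 1/2 by 1 + 2 · occ S 0 = ±1, which is multiplicative over positions. The sum
becomes a product with factor 2 at m = 0 and ∏(1 - q^n) from each sign of m. -/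
theorem thetaCoeff_half_half_one_mul_trace_one (τ : ℍ) :
    thetaCoeff (1 / 2) (1 / 2) 1 τ * traceMap 1 τ = I * η (τ : ℂ) ^ 2 := by
  have ht : 0 < 2 * Real.pi * τ.im := by have := τ.im_pos; positivity
  set s := thetaCoeff (1 / 2) (1 / 2) 1 τ * traceMap 1 τ with hs
  set g : ℤ → ℂ := fun m => if m = 0 then 1 else -cexp (2 * Real.pi * I * τ * (|(m : ℝ)| : ℝ)) with hg
  set P := ∏' n, (1 - ModularForm.eta_q n τ) with hP
  have h0 : HasSum (twistedTerm (1 / 2) (1 / 2) (MvPolynomial.X 0) τ) s := by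
    have h := hasSum_twistedTerm (1 / 2) (1 / 2) (MvPolynomial.X 0) τ (N := 2)
      (by rw [translate_X_zero, add_comm, Polynomial.natDegree_X_add_C]; norm_num)
    rw [translate_X_zero, Finset.sum_range_succ, Finset.sum_range_one] at h
    have h1 := congrFun (traceMap_X_zero_mul 1) τ
    rw [mul_one] at h1
    simpa [h1, hs] using h
  have h1 := h0.add (Maya.toggle.hasSum_iff.2 h0)
  have hgs : Summable fun m => ‖g m‖ := by
    refine Summable.of_nonneg_of_le (fun m => norm_nonneg _) (fun m => ?_) (summable_exp_neg_abs 0 ht)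
    rw [hg]
    dsimp only
    split_ifs with hm
    · simp [hm]
    · rw [norm_neg, norm_exp_mul_abs, add_zero]
  have hprod : ∏' m, (1 + g m) = P * 2 * P := by
    have hq : HasProd (fun n => 1 - ModularForm.eta_q n τ) P :=
      (ModularForm.multipliable_one_sub_pow (by simpa using norm_qParam_lt_one 1 τ)).hasProd
    have hgn : ∀ (m : ℤ) (n : ℕ), |(m : ℝ)| = n + 1 → g m = -ModularForm.eta_q n τ := by
      intro m n h
      have hm : m ≠ 0 := by
        rintro rfl
        rw [Int.cast_zero, abs_zero] at h
        linarith [(Nat.cast_nonneg n : (0 : ℝ) ≤ n)]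
      simp only [hg, if_neg hm, h, ModularForm.eta_q_eq_cexp]
      push_cast
      ring_nf
    have hpos : HasProd (fun n : ℕ => 1 + g (n + 1)) P := by
      refine hq.congr_fun fun n => ?_
      rw [hgn _ n (by push_cast; rw [abs_of_nonneg (by positivity)]), sub_eq_add_neg]
    have hneg : HasProd (fun n : ℕ => 1 + g (-(n + 1))) P := by
      refine hq.congr_fun fun n => ?_
      rw [hgn _ n (by push_cast; rw [abs_neg, abs_of_nonneg (by positivity)]), sub_eq_add_neg]
    have := (hpos.of_add_one_of_neg_add_one (f := fun m => 1 + g m) hneg).tprod_eq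
    rw [this]
    simp [hg]
    norm_num
  -- 1/12 is `bern 1 1`, the vacuum energy at a = 1/2; it yields the prefactor q^(1/12) of η².
  have h2 := (hasSum_prod_diff hgs).mul_left (I * cexp (2 * Real.pi * I * τ * (1 / 12)))
  have h3 : s + s = I * cexp (2 * Real.pi * I * τ * (1 / 12)) * (P * 2 * P) := by
    rw [← hprod]
    refine h1.unique (h2.congr_fun fun S => ?_)
    rw [prod_diff_eq, comp_apply, twistedTerm, twistedTerm, exp_half_mul, exp_half_mul,
      neg_one_zpow_charge_toggle, MvPolynomial.eval_X, MvPolynomial.eval_X, powSum_zero_left,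
      powSum_zero_left, charge_toggle]
    have h4 := powSum_toggle 1 one_ne_zero S
    have h5 := powSum_one_eq_energy (a := 1 / 2) (by norm_num) le_rfl S
    push_cast at h5 ⊢
    rw [h4, h5, show (1 / 2 + 1 / 2 : ℂ) = 1 by norm_num, bern_one_one,
      mul_add (2 * Real.pi * I * (τ : ℂ)), Complex.exp_add]
    ring
  have h6 : η (τ : ℂ) ^ 2 = cexp (2 * Real.pi * I * τ * (1 / 12)) * P ^ 2 := by
    rw [ModularForm.eta, mul_pow, Periodic.qParam, ← Complex.exp_nat_mul]
    congr 2
    push_cast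
    ring
  rw [h6]
  linear_combination h3 / 2

/-- The constant cannot vanish since its product with a trace gives iη²; its value is never needed.
-/
theorem exists_thetaCoeff_half_half_one_eq : ∃ c : ℂ, c ≠ 0 ∧ ∀ τ : ℍ,
    thetaCoeff (1 / 2) (1 / 2) 1 τ = c * η (τ : ℂ) ^ 3 := by
  obtain ⟨c, hc⟩ := exists_thetaCoeff_eq
  refine ⟨c, ?_, hc⟩
  rintro rfl
  have h := thetaCoeff_half_half_one_mul_trace_one UpperHalfPlane.I
  rw [hc, zero_mul, zero_mul] at h
  exact mul_ne_zero I_ne_zero (pow_ne_zero 2 (eta_ne_zero _)) h.symm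

theorem trace_one_mem : traceMap 1 ∈ quasi (-1) := by
  obtain ⟨c, hc0, hc⟩ := exists_thetaCoeff_half_half_one_eq
  convert (quasi (-1)).smul_mem (I / c) (eta_zpow_mem_quasi (-1)) using 1
  ext τ
  have h := thetaCoeff_half_half_one_mul_trace_one τ
  have hη := eta_ne_zero τ
  rw [hc] at h
  rw [Pi.smul_apply, smul_eq_mul, zpow_neg_one]
  field_simp
  refine mul_left_cancel₀ (pow_ne_zero 2 hη) ?_
  linear_combination h

end InfiniteWedge

end

noncomputable section

namespace InfiniteWedge

open UpperHalfPlane hiding I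
open Complex Function
open scoped ModularForm

/-! ### Weights -/

/-- The weight of a monomial, the variable `X_r` having weight `r + 1`. -/
def weight : (ℕ →₀ ℕ) →+ ℕ := Finsupp.weight fun r => r + 1

theorem weight_single (r : ℕ) : weight (Finsupp.single r 1) = r + 1 := by
  simp [weight, Finsupp.weight_single]

/-- Homogeneity of weight `w`, where the polynomial variable has weight `1`. -/
def Bihomogeneous (w : ℕ) (p : Polynomial (MvPolynomial ℕ ℂ)) : Prop :=
  ∀ j d, MvPolynomial.coeff d (p.coeff j) ≠ 0 → weight d + j = w

theorem Bihomogeneous.add {w : ℕ} {p q : Polynomial (MvPolynomial ℕ ℂ)} (hp : Bihomogeneous w p)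
    (hq : Bihomogeneous w q) : Bihomogeneous w (p + q) := by
  intro j d h
  rw [Polynomial.coeff_add, MvPolynomial.coeff_add] at h
  by_cases h1 : MvPolynomial.coeff d (p.coeff j) = 0
  · rw [h1, zero_add] at h
    exact hq j d h
  · exact hp j d h1

theorem Bihomogeneous.sum {ι : Type*} {w : ℕ} {s : Finset ι}
    {p : ι → Polynomial (MvPolynomial ℕ ℂ)} (hp : ∀ i ∈ s, Bihomogeneous w (p i)) :
    Bihomogeneous w (∑ i ∈ s, p i) := by
  intro j d h
  rw [Polynomial.finsetSum_coeff, MvPolynomial.coeff_sum] at h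
  obtain ⟨i, hi, hne⟩ := Finset.exists_ne_zero_of_sum_ne_zero h
  exact hp i hi j d hne

theorem Bihomogeneous.mul {w w' : ℕ} {p q : Polynomial (MvPolynomial ℕ ℂ)}
    (hp : Bihomogeneous w p) (hq : Bihomogeneous w' q) : Bihomogeneous (w + w') (p * q) := by
  intro j d h
  rw [Polynomial.coeff_mul, MvPolynomial.coeff_sum] at h
  obtain ⟨i, hi, hne⟩ := Finset.exists_ne_zero_of_sum_ne_zero h
  rw [MvPolynomial.coeff_mul] at hne
  obtain ⟨e, he, hne⟩ := Finset.exists_ne_zero_of_sum_ne_zero hne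
  have h1 := hp _ _ (left_ne_zero_of_mul hne)
  have h2 := hq _ _ (right_ne_zero_of_mul hne)
  rw [Finset.HasAntidiagonal.mem_antidiagonal] at hi he
  rw [← hi, ← he, map_add]
  omega

theorem bihomogeneous_C_mul_X_pow {a : MvPolynomial ℕ ℂ} {w n : ℕ}
    (h : ∀ d, MvPolynomial.coeff d a ≠ 0 → weight d + n = w) :
    Bihomogeneous w (Polynomial.C a * Polynomial.X ^ n) := by
  intro j d hd
  rw [Polynomial.coeff_C_mul_X_pow] at hd
  split_ifs at hd with hj
  · rw [hj]
    exact h d hd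
  · simp at hd

/-- With X_r of weight r + 1 and the translation parameter of weight 1, even the anomalous term is
homogeneous. -/
theorem bihomogeneous_translate_X (r : ℕ) : Bihomogeneous (r + 1) (translate (MvPolynomial.X r)) := by
  classical
  rw [translate_X]
  refine Bihomogeneous.add (Bihomogeneous.sum fun i hi => bihomogeneous_C_mul_X_pow fun d hd => ?_)
    (bihomogeneous_C_mul_X_pow fun d hd => ?_)
  · rw [MvPolynomial.coeff_C_mul, MvPolynomial.coeff_X] at hd
    have : Finsupp.single i 1 = d := by
      by_contra hne
      simp [hne] at hd
    rw [← this, weight_single]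
    have := Finset.mem_range.1 hi
    omega
  · rw [MvPolynomial.coeff_C] at hd
    have : 0 = d := by
      by_contra hne
      simp [hne] at hd
    rw [← this, map_zero, zero_add]

theorem bihomogeneous_one : Bihomogeneous 0 1 := by
  have := bihomogeneous_C_mul_X_pow (a := 1) (w := 0) (n := 0) fun d hd => by
    classical
    rw [MvPolynomial.coeff_one] at hd
    have : 0 = d := by
      by_contra hne
      simp [hne] at hd
    rw [← this, map_zero]
  simpa using this

theorem bihomogeneous_translate_monomial (d : ℕ →₀ ℕ) :
    Bihomogeneous (weight d) (translate (MvPolynomial.monomial d 1)) := by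
  induction d using Finsupp.induction_linear with
  | zero => simpa using bihomogeneous_one
  | add d e hd he =>
    have h := MvPolynomial.monomial_mul (s := d) (s' := e) (a := (1 : ℂ)) (b := 1)
    rw [mul_one] at h
    rw [← h, map_mul, map_add]
    exact hd.mul he
  | single r n =>
    induction n with
    | zero => simpa using bihomogeneous_one
    | succ n ih =>
      rw [Finsupp.single_add, map_add, weight_single, MvPolynomial.monomial_add_single, map_mul,
        pow_one]
      exact ih.mul (bihomogeneous_translate_X r)

theorem coeff_translate_X {r k : ℕ} (h : k ≤ r) : (translate (MvPolynomial.X r)).coeff k =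
    MvPolynomial.C (r.choose (r - k) : ℂ) * MvPolynomial.X (r - k) := by
  rw [translate_X, Polynomial.coeff_add, Polynomial.finsetSum_coeff, Finset.sum_eq_single (r - k)]
  · rw [Polynomial.coeff_C_mul_X_pow, Polynomial.coeff_C_mul_X_pow, if_pos (by omega),
      if_neg (by omega), add_zero]
  · intro i hi hne
    have := Finset.mem_range.1 hi
    rw [Polynomial.coeff_C_mul_X_pow, if_neg (by omega)]
  · intro h'
    exact absurd (Finset.mem_range.2 (by omega)) h'

theorem translate_C (a : ℂ) :
    translate (MvPolynomial.C a) = Polynomial.C (MvPolynomial.C a) := by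
  rw [← MvPolynomial.algebraMap_eq, AlgHom.commutes, Polynomial.algebraMap_apply]

theorem coeff_zero_translate (f : MvPolynomial ℕ ℂ) : (translate f).coeff 0 = f := by
  induction f using MvPolynomial.induction_on with
  | C a => rw [translate_C, Polynomial.coeff_C_zero]
  | add p q hp hq => rw [map_add, Polynomial.coeff_add, hp, hq]
  | mul_X p r hp =>
    rw [map_mul, Polynomial.mul_coeff_zero, hp, coeff_translate_X r.zero_le]
    simp

/-- The linear part of the translation, a derivation. -/
def lowering : Derivation ℂ (MvPolynomial ℕ ℂ) (MvPolynomial ℕ ℂ) :=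
  MvPolynomial.mkDerivation ℂ fun r => (translate (MvPolynomial.X r)).coeff 1

/-- Translation is multiplicative and has constant coefficient f, so its linear coefficient obeys
the Leibniz rule. -/
theorem coeff_one_translate (f : MvPolynomial ℕ ℂ) : (translate f).coeff 1 = lowering f := by
  induction f using MvPolynomial.induction_on with
  | C a =>
    rw [translate_C, Polynomial.coeff_C_of_ne_zero one_ne_zero, ← MvPolynomial.algebraMap_eq,
      Derivation.map_algebraMap]
  | add p q hp hq => rw [map_add, Polynomial.coeff_add, hp, hq, map_add]
  | mul_X p r hp =>
    rw [map_mul, Polynomial.mul_coeff_one, hp, coeff_zero_translate, coeff_zero_translate,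
      Derivation.leibniz, lowering, MvPolynomial.mkDerivation_X, smul_eq_mul, smul_eq_mul,
      mul_comm (MvPolynomial.X r)]

theorem lowering_X_succ (s : ℕ) :
    lowering (MvPolynomial.X (s + 1)) = ((s : ℂ) + 1) • MvPolynomial.X s := by
  rw [← coeff_one_translate, coeff_translate_X (by omega), MvPolynomial.smul_eq_C_mul]
  simp

/-! ### Quasimodularity of the charge zero traces -/

theorem trace_mem_of_forall_monomial {κ : ℤ} {f : MvPolynomial ℕ ℂ}
    (h : ∀ d, MvPolynomial.coeff d f ≠ 0 → traceMap (MvPolynomial.monomial d 1) ∈ quasi κ) :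
    traceMap f ∈ quasi κ := by
  rw [f.as_sum, map_sum]
  refine sum_mem fun d hd => ?_
  rw [← mul_one (MvPolynomial.coeff d f), ← smul_eq_mul, ← MvPolynomial.smul_monomial, map_smul]
  exact (quasi κ).smul_mem _ (h d (MvPolynomial.mem_support_iff.1 hd))

theorem thetaCoeff_half_half_mem_quasi (j : ℕ) :
    (fun τ : ℍ => thetaCoeff (1 / 2) (1 / 2) j τ) ∈ quasi (1 + 2 * j) := by
  have := thetaCoeff_mem_quasi (x := (1, 1)) (fun γ hγ => hγ.2.2.2.2) j
  simpa using this

theorem thetaCoeff_zero_zero_mem_quasi (j : ℕ) :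
    (fun τ : ℍ => thetaCoeff 0 0 j τ) ∈ quasi (1 + 2 * j) := by
  have := thetaCoeff_mem_quasi (x := (0, 0)) (fun γ hγ => hγ.2.2.2.1) j
  simpa using this

/-- In the vanishing relation the term j = 0 is absent and j = 1 is cη³ times the wanted trace. The
terms j ≥ 2 involve traces of weight w + 1 - j < w, known by induction. -/
theorem trace_lowering_mem {w : ℕ}
    (ih : ∀ d, weight d < w → traceMap (MvPolynomial.monomial d 1) ∈ quasi (-1 + 2 * weight d))
    {e : ℕ →₀ ℕ} (he : e 0 = 0) (hw : weight e = w + 1) :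
    traceMap (lowering (MvPolynomial.monomial e 1)) ∈ quasi (-1 + 2 * w) := by
  obtain ⟨c, hc0, hc⟩ := exists_thetaCoeff_half_half_one_eq
  set p := translate (MvPolynomial.monomial e 1) with hp
  have hmem : ∀ j : ℕ, (fun τ : ℍ => thetaCoeff (1 / 2) (1 / 2) (j + 2) τ) *
      traceMap (p.coeff (j + 2)) * (fun τ : ℍ => η (τ : ℂ) ^ (-3 : ℤ)) ∈ quasi (-1 + 2 * w) := by
    intro j
    have hwt : ∀ d, MvPolynomial.coeff d (p.coeff (j + 2)) ≠ 0 → weight d + (j + 2) = w + 1 := by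
      intro d hd
      rw [← hw]
      exact bihomogeneous_translate_monomial e _ _ hd
    by_cases h0 : p.coeff (j + 2) = 0
    · rw [h0, map_zero, mul_zero, zero_mul]
      exact zero_mem _
    · obtain ⟨d₀, hd₀⟩ := MvPolynomial.ne_zero_iff.1 h0
      have h1 : traceMap (p.coeff (j + 2)) ∈ quasi (-1 + 2 * weight d₀) := by
        refine trace_mem_of_forall_monomial fun d hd => ?_
        have h2 := hwt d hd
        have h3 := hwt d₀ hd₀
        have h4 := ih d (by omega)
        rwa [show weight d = weight d₀ by omega] at h4
      -- Doubled weights: (1 + 2(j+2)) + (-1 + 2(w - 1 - j)) - 3 = -1 + 2w.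
      have h5 := mul_mem_quasi (mul_mem_quasi (thetaCoeff_half_half_mem_quasi (j + 2)) h1)
        (eta_zpow_mem_quasi (-3))
      have h3 := hwt d₀ hd₀
      convert h5 using 2
      push_cast
      omega
  have hsum : traceMap (p.coeff 1) = (-c⁻¹) • ∑ j ∈ Finset.range p.natDegree,
      (fun τ : ℍ => thetaCoeff (1 / 2) (1 / 2) (j + 2) τ) *
      traceMap (p.coeff (j + 2)) * (fun τ : ℍ => η (τ : ℂ) ^ (-3 : ℤ)) := by
    ext τ
    -- The padding by 2 allows the terms j = 0 and j = 1 to be split off whatever the degree.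
    have h := sum_thetaCoeff_mul_trace_eq_zero he τ (N := p.natDegree + 2)
      (by rw [← hp]; omega)
    rw [Finset.sum_range_succ', Finset.sum_range_succ', thetaCoeff_half_half_zero τ.im_pos,
      zero_mul, add_zero, zero_add, hc, ← hp] at h
    have hη := eta_ne_zero τ
    have h2 : traceMap (p.coeff 1) τ = -c⁻¹ * (∑ j ∈ Finset.range p.natDegree,
        thetaCoeff (1 / 2) (1 / 2) (j + 2) τ * traceMap (p.coeff (j + 2)) τ) *
          η (τ : ℂ) ^ (-3 : ℤ) := by
      rw [zpow_neg]
      norm_cast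
      field_simp
      linear_combination h
    rw [h2, Pi.smul_apply, Finset.sum_apply, smul_eq_mul, mul_assoc, Finset.sum_mul]
    rfl
  rw [← coeff_one_translate, ← hp, hsum]
  exact (quasi _).smul_mem _ (sum_mem fun j _ => hmem j)

theorem lowering_monomial (e : ℕ →₀ ℕ) : lowering (MvPolynomial.monomial e 1) =
    ∑ r ∈ e.support, MvPolynomial.monomial (e - Finsupp.single r 1) (e r : ℂ) *
      lowering (MvPolynomial.X r) := by
  rw [lowering, MvPolynomial.mkDerivation_monomial, one_smul, Finsupp.sum]
  simp only [MvPolynomial.mkDerivation_X, smul_eq_mul]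

/-- By Leibniz, (s+1) X_s X^e = lowering(X_{s+1} X^e) - X_{s+1} lowering(X^e). The first trace is
known; in the second, ∑ r e_r has dropped by one while s has grown by one at constant weight, so
induction on ∑ r e_r applies. -/
theorem trace_monomial_single_add_mem {w : ℕ}
    (ih : ∀ d, weight d < w → traceMap (MvPolynomial.monomial d 1) ∈ quasi (-1 + 2 * weight d))
    (n : ℕ) : ∀ (s : ℕ) (e : ℕ →₀ ℕ), s ≠ 0 → e 0 = 0 → Finsupp.weight (fun r => r) e = n →
      s + 1 + weight e = w →
      traceMap (MvPolynomial.monomial (Finsupp.single s 1 + e) 1) ∈ quasi (-1 + 2 * w) := by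
  induction n using Nat.strong_induction_on with
  | _ n ihn =>
    intro s e hs he hn hw
    have h1 := trace_lowering_mem ih (e := Finsupp.single (s + 1) 1 + e) (by simp [he])
      (by rw [map_add, weight_single]; omega)
    have h2 : lowering (MvPolynomial.monomial (Finsupp.single (s + 1) 1 + e) 1) =
        MvPolynomial.X (s + 1) * lowering (MvPolynomial.monomial e 1) +
          ((s : ℂ) + 1) • MvPolynomial.monomial (Finsupp.single s 1 + e) 1 := by
      rw [MvPolynomial.monomial_single_add, pow_one, Derivation.leibniz, lowering_X_succ,
        MvPolynomial.monomial_single_add, pow_one, smul_eq_mul, smul_eq_mul, mul_smul_comm,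
        mul_comm (MvPolynomial.monomial e 1)]
    have h3 : traceMap (MvPolynomial.X (s + 1) * lowering (MvPolynomial.monomial e 1)) ∈
        quasi (-1 + 2 * w) := by
      rw [lowering_monomial, Finset.mul_sum, map_sum]
      refine sum_mem fun r hr => ?_
      have hr' := Finsupp.mem_support_iff.1 hr
      obtain ⟨t, rfl⟩ : ∃ t, r = t + 1 := Nat.exists_eq_succ_of_ne_zero (by
        rintro rfl
        exact hr' he)
      set e₀ := e - Finsupp.single (t + 1) 1 with he₀
      have hee : e = Finsupp.single (t + 1) 1 + e₀ :=
        (add_tsub_cancel_of_le (Finsupp.single_le_iff.2 (Nat.one_le_iff_ne_zero.2 hr'))).symm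
      have h4 : MvPolynomial.X (s + 1) * (MvPolynomial.monomial e₀ (e (t + 1) : ℂ) *
          lowering (MvPolynomial.X (t + 1))) = ((e (t + 1) : ℂ) * (t + 1)) •
            MvPolynomial.monomial (Finsupp.single (s + 1) 1 + (Finsupp.single t 1 + e₀)) 1 := by
        rw [lowering_X_succ, MvPolynomial.monomial_single_add, MvPolynomial.monomial_single_add,
          pow_one, pow_one, ← mul_one (e (t + 1) : ℂ), ← smul_eq_mul (e (t + 1) : ℂ) 1,
          ← MvPolynomial.smul_monomial, smul_eq_mul, mul_one]
        simp only [MvPolynomial.smul_eq_C_mul, map_mul]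
        ring
      rw [h4, map_smul]
      refine (quasi _).smul_mem _ ?_
      -- Lowering X_1 produces X_0, which kills the trace on charge zero.
      rcases eq_or_ne t 0 with rfl | ht
      · rw [add_left_comm, MvPolynomial.monomial_single_add, pow_one, traceMap_X_zero_mul]
        exact zero_mem _
      · have hz : e₀ 0 = 0 := by
          rw [hee] at he
          simpa using he
        have hi : Finsupp.weight (fun r => r) e = t + 1 + Finsupp.weight (fun r => r) e₀ := by
          rw [hee, map_add, Finsupp.weight_single]
          simp
        have hwe : weight e = t + 2 + weight e₀ := by
          rw [hee, map_add, weight_single]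
        refine ihn (n - 1) (by omega) (s + 1) _ (by omega) (by simp [hz, ht]) ?_ ?_
        · rw [map_add, Finsupp.weight_single, smul_eq_mul, one_mul]
          omega
        · rw [map_add, weight_single]
          omega
    have hs0 : (s : ℂ) + 1 ≠ 0 := by exact_mod_cast s.succ_ne_zero
    rw [h2, map_add, map_smul] at h1
    have h5 := (quasi (-1 + 2 * w)).smul_mem ((s : ℂ) + 1)⁻¹ (sub_mem h1 h3)
    rwa [add_sub_cancel_left, smul_smul, inv_mul_cancel₀ hs0, one_smul] at h5

theorem trace_monomial_mem (d : ℕ →₀ ℕ) :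
    traceMap (MvPolynomial.monomial d 1) ∈ quasi (-1 + 2 * weight d) := by
  induction hw : weight d using Nat.strong_induction_on generalizing d with
  | _ w ih =>
    rcases eq_or_ne d 0 with rfl | hd
    · rw [map_zero] at hw
      subst hw
      exact trace_one_mem
    · obtain ⟨s, hs⟩ := Finsupp.ne_iff.1 hd
      have hs' : Finsupp.single s 1 ≤ d := Finsupp.single_le_iff.2 (Nat.one_le_iff_ne_zero.2 hs)
      have hds := (add_tsub_cancel_of_le hs').symm
      rcases Nat.eq_zero_or_pos (d 0) with h0 | h0
      · set e := d - Finsupp.single s 1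
        have hs0 : s ≠ 0 := by
          rintro rfl
          exact hs h0
        rw [hds] at hw h0 ⊢
        refine trace_monomial_single_add_mem (fun d hd => ih _ hd d rfl) _ s e hs0
          (Nat.eq_zero_of_add_eq_zero_left h0) rfl ?_
        rwa [map_add, weight_single] at hw
      · have h2 : Finsupp.single 0 1 ≤ d := Finsupp.single_le_iff.2 h0
        have h1 := (add_tsub_cancel_of_le h2).symm
        rw [h1, MvPolynomial.monomial_single_add, pow_one, traceMap_X_zero_mul]
        exact zero_mem _

end InfiniteWedge

end

noncomputable section

namespace InfiniteWedge

open UpperHalfPlane hiding I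
open Complex Function

/-! ### The Taylor coefficients of the characters -/

/-- A multi-index on a subset of `ℕ`, as an exponent of the variables `X_r`. -/
def exponent {P : ℕ → Prop} (A : {r : ℕ // P r} →₀ ℕ) : ℕ →₀ ℕ := A.mapDomain Subtype.val

theorem weight_exponent {P : ℕ → Prop} (A : {r : ℕ // P r} →₀ ℕ) : weight (exponent A) = wt A := by
  rw [weight, exponent, Finsupp.weight_apply, Finsupp.sum_mapDomain_index_inj Subtype.val_injective,
    wt]
  simp only [smul_eq_mul, mul_comm]

/-- The power of `2πi` in the Taylor coefficient with multi-index `A`. -/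
def coeffConst {P : ℕ → Prop} (A : {r : ℕ // P r} →₀ ℕ) : ℂ :=
  A.prod fun _ a => (2 * Real.pi * I) ^ a

theorem diagEntry_eq {P : ℕ → Prop} (A : {r : ℕ // P r} →₀ ℕ) (τ : ℍ) (S : Maya) :
    diagEntry A τ S = coeffConst A * (cexp (2 * Real.pi * I * τ * eig 1 S) *
      MvPolynomial.eval (fun r => eig r S) (MvPolynomial.monomial (exponent A) 1)) := by
  rw [diagEntry, MvPolynomial.eval_monomial, one_mul, exponent,
    Finsupp.prod_mapDomain_index_inj Subtype.val_injective, coeffConst]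
  simp only [mul_pow, Finsupp.prod_mul]
  ring

theorem summable_diagEntry {P : ℕ → Prop} (A : {r : ℕ // P r} →₀ ℕ) (τ : ℍ) :
    Summable fun S : Maya => diagEntry A τ S := by
  simp only [diagEntry_eq]
  exact (summable_norm_eig _ τ).of_norm.mul_left _

theorem multiFactorial_mul_inv_mul {P : ℕ → Prop} (A : {r : ℕ // P r} →₀ ℕ) (x : ℂ) :
    (multiFactorial A : ℂ) * ((multiFactorial A : ℂ)⁻¹ * x) = x := by
  refine mul_inv_cancel_left₀ ?_ x
  rw [Nat.cast_ne_zero, multiFactorial, Finsupp.prod]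
  exact Finset.prod_ne_zero_iff.2 fun r _ => (A r).factorial_ne_zero

theorem coeff_V (B : {r : ℕ // 2 ≤ r} →₀ ℕ) :
    (fun τ : ℍ => (multiFactorial B : ℂ) * MvPowerSeries.coeff B (V τ)) =
      coeffConst B • traceMap (MvPolynomial.monomial (exponent B) 1) := by
  ext τ
  change (multiFactorial B : ℂ) * ((multiFactorial B : ℂ)⁻¹ * _) = _
  rw [multiFactorial_mul_inv_mul]
  simp only [diagEntry_eq]
  rw [tsum_mul_left]
  rfl

/-- The untwisted case a = b = 0 of the factorization, where the translated power sums are the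
eigenvalues themselves. -/
theorem coeff_Omega (A : {r : ℕ // r ≠ 1} →₀ ℕ) :
    (fun τ : ℍ => (multiFactorial A : ℂ) * MvPowerSeries.coeff A (Omega τ)) =
      coeffConst A • ∑ j ∈ Finset.range
          ((translate (MvPolynomial.monomial (exponent A) 1)).natDegree + 1),
        (fun τ : ℍ => thetaCoeff 0 0 j τ) *
          traceMap ((translate (MvPolynomial.monomial (exponent A) 1)).coeff j) := by
  ext τ
  change (multiFactorial A : ℂ) * ((multiFactorial A : ℂ)⁻¹ * _) = _
  rw [multiFactorial_mul_inv_mul]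
  simp only [diagEntry_eq]
  rw [tsum_mul_left, Pi.smul_apply, smul_eq_mul, Finset.sum_apply]
  congr 1
  refine HasSum.tsum_eq ((hasSum_twistedTerm 0 0 _ τ (Nat.lt_succ_self _)).congr_fun fun S => ?_)
  simp [twistedTerm, powSum_zero_right]

/-- The theta constant has weight j + 1/2 and the trace weight(d) - j - 1/2; the halves cancel,
leaving the integral weight of Ω. -/
theorem sum_thetaCoeff_mul_trace_mem (d : ℕ →₀ ℕ) (N : ℕ) :
    ∑ j ∈ Finset.range N, (fun τ : ℍ => thetaCoeff 0 0 j τ) *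
      traceMap ((translate (MvPolynomial.monomial d 1)).coeff j) ∈ quasi (2 * weight d) := by
  refine sum_mem fun j _ => ?_
  have hwt := bihomogeneous_translate_monomial d j
  by_cases h0 : (translate (MvPolynomial.monomial d 1)).coeff j = 0
  · rw [h0, map_zero, mul_zero]
    exact zero_mem _
  · obtain ⟨d₀, hd₀⟩ := MvPolynomial.ne_zero_iff.1 h0
    have h3 := hwt d₀ hd₀
    have h1 : traceMap ((translate (MvPolynomial.monomial d 1)).coeff j) ∈
        quasi (-1 + 2 * weight d₀) := by
      refine trace_mem_of_forall_monomial fun e he => ?_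
      have h2 := hwt e he
      have h4 := trace_monomial_mem e
      rwa [show weight e = weight d₀ by omega] at h4
    convert mul_mem_quasi (thetaCoeff_zero_zero_mem_quasi j) h1 using 2
    omega

theorem isQuasimodularSeries_Omega : IsQuasimodularSeries 0 Omega := by
  refine ⟨0, by norm_num, level, finiteIndex_level, inf_le_left, fun A => ?_⟩
  refine isQuasimodular_of_mem_quasi theta_ne_zero ?_
  rw [coeff_Omega, zero_add, ← weight_exponent]
  exact (quasi _).smul_mem _ (sum_thetaCoeff_mul_trace_mem _ _)

theorem isQuasimodularSeries_V : IsQuasimodularSeries (-1 / 2) V := by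
  refine ⟨-1, by norm_num, level, finiteIndex_level, inf_le_left, fun B => ?_⟩
  refine isQuasimodular_of_mem_quasi theta_ne_zero ?_
  rw [coeff_V, ← weight_exponent]
  exact (quasi _).smul_mem _ (trace_monomial_mem _)

end InfiniteWedge

end

/-- The character `Ω` of the infinite wedge representation is quasimodular of weight `0`, and its
charge zero part `V` is quasimodular of weight `-1/2`; the traces that are the Taylor coefficients
of `Ω` and `V` converge absolutely. -/
theorem theorem0p2 :
    ((∀ (A : {r : ℕ // r ≠ 1} →₀ ℕ) (τ₁ : UpperHalfPlane),
        Summable fun S : InfiniteWedge.Maya => InfiniteWedge.diagEntry A τ₁ S) ∧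
      InfiniteWedge.IsQuasimodularSeries 0 InfiniteWedge.Omega) ∧
    ((∀ (B : {r : ℕ // 2 ≤ r} →₀ ℕ) (τ₁ : UpperHalfPlane),
        Summable fun S : {S : InfiniteWedge.Maya // InfiniteWedge.eig 0 S = 0} =>
          InfiniteWedge.diagEntry B τ₁ S.1) ∧
      InfiniteWedge.IsQuasimodularSeries (-1 / 2) InfiniteWedge.V) := by
  exact ⟨⟨InfiniteWedge.summable_diagEntry, InfiniteWedge.isQuasimodularSeries_Omega⟩,
    fun B τ₁ => (InfiniteWedge.summable_diagEntry B τ₁).subtype _,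
    InfiniteWedge.isQuasimodularSeries_V⟩
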